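/- Let $(M_i,g_i)$ and $(N_i,g_i')$ ($i=1,2$) be smooth Riemannian manifolds (without boundary) of dimensions $m_i$ and $n_i$, with $M_2\neq\emptyset$, and let $f:M_1\to(0,\infty)$ and $\rho:N_1\to(0,\infty)$ be smooth. Let $M=M_1\times_f M_2$ be $M_1\times M_2$ with the warped product metric $g=g_1+f^2g_2$, and let $N=N_1\times_\rho N_2$ be $N_1\times N_2$ with $g'=g_1'+\rho^2g_2'$. Let $\phi=(\phi_1,\phi_2):M\to N$, $\phi(x,y)=(\phi_1(x),\phi_2(y))$, be a Riemannian warped product submersion, i.e. $\phi_i:(M_i,g_i)\to(N_i,g_i')$ are Riemannian submersions (smooth, onto, with surjective differentials that preserve the lengths of horizontal vectors) and $f=\rho\circ\phi_1$. Let $\psi:M\to\mathbb R$ be smooth and suppose that $\phi$ is Clairaut with $r=e^\psi$: for every geodesic $c$ of $(M,g)$ the function $(r\circ c)\sin\omega$ is constant, where $\omega(t)\in[0,\pi/2]$ is the angle between $\dot c(t)$ and the horizontal space $(\ker\phi_{*c(t)})^\perp$. Let $H_1$ be the mean curvature vector field of the fibers of $\phi_1$ (the mean of $T_{U}U=\mathcal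 H\nabla_{U}U$ over an orthonormal basis of $\ker\phi_{1*}$; $H_1=0$ if $m_1=n_1$), and call $\phi$ harmonic if its tension field $\tau(\phi)=\operatorname{trace}_g(\nabla\phi_*)$ vanishes identically. (a) $\phi$ is harmonic if and only if either $H_1=0$ on $M_1$ and $\nabla\psi=0$ on $M$, or $m_1-n_1=m_2-n_2=0$. (b) Suppose moreover that $M_1$ is connected and that the fibers of $\phi_1$ and of $\phi_2$ either both have positive dimension or both have dimension zero (i.e. $m_1=n_1\iff m_2=n_2$). Then $\phi$ is harmonic if and only if either $(M,g)$ is a Riemannian product (that is, $g$ is the sum of a Riemannian metric on $M_1$ and a Riemannian metric on $M_2$), or $\dim M_1=\dim N_1$ and $\dim M_2=\dim N_2$. (c) If $M_1$ is connected, $m_2>n_2$ and $\phi$ is harmonic, then $(M,g)$ is a Riemannian product. -/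

import Mathlib

open Bundle Manifold Module
open scoped ContDiff

set_option linter.unusedSectionVars false

noncomputable section

namespace ClairautWarped

/-! ### Linear algebra of a positive definite symmetric form -/

theorem nondegenerate_of_pos {V : Type*} [AddCommGroup V] [Module ℝ V]
    {B : LinearMap.BilinForm ℝ V} (hp : ∀ v, v ≠ 0 → 0 < B v v) : B.Nondegenerate := by
  constructor
  · intro v hv
    by_contra h
    exact (hp v h).ne' (hv v)
  · intro v hv
    by_contra h
    exact (hp v h).ne' (hv v)

theorem isCompl_orthogonal_of_pos {V : Type*} [AddCommGroup V] [Module ℝ V]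
    [FiniteDimensional ℝ V] {B : LinearMap.BilinForm ℝ V}
    (hs : ∀ v w, B v w = B w v) (hp : ∀ v, v ≠ 0 → 0 < B v v) (S : Submodule ℝ V) :
    IsCompl S (B.orthogonal S) := by
  refine LinearMap.BilinForm.isCompl_orthogonal_of_restrict_nondegenerate ?_ ?_
  · intro v w h
    rw [hs]
    exact h
  · refine nondegenerate_of_pos ?_
    intro v hv
    exact hp v (fun h => hv (Subtype.ext h))

/-- Every subspace has an orthonormal basis. -/
theorem exists_orthonormal_basis {V : Type*} [AddCommGroup V] [Module ℝ V]
    [FiniteDimensional ℝ V] {B : LinearMap.BilinForm ℝ V}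
    (hs : ∀ v w, B v w = B w v) (hp : ∀ v, v ≠ 0 → 0 < B v v) (S : Submodule ℝ V) :
    ∃ e : Basis (Fin (finrank ℝ S)) ℝ S,
      ∀ i j, B (e i : V) (e j : V) = if i = j then 1 else 0 := by
  let c : InnerProductSpace.Core ℝ S :=
    { inner := fun v w => B (v : V) (w : V)
      conj_inner_symm := fun v w => hs w v
      re_inner_nonneg := fun v => by
        rcases eq_or_ne v 0 with rfl | hv
        · simp
        · simpa using (hp (v : V) (fun h => hv (Subtype.ext h))).le
      add_left := fun u v w => by simp
      smul_left := fun u v r => by simp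
      definite := fun v h => by
        by_contra hv
        exact (hp (v : V) (fun h => hv (Subtype.ext h))).ne' h }
  let _ : NormedAddCommGroup S := c.toNormedAddCommGroup
  let _ : InnerProductSpace ℝ S := InnerProductSpace.ofCore c.toCore
  refine ⟨(stdOrthonormalBasis ℝ S).toBasis, fun i j => ?_⟩
  have h := orthonormal_iff_ite.mp (stdOrthonormalBasis ℝ S).orthonormal i j
  rw [OrthonormalBasis.coe_toBasis]
  exact h

/-! ### Riemannian metrics and their pointwise algebra -/

section Riemannian

variable {E : Type*} [NormedAddCommGroup E] [NormedSpace ℝ E]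
  {H : Type*} [TopologicalSpace H] {I : ModelWithCorners ℝ E H}
  {M : Type*} [TopologicalSpace M] [ChartedSpace H M] [IsManifold I ∞ M]
  {E' : Type*} [NormedAddCommGroup E'] [NormedSpace ℝ E']
  {H' : Type*} [TopologicalSpace H'] {I' : ModelWithCorners ℝ E' H'}
  {M' : Type*} [TopologicalSpace M'] [ChartedSpace H' M']

variable (I M) in
/-- A smooth Riemannian metric on the manifold `M`. -/
abbrev Metric : Type _ :=
  ContMDiffRiemannianMetric I ∞ E (fun p : M => TangentSpace I p)

/-- The metric at `p`, as a bilinear form on the tangent space. -/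
def form (g : Metric I M) (p : M) : LinearMap.BilinForm ℝ (TangentSpace I p) :=
  (ContinuousLinearMap.coeLM ℝ).comp (g.inner p).toLinearMap

theorem form_symm (g : Metric I M) (p : M) (v w : TangentSpace I p) :
    form g p v w = form g p w v := g.symm p v w

theorem form_pos (g : Metric I M) (p : M) (v : TangentSpace I p) (hv : v ≠ 0) :
    0 < form g p v v := g.pos p v hv

/-- The length of a tangent vector. -/
def len (g : Metric I M) (p : M) (v : TangentSpace I p) : ℝ := √(g.inner p v v)

/-- The unoriented angle in `[0, π]` between two tangent vectors
(`π / 2` if one of them is zero). -/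
def angle (g : Metric I M) (p : M) (v w : TangentSpace I p) : ℝ :=
  Real.arccos (g.inner p v w / (len g p v * len g p w))

/-- The vertical space `𝒱_p = ker (dφ_p)` of a map. -/
def vertical (φ : M → M') (p : M) : Submodule ℝ (TangentSpace I p) :=
  LinearMap.ker (mfderiv I I' φ p).toLinearMap

variable (I I') in
/-- The horizontal space `ℋ_p`, the orthogonal complement of the vertical space. -/
def horizontal (g : Metric I M) (φ : M → M') (p : M) : Submodule ℝ (TangentSpace I p) :=
  (form g p).orthogonal (vertical (I := I) (I' := I') φ p)

variable (I I') in
/-- A Riemannian submersion: a smooth surjective map whose differentials are surjective and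
preserve the lengths of horizontal vectors. -/
structure IsRiemannianSubmersion [IsManifold I' ∞ M'] (g : Metric I M) (g' : Metric I' M') (φ : M → M') : Prop where
  contMDiff : ContMDiff I I' ∞ φ
  surjective : Function.Surjective φ
  surjective_mfderiv : ∀ p, Function.Surjective (mfderiv I I' φ p)
  len_mfderiv : ∀ p, ∀ v ∈ horizontal I I' g φ p, len g' (φ p) (mfderiv I I' φ p v) = len g p v

variable [FiniteDimensional ℝ E]

instance (p : M) : FiniteDimensional ℝ (TangentSpace I p) :=
  inferInstanceAs (FiniteDimensional ℝ E)

/-- The tangent vector dual to a covector: `g (sharp g p α, w) = α w`. -/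
def sharp (g : Metric I M) (p : M) (α : TangentSpace I p →ₗ[ℝ] ℝ) : TangentSpace I p :=
  ((form g p).toDual (nondegenerate_of_pos (form_pos g p))).symm α

theorem inner_sharp (g : Metric I M) (p : M) (α : TangentSpace I p →ₗ[ℝ] ℝ)
    (w : TangentSpace I p) : g.inner p (sharp g p α) w = α w :=
  LinearMap.BilinForm.apply_toDual_symm_apply (B := form g p) α w

/-- The gradient of a function. -/
def gradient (g : Metric I M) (ψ : M → ℝ) (p : M) : TangentSpace I p :=
  sharp g p (mfderiv I 𝓘(ℝ, ℝ) ψ p).toLinearMap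

/-- An orthonormal basis of a subspace of a tangent space. -/
def frame (g : Metric I M) (p : M) (S : Submodule ℝ (TangentSpace I p)) :
    Basis (Fin (finrank ℝ S)) ℝ S :=
  (exists_orthonormal_basis (form_symm g p) (form_pos g p) S).choose

theorem inner_frame (g : Metric I M) (p : M) (S : Submodule ℝ (TangentSpace I p))
    (i j : Fin (finrank ℝ S)) :
    g.inner p (frame g p S i : TangentSpace I p) (frame g p S j : TangentSpace I p) =
      if i = j then 1 else 0 :=
  (exists_orthonormal_basis (form_symm g p) (form_pos g p) S).choose_spec i j

theorem isCompl_vertical_horizontal (g : Metric I M) (φ : M → M') (p : M) :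
    IsCompl (vertical (I := I) (I' := I') φ p) (horizontal I I' g φ p) :=
  isCompl_orthogonal_of_pos (form_symm g p) (form_pos g p) _

variable (I I') in
/-- The orthogonal projection onto the vertical space. -/
def verticalProj (g : Metric I M) (φ : M → M') (p : M) :
    TangentSpace I p →ₗ[ℝ] TangentSpace I p :=
  Submodule.projection _ _ (isCompl_vertical_horizontal (I' := I') g φ p)

variable (I I') in
/-- The orthogonal projection onto the horizontal space. -/
def horizontalProj (g : Metric I M) (φ : M → M') (p : M) :
    TangentSpace I p →ₗ[ℝ] TangentSpace I p :=
  Submodule.projection _ _ (isCompl_vertical_horizontal (I' := I') g φ p).symm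

/-! ### The Levi-Civita connection

All derivatives at a point `p` are taken in the preferred chart at `p`.  In Mathlib the tangent
space at `p` is the model space `E`, identified with it through this chart. -/

/-- The matrix of the metric in the chart at `p`, as a function of the point `x`: the form
`(v, w) ↦ g_x(v, w)` on coordinate vectors. -/
def coordMetric (g : Metric I M) (p x : M) : E →L[ℝ] E →L[ℝ] ℝ :=
  (ContinuousLinearMap.precomp ℝ
      ((trivializationAt E (TangentSpace I : M → Type _) p).symmL ℝ x)).comp
    ((g.inner x).comp ((trivializationAt E (TangentSpace I : M → Type _) p).symmL ℝ x))

theorem coordMetric_apply (g : Metric I M) (p x : M) (v w : E) :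
    coordMetric g p x v w =
      g.inner x ((trivializationAt E (TangentSpace I : M → Type _) p).symmL ℝ x v)
        ((trivializationAt E (TangentSpace I : M → Type _) p).symmL ℝ x w) := rfl

/-- The derivative of the metric matrix at `p`: `(u, v, w) ↦ ∂_u g(v, w)`. -/
def coordMetricDeriv (g : Metric I M) (p : M) : E →L[ℝ] E →L[ℝ] E →L[ℝ] ℝ :=
  mfderiv I 𝓘(ℝ, E →L[ℝ] E →L[ℝ] ℝ) (coordMetric g p) p

/-- The Christoffel symbols at `p` of the Levi-Civita connection in the chart at `p`:
`g(Γ(u, v), w) = (∂_u g(v, w) + ∂_v g(u, w) - ∂_w g(u, v)) / 2`. -/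
def christoffel (g : Metric I M) (p : M) (u v : TangentSpace I p) : TangentSpace I p :=
  sharp g p
    ((1 / 2 : ℝ) • (coordMetricDeriv g p u v + coordMetricDeriv g p v u
      - ((coordMetricDeriv g p).flip u).flip v) : E →L[ℝ] ℝ).toLinearMap

variable [IsManifold I' ∞ M'] [FiniteDimensional ℝ E']

/-- The covariant derivative `∇̃_v W` at `p` of a vector field `W` along a map `φ : M → M'`, with
respect to the pullback of the Levi-Civita connection of `M'`: in coordinates
`dW(v) + Γ(dφ v, W)`. -/
def covDerivAlong (g' : Metric I' M') (φ : M → M') (W : ∀ x, TangentSpace I' (φ x))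
    (p : M) (v : TangentSpace I p) : TangentSpace I' (φ p) :=
  letI coordDeriv : TangentSpace I p →L[ℝ] E' := mfderiv I 𝓘(ℝ, E')
    (fun x => (trivializationAt E' (TangentSpace I' : M' → Type _) (φ p) ⟨φ x, W x⟩).2) p
  letI dW : TangentSpace I' (φ p) := coordDeriv v
  dW + christoffel g' (φ p) (mfderiv I I' φ p v) (W p)

/-- The Levi-Civita covariant derivative `∇_v Y` at `p` of a vector field `Y`. -/
def covDeriv (g : Metric I M) (Y : ∀ x : M, TangentSpace I x) (p : M) (v : TangentSpace I p) :
    TangentSpace I p :=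
  covDerivAlong g (fun x => x) Y p v

/-- `c` is a geodesic on the set `s` of parameters: `∇_ċ ċ = 0`. -/
structure IsGeodesicOn (g : Metric I M) (c : ℝ → M) (s : Set ℝ) : Prop where
  contMDiffOn : ContMDiffOn 𝓘(ℝ, ℝ) I 2 c s
  covDeriv_velocity : ∀ t ∈ s,
    covDerivAlong (I := 𝓘(ℝ, ℝ)) g c (fun τ => mfderiv 𝓘(ℝ, ℝ) I c τ (1 : ℝ)) t (1 : ℝ) = 0

/-! ### Harmonic maps -/

/-- The second fundamental form `(∇φ_*)(X, Y) = ∇̃_X (φ_* Y) - φ_* (∇_X Y)` at `p`; the value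
`v = Y_p` is extended to a vector field with constant coordinates in the chart at `p`. -/
def secondFundamentalForm (g : Metric I M) (g' : Metric I' M') (φ : M → M') (p : M)
    (u v : TangentSpace I p) : TangentSpace I' (φ p) :=
  covDerivAlong g' φ (fun x => mfderiv I I' φ x (FiberBundle.extend E v x)) p u
    - mfderiv I I' φ p (covDeriv g (FiberBundle.extend E v) p u)

/-- The tension field, the trace of the second fundamental form. -/
def tensionField (g : Metric I M) (g' : Metric I' M') (φ : M → M') (p : M) :
    TangentSpace I' (φ p) :=
  ∑ i, secondFundamentalForm g g' φ p (frame g p ⊤ i : TangentSpace I p)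
    (frame g p ⊤ i : TangentSpace I p)

/-- A map is harmonic if its tension field vanishes. -/
def IsHarmonic (g : Metric I M) (g' : Metric I' M') (φ : M → M') : Prop :=
  ∀ p, tensionField g g' φ p = 0

/-! ### The geometry of the fibers and the Clairaut condition -/

variable (I I') in
/-- O'Neill's tensor `T_U W = ℋ ∇_U W` on vertical vectors `U`, `W` at `p`; the value `w = W_p` is
extended to the vertical part of a vector field with constant coordinates in the chart at `p`. -/
def fiberTensor (g : Metric I M) (φ : M → M') (p : M) (u w : TangentSpace I p) :
    TangentSpace I p :=
  horizontalProj I I' g φ p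
    (covDeriv g (fun x => verticalProj I I' g φ x (FiberBundle.extend E w x)) p u)

variable (I I') in
/-- The mean curvature vector field of the fibers, `(1 / k) ∑ T_{U_i} U_i` for an orthonormal
basis `U_1, …, U_k` of the vertical space (zero if `k = 0`). -/
def meanCurvature (g : Metric I M) (φ : M → M') (p : M) : TangentSpace I p :=
  (finrank ℝ (vertical (I := I) (I' := I') φ p) : ℝ)⁻¹ •
    ∑ i, fiberTensor I I' g φ p
      (frame g p (vertical (I := I) (I' := I') φ p) i : TangentSpace I p)
      (frame g p (vertical (I := I) (I' := I') φ p) i : TangentSpace I p)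

variable (I I') in
/-- The Clairaut relation with `r`: along every geodesic `c` of `M` (on any open interval), the
function `r(c(t)) sin ω(t)` is constant, where `ω(t)` is the angle between `ċ(t)` and the
horizontal space, that is, between `ċ(t)` and its horizontal part. -/
def IsClairautWith (g : Metric I M) (φ : M → M') (r : M → ℝ) : Prop :=
  ∀ (c : ℝ → M) (s : Set ℝ), IsOpen s → s.OrdConnected → IsGeodesicOn g c s →
    ∃ k : ℝ, ∀ t ∈ s,
      r (c t) * Real.sin (angle g (c t) (mfderiv 𝓘(ℝ, ℝ) I c t (1 : ℝ))
        (horizontalProj I I' g φ (c t) (mfderiv 𝓘(ℝ, ℝ) I c t (1 : ℝ)))) = k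

end Riemannian

/-! ### Warped products -/

section Warped

/-- A family of linear maps on a finite-dimensional space is smooth if its values are. -/
theorem contMDiffAt_clm {E : Type*} [NormedAddCommGroup E] [NormedSpace ℝ E]
    [FiniteDimensional ℝ E] {F : Type*} [NormedAddCommGroup F] [NormedSpace ℝ F]
    {E₀ : Type*} [NormedAddCommGroup E₀] [NormedSpace ℝ E₀]
    {H : Type*} [TopologicalSpace H] {I : ModelWithCorners ℝ E₀ H}
    {M : Type*} [TopologicalSpace M] [ChartedSpace H M] {p : M} (a : M → E →L[ℝ] F)
    (ha : ∀ v, ContMDiffAt I 𝓘(ℝ, F) ∞ (fun x => a x v) p) :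
    ContMDiffAt I 𝓘(ℝ, E →L[ℝ] F) ∞ a p := by
  have hd : finrank ℝ E = finrank ℝ (Fin (finrank ℝ E) → ℝ) := (finrank_fin_fun ℝ).symm
  let e₁ := ContinuousLinearEquiv.ofFinrankEq hd
  let e₂ := (e₁.arrowCongr (1 : F ≃L[ℝ] F)).trans
    (ContinuousLinearEquiv.piRing (Fin (finrank ℝ E)))
  have h2 : ContMDiffAt I 𝓘(ℝ, Fin (finrank ℝ E) → F) ∞ (fun x => e₂ (a x)) p := by
    rw [contMDiffAt_pi_space]
    intro i
    exact ha _
  have h3 := e₂.symm.contDiff.contMDiff.contMDiffAt.comp p h2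
  refine h3.congr_of_eventuallyEq (Filter.Eventually.of_forall fun x => ?_)
  simp

/-- A family of bilinear forms on the tangent spaces whose matrix entries in the charts
are smooth is a smooth section. -/
theorem contMDiff_of_coord {E : Type*} [NormedAddCommGroup E] [NormedSpace ℝ E]
    [FiniteDimensional ℝ E] {H : Type*} [TopologicalSpace H] {I : ModelWithCorners ℝ E H}
    {M : Type*} [TopologicalSpace M] [ChartedSpace H M] [IsManifold I ∞ M]
    (G : ∀ p : M, TangentSpace I p →L[ℝ] TangentSpace I p →L[ℝ] ℝ)
    (hG : ∀ (p : M) (v w : E), ContMDiffAt I 𝓘(ℝ, ℝ) ∞ (fun x =>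
      G x ((trivializationAt E (TangentSpace I : M → Type _) p).symm x v)
        ((trivializationAt E (TangentSpace I : M → Type _) p).symm x w)) p) :
    ContMDiff I (I.prod 𝓘(ℝ, E →L[ℝ] E →L[ℝ] ℝ)) ∞
      (fun p => TotalSpace.mk' (E →L[ℝ] E →L[ℝ] ℝ) p (G p)) := by
  intro p
  rw [contMDiffAt_hom_bundle]
  refine ⟨contMDiffAt_id, ?_⟩
  refine contMDiffAt_clm _ fun v => contMDiffAt_clm _ fun w => ?_
  refine (hG p v w).congr_of_eventuallyEq ?_
  have hb : (trivializationAt E (TangentSpace I : M → Type _) p).baseSet ∈ nhds p :=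
    (trivializationAt E (TangentSpace I : M → Type _) p).open_baseSet.mem_nhds
      (FiberBundle.mem_baseSet_trivializationAt' p)
  filter_upwards [hb] with x hx
  have := inCoordinates_apply_eq₂ (𝕜 := ℝ) (F₁ := E) (F₂ := E) (F₃ := ℝ)
    (E₁ := (TangentSpace I : M → Type _)) (E₂ := (TangentSpace I : M → Type _))
    (E₃ := Bundle.Trivial M ℝ) (x₀ := p) (ϕ := G x) (v := v) (w := w) hx hx (Set.mem_univ _)
  refine this.trans ?_
  simp

variable {E₁ : Type*} [NormedAddCommGroup E₁] [NormedSpace ℝ E₁] [FiniteDimensional ℝ E₁]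
  {H₁ : Type*} [TopologicalSpace H₁] {I₁ : ModelWithCorners ℝ E₁ H₁}
  {M₁ : Type*} [TopologicalSpace M₁] [ChartedSpace H₁ M₁] [IsManifold I₁ ∞ M₁]
  {E₂ : Type*} [NormedAddCommGroup E₂] [NormedSpace ℝ E₂] [FiniteDimensional ℝ E₂]
  {H₂ : Type*} [TopologicalSpace H₂] {I₂ : ModelWithCorners ℝ E₂ H₂}
  {M₂ : Type*} [TopologicalSpace M₂] [ChartedSpace H₂ M₂] [IsManifold I₂ ∞ M₂]

variable (I₁ I₂) in
/-- The differential at `p` of the projection `M₁ × M₂ → M₁`. -/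
def tangentFst (p : M₁ × M₂) : TangentSpace (I₁.prod I₂) p →L[ℝ] TangentSpace I₁ p.1 :=
  mfderiv (I₁.prod I₂) I₁ Prod.fst p

variable (I₁ I₂) in
/-- The differential at `p` of the projection `M₁ × M₂ → M₂`. -/
def tangentSnd (p : M₁ × M₂) : TangentSpace (I₁.prod I₂) p →L[ℝ] TangentSpace I₂ p.2 :=
  mfderiv (I₁.prod I₂) I₂ Prod.snd p

theorem tangentFst_apply (p : M₁ × M₂) (v : TangentSpace (I₁.prod I₂) p) :
    tangentFst I₁ I₂ p v = v.1 := by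
  rw [tangentFst, mfderiv_fst]
  rfl

theorem tangentSnd_apply (p : M₁ × M₂) (v : TangentSpace (I₁.prod I₂) p) :
    tangentSnd I₁ I₂ p v = v.2 := by
  rw [tangentSnd, mfderiv_snd]
  rfl

/-- The form `g₁ + f² g₂` at a point of `M₁ × M₂`. -/
def warpedForm (g₁ : Metric I₁ M₁) (g₂ : Metric I₂ M₂) (f : M₁ → ℝ) (p : M₁ × M₂) :
    TangentSpace (I₁.prod I₂) p →L[ℝ] TangentSpace (I₁.prod I₂) p →L[ℝ] ℝ :=
  (ContinuousLinearMap.precomp ℝ (tangentFst I₁ I₂ p)).comp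
      ((g₁.inner p.1).comp (tangentFst I₁ I₂ p))
    + (f p.1) ^ 2 • (ContinuousLinearMap.precomp ℝ (tangentSnd I₁ I₂ p)).comp
      ((g₂.inner p.2).comp (tangentSnd I₁ I₂ p))

theorem warpedForm_apply (g₁ : Metric I₁ M₁) (g₂ : Metric I₂ M₂) (f : M₁ → ℝ) (p : M₁ × M₂)
    (v w : TangentSpace (I₁.prod I₂) p) :
    warpedForm g₁ g₂ f p v w = g₁.inner p.1 (tangentFst I₁ I₂ p v) (tangentFst I₁ I₂ p w)
      + (f p.1) ^ 2 * g₂.inner p.2 (tangentSnd I₁ I₂ p v) (tangentSnd I₁ I₂ p w) := by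
  simp [warpedForm]

theorem contMDiff_warpedForm (g₁ : Metric I₁ M₁) (g₂ : Metric I₂ M₂) (f : M₁ → ℝ)
    (hf : ContMDiff I₁ 𝓘(ℝ, ℝ) ∞ f) :
    ContMDiff (I₁.prod I₂) ((I₁.prod I₂).prod 𝓘(ℝ, E₁ × E₂ →L[ℝ] E₁ × E₂ →L[ℝ] ℝ)) ∞
      (fun p => TotalSpace.mk' (E₁ × E₂ →L[ℝ] E₁ × E₂ →L[ℝ] ℝ) p (warpedForm g₁ g₂ f p)) := by
  refine contMDiff_of_coord _ fun p v w => ?_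
  simp only [warpedForm_apply]
  have hext : ∀ u : E₁ × E₂, ContMDiffAt (I₁.prod I₂) (I₁.prod I₂).tangent ∞
      (fun x => (⟨x, (trivializationAt (E₁ × E₂)
        (TangentSpace (I₁.prod I₂) : M₁ × M₂ → Type _) p).symm x u⟩ :
        TangentBundle (I₁.prod I₂) (M₁ × M₂))) p := by
    intro u
    rw [contMDiffAt_section]
    refine (contMDiffAt_const (c := u)).congr_of_eventuallyEq ?_
    have hb := (trivializationAt (E₁ × E₂)
      (TangentSpace (I₁.prod I₂) : M₁ × M₂ → Type _) p).open_baseSet.mem_nhds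
      (FiberBundle.mem_baseSet_trivializationAt' p)
    filter_upwards [hb] with x hx
    exact congrArg Prod.snd (Trivialization.apply_mk_symm _ hx u)
  have h1 : ∀ u : E₁ × E₂, ContMDiffAt (I₁.prod I₂) I₁.tangent ∞
      (fun x => (⟨x.1, tangentFst I₁ I₂ x ((trivializationAt (E₁ × E₂)
        (TangentSpace (I₁.prod I₂) : M₁ × M₂ → Type _) p).symm x u)⟩ :
        TangentBundle I₁ M₁)) p := fun u =>
    ((contMDiff_fst (n := ∞)).contMDiff_tangentMap (m := ∞) le_rfl).contMDiffAt.comp p (hext u)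
  have h2 : ∀ u : E₁ × E₂, ContMDiffAt (I₁.prod I₂) I₂.tangent ∞
      (fun x => (⟨x.2, tangentSnd I₁ I₂ x ((trivializationAt (E₁ × E₂)
        (TangentSpace (I₁.prod I₂) : M₁ × M₂ → Type _) p).symm x u)⟩ :
        TangentBundle I₂ M₂)) p := fun u =>
    ((contMDiff_snd (n := ∞)).contMDiff_tangentMap (m := ∞) le_rfl).contMDiffAt.comp p (hext u)
  have k1 := (g₁.contMDiff.contMDiffAt.comp p
    (contMDiffAt_fst (I := I₁) (J := I₂))).clm_bundle_apply₂ (F₁ := E₁) (F₂ := E₁)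
    (E₃ := Bundle.Trivial M₁ ℝ) (h1 v) (h1 w)
  have k2 := (g₂.contMDiff.contMDiffAt.comp p
    (contMDiffAt_snd (I := I₁) (J := I₂))).clm_bundle_apply₂ (F₁ := E₂) (F₂ := E₂)
    (E₃ := Bundle.Trivial M₂ ℝ) (h2 v) (h2 w)
  rw [contMDiffAt_totalSpace] at k1 k2
  have hf' : ContMDiffAt (I₁.prod I₂) 𝓘(ℝ, ℝ) ∞ (fun x : M₁ × M₂ => f x.1) p :=
    hf.contMDiffAt.comp p contMDiffAt_fst
  exact k1.2.add ((hf'.pow 2).mul k2.2)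

/-- The warped product metric `g = g₁ + f² g₂` on `M₁ × M₂`. -/
def warpedMetric (g₁ : Metric I₁ M₁) (g₂ : Metric I₂ M₂) (f : M₁ → ℝ)
    (hf : ContMDiff I₁ 𝓘(ℝ, ℝ) ∞ f) (hf0 : ∀ x, 0 < f x) :
    Metric (I₁.prod I₂) (M₁ × M₂) where
  inner := warpedForm g₁ g₂ f
  symm p v w := by
    simp only [warpedForm_apply]
    rw [g₁.symm, g₂.symm]
  pos p v hv := by
    rw [warpedForm_apply]
    have n1 : ∀ u, 0 ≤ g₁.inner p.1 u u := fun u => by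
      rcases eq_or_ne u 0 with rfl | h
      · simp
      · exact (g₁.pos _ _ h).le
    have n2 : ∀ u, 0 ≤ g₂.inner p.2 u u := fun u => by
      rcases eq_or_ne u 0 with rfl | h
      · simp
      · exact (g₂.pos _ _ h).le
    have hp := pow_pos (hf0 p.1) 2
    by_cases h1 : tangentFst I₁ I₂ p v = 0
    · have h2 : tangentSnd I₁ I₂ p v ≠ 0 := by
        intro h2
        rw [tangentFst_apply] at h1
        rw [tangentSnd_apply] at h2
        exact hv (Prod.ext h1 h2)
      exact add_pos_of_nonneg_of_pos (n1 _) (mul_pos hp (g₂.pos _ _ h2))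
    · exact add_pos_of_pos_of_nonneg (g₁.pos _ _ h1) (mul_nonneg hp.le (n2 _))
  isVonNBounded p := by
    have n1 : ∀ u, 0 ≤ g₁.inner p.1 u u := fun u => by
      rcases eq_or_ne u 0 with rfl | h
      · simp
      · exact (g₁.pos _ _ h).le
    have n2 : ∀ u, 0 ≤ g₂.inner p.2 u u := fun u => by
      rcases eq_or_ne u 0 with rfl | h
      · simp
      · exact (g₂.pos _ _ h).le
    have hp := hf0 p.1
    have b1 : Bornology.IsVonNBounded ℝ {v : E₁ | g₁.inner p.1 v v < 1} := g₁.isVonNBounded p.1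
    have b2 : Bornology.IsVonNBounded ℝ {v : E₂ | g₂.inner p.2 v v < 1} := g₂.isVonNBounded p.2
    have hb := (b1.image (ContinuousLinearMap.inl ℝ E₁ E₂)).add
      (b2.image ((f p.1)⁻¹ • ContinuousLinearMap.inr ℝ E₁ E₂))
    refine Bornology.IsVonNBounded.subset ?_ hb
    intro v hv
    change warpedForm g₁ g₂ f p v v < 1 at hv
    rw [warpedForm_apply, tangentFst_apply, tangentSnd_apply] at hv
    refine ⟨(v.1, 0), ⟨v.1, ?_, rfl⟩, (0, v.2), ⟨f p.1 • v.2, ?_, ?_⟩, ?_⟩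
    · have := mul_nonneg (pow_pos hp 2).le (n2 v.2)
      exact lt_of_le_of_lt (le_add_of_nonneg_right this) hv
    · have h1 := n1 v.1
      have e : ∀ (a : ℝ) (u : TangentSpace I₂ p.2),
          g₂.inner p.2 (a • u) (a • u) = a * (a * g₂.inner p.2 u u) := fun a u => by simp
      refine lt_of_eq_of_lt (e (f p.1) v.2) (lt_of_le_of_lt ?_ hv)
      rw [← mul_assoc, ← sq]
      exact le_add_of_nonneg_left h1
    · change (f p.1)⁻¹ • ((0 : E₁), f p.1 • v.2) = (0, v.2)
      rw [Prod.smul_mk, smul_zero]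
      exact congrArg (Prod.mk 0) (inv_smul_smul₀ hp.ne' v.2)
    · exact Prod.ext (add_zero v.1) (zero_add v.2)
  contMDiff := contMDiff_warpedForm g₁ g₂ f hf

/-- The Riemannian manifold `(M₁ × M₂, g)` is a Riemannian product: `g` is the sum of a metric of
`M₁` and a metric of `M₂`. -/
def IsRiemannianProduct (g : Metric (I₁.prod I₂) (M₁ × M₂)) : Prop :=
  ∃ (h₁ : Metric I₁ M₁) (h₂ : Metric I₂ M₂), ∀ (p : M₁ × M₂) (v w : TangentSpace (I₁.prod I₂) p),
    g.inner p v w = h₁.inner p.1 (tangentFst I₁ I₂ p v) (tangentFst I₁ I₂ p w)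
      + h₂.inner p.2 (tangentSnd I₁ I₂ p v) (tangentSnd I₁ I₂ p w)

variable {F₁ : Type*} [NormedAddCommGroup F₁] [NormedSpace ℝ F₁]
  {K₁ : Type*} [TopologicalSpace K₁] {J₁ : ModelWithCorners ℝ F₁ K₁}
  {N₁ : Type*} [TopologicalSpace N₁] [ChartedSpace K₁ N₁] [IsManifold J₁ ∞ N₁]
  {F₂ : Type*} [NormedAddCommGroup F₂] [NormedSpace ℝ F₂]
  {K₂ : Type*} [TopologicalSpace K₂] {J₂ : ModelWithCorners ℝ F₂ K₂}
  {N₂ : Type*} [TopologicalSpace N₂] [ChartedSpace K₂ N₂] [IsManifold J₂ ∞ N₂]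

/-- `φ = φ₁ × φ₂ : M₁ ×_f M₂ → N₁ ×_ρ N₂` is a Riemannian warped product submersion: `φ₁` and `φ₂`
are Riemannian submersions and `f = ρ ∘ φ₁`. -/
structure IsRiemannianWarpedProductSubmersion (g₁ : Metric I₁ M₁) (g₂ : Metric I₂ M₂) (f : M₁ → ℝ)
    (g₁' : Metric J₁ N₁) (g₂' : Metric J₂ N₂) (ρ : N₁ → ℝ) (φ₁ : M₁ → N₁) (φ₂ : M₂ → N₂) :
    Prop where
  fst : IsRiemannianSubmersion I₁ J₁ g₁ g₁' φ₁
  snd : IsRiemannianSubmersion I₂ J₂ g₂ g₂' φ₂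
  warping : f = ρ ∘ φ₁

end Warped
end ClairautWarped

end

/-!
# Harmonic Clairaut submersions between warped products

Everything is read off from the symmetric form `D = g - φ^* g'` (`defect`) of a Riemannian
submersion `φ : (M, g) → (M', g')`: it is nonnegative, vanishes on horizontal vectors and equals `g`
on vertical ones. With `K(u, v, w) = (∂_u D(v, w) + ∂_v D(u, w) - ∂_w D(u, v)) / 2` (`koszul`),
computed in the chart at a point, the transformation law of the Christoffel symbols under pull-back
gives, for horizontal `X`,

* `g'(∇φ_*(u, v), φ_* X) = -K(u, v, X)` (`IsRiemannianSubmersion.inner_secondFundamentalForm`);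
* `g(T_U U, X) = K(U, U, X)` for vertical `U` (`IsRiemannianSubmersion.inner_fiberTensor`);
* `K = 0` on horizontal vectors, because `D` attains its minimum there
  (`IsRiemannianSubmersion.koszul_horizontal`).

The square of the Clairaut relation with `r = e^ψ` along a geodesic `c` says that
`e^{2ψ} D(ċ, ċ) / g(ċ, ċ)` is constant. Geodesics exist for every initial velocity `v`
(`exists_isGeodesicOn`), so differentiating at time `0` gives
`dψ(v) D(v, v) = -K(v, v, ℋ v)` (`IsClairautWith.dirDeriv_mul_defect`). Comparing coefficients for
`v = U + t X` with `U` vertical and `X` horizontal, one finds `dψ(U) = 0` and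
`dψ(X) g(U, U) = -K(U, U, X)`. Taking the trace in an orthonormal basis adapted to the splitting,
`g'(τ(φ), φ_* X) = k dψ(X)`, where `k` is the dimension of the fibers. Hence `φ` is harmonic if and
only if `k = 0` or `dψ = 0` (`IsClairautWith.isHarmonic_iff`).

For a warped product submersion, `D = D₁ + f² D₂` in product charts. Inserting vectors tangent to
the factors into `dψ(X) g(U, U) = -K(U, U, X)` gives `dψ(X₁, 0) = df(X₁) / f` if the fibers of `φ₂`
have positive dimension (`dirDeriv_fst`), `dψ(0, X₂) = 0` if those of `φ₁` have
(`dirDeriv_snd`), and `H₁ = 0` if `dψ = 0`. Since `f = ρ ∘ φ₁` is constant along the fibers of `φ₁`,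
the vanishing of `dψ` is thereby related to that of `df`, and on a connected `M₁` the latter means
that the warped product is a Riemannian product.
-/

set_option linter.unusedSectionVars false
set_option synthInstance.maxHeartbeats 200000

noncomputable section

namespace ClairautWarped

open Filter Topology

/-! ### Koszul combinations and pull-backs of bilinear forms -/

section Koszul

variable {E : Type*} [NormedAddCommGroup E] [NormedSpace ℝ E]
  {E' : Type*} [NormedAddCommGroup E'] [NormedSpace ℝ E']

/-- The Christoffel symbol of the first kind attached to the derivative
`D u v w = ∂_u B (v, w)` of a bilinear form. -/
def koszul (D : E →L[ℝ] E →L[ℝ] E →L[ℝ] ℝ) (u v w : E) : ℝ :=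
  (1 / 2 : ℝ) * (D u v w + D v u w - D w u v)

theorem koszul_sub {D D₁ D₂ : E →L[ℝ] E →L[ℝ] E →L[ℝ] ℝ}
    (h : ∀ u v w, D u v w = D₁ u v w - D₂ u v w) (u v w : E) :
    koszul D u v w = koszul D₁ u v w - koszul D₂ u v w := by
  simp only [koszul, h]
  ring

theorem koszul_congr {D D' : E →L[ℝ] E →L[ℝ] E →L[ℝ] ℝ} (h : ∀ u, D u = D' u) (u v w : E) :
    koszul D u v w = koszul D' u v w := by
  simp only [koszul, h]

theorem koszul_symm (D : E →L[ℝ] E →L[ℝ] E →L[ℝ] ℝ) (hD : ∀ u v w, D u v w = D u w v)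
    (u v w : E) : koszul D u v w = koszul D v u w := by
  simp only [koszul, hD w u v]
  ring

theorem koszul_add_left (D : E →L[ℝ] E →L[ℝ] E →L[ℝ] ℝ) (u u' v w : E) :
    koszul D (u + u') v w = koszul D u v w + koszul D u' v w := by
  simp only [koszul, map_add, add_apply]
  ring

theorem koszul_smul_left (D : E →L[ℝ] E →L[ℝ] E →L[ℝ] ℝ) (c : ℝ) (u v w : E) :
    koszul D (c • u) v w = c * koszul D u v w := by
  simp only [koszul, map_smul, smul_apply, smul_eq_mul]
  ring

theorem koszul_add_middle (D : E →L[ℝ] E →L[ℝ] E →L[ℝ] ℝ) (u v v' w : E) :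
    koszul D u (v + v') w = koszul D u v w + koszul D u v' w := by
  simp only [koszul, map_add, add_apply]
  ring

theorem koszul_smul_middle (D : E →L[ℝ] E →L[ℝ] E →L[ℝ] ℝ) (c : ℝ) (u v w : E) :
    koszul D u (c • v) w = c * koszul D u v w := by
  simp only [koszul, map_smul, smul_apply, smul_eq_mul]
  ring

theorem koszul_add_right (D : E →L[ℝ] E →L[ℝ] E →L[ℝ] ℝ) (u v w w' : E) :
    koszul D u v (w + w') = koszul D u v w + koszul D u v w' := by
  simp only [koszul, map_add, add_apply]
  ring

theorem koszul_smul_right (D : E →L[ℝ] E →L[ℝ] E →L[ℝ] ℝ) (c : ℝ) (u v w : E) :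
    koszul D u v (c • w) = c * koszul D u v w := by
  simp only [koszul, map_smul, smul_apply, smul_eq_mul]
  ring

variable [FiniteDimensional ℝ E]

theorem contDiffAt_of_apply₂ {F : Type*} [NormedAddCommGroup F] [NormedSpace ℝ F]
    {B : F → E →L[ℝ] E →L[ℝ] ℝ} {y : F} (h : ∀ v w, ContDiffAt ℝ ∞ (fun z => B z v w) y) :
    ContDiffAt ℝ ∞ B y := by
  rw [← contMDiffAt_iff_contDiffAt]
  exact contMDiffAt_clm _ fun v => contMDiffAt_clm _ fun w => (h v w).contMDiffAt

theorem fderiv_apply₂ {F : Type*} [NormedAddCommGroup F] [NormedSpace ℝ F]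
    {B : F → E →L[ℝ] E →L[ℝ] ℝ} {y : F} (h : DifferentiableAt ℝ B y) (u : F) (v w : E) :
    fderiv ℝ (fun z => B z v w) y u = fderiv ℝ B y u v w := by
  have := (h.hasFDerivAt.clm_apply (hasFDerivAt_const v y)).clm_apply (hasFDerivAt_const w y)
  rw [this.fderiv]
  simp

theorem contDiffAt_pullback [FiniteDimensional ℝ E'] {f : E → E'} {y : E}
    (hf : ContDiffAt ℝ ∞ f y)
    {G : E' → E' →L[ℝ] E' →L[ℝ] ℝ} (hG : ContDiffAt ℝ ∞ G (f y))
    {P : E → E →L[ℝ] E →L[ℝ] ℝ}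
    (hP : ∀ᶠ z in 𝓝 y, ∀ v w, P z v w = G (f z) (fderiv ℝ f z v) (fderiv ℝ f z w)) :
    ContDiffAt ℝ ∞ P y := by
  refine contDiffAt_of_apply₂ fun v w => ?_
  have hdf : ContDiffAt ℝ ∞ (fderiv ℝ f) y := hf.fderiv_right le_rfl
  have h : ContDiffAt ℝ ∞ (fun z => G (f z) (fderiv ℝ f z v) (fderiv ℝ f z w)) y :=
    ((hG.comp y hf).clm_apply (hdf.clm_apply contDiffAt_const)).clm_apply
      (hdf.clm_apply contDiffAt_const)
  exact h.congr_of_eventuallyEq (hP.mono fun z hz => hz v w)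

/-- The transformation law of the Christoffel symbols of the first kind under pull-back by an
arbitrary smooth map. -/
theorem koszul_pullback [FiniteDimensional ℝ E'] {f : E → E'} {y : E}
    (hf : ContDiffAt ℝ ∞ f y)
    {G : E' → E' →L[ℝ] E' →L[ℝ] ℝ} (hG : ContDiffAt ℝ ∞ G (f y))
    (hs : ∀ v w, G (f y) v w = G (f y) w v)
    {P : E → E →L[ℝ] E →L[ℝ] ℝ}
    (hP : ∀ᶠ z in 𝓝 y, ∀ v w, P z v w = G (f z) (fderiv ℝ f z v) (fderiv ℝ f z w))
    (u v w : E) :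
    koszul (fderiv ℝ P y) u v w =
      koszul (fderiv ℝ G (f y)) (fderiv ℝ f y u) (fderiv ℝ f y v) (fderiv ℝ f y w)
        + G (f y) (fderiv ℝ (fderiv ℝ f) y u v) (fderiv ℝ f y w) := by
  have hPd := (contDiffAt_pullback hf hG hP).differentiableAt (by simp)
  have hdf : DifferentiableAt ℝ (fderiv ℝ f) y :=
    (hf.fderiv_right (m := ∞) le_rfl).differentiableAt (by simp)
  have hfd := hf.differentiableAt (by simp)
  have hGd := hG.differentiableAt (by simp)
  have key : ∀ u v w, fderiv ℝ P y u v w =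
      fderiv ℝ G (f y) (fderiv ℝ f y u) (fderiv ℝ f y v) (fderiv ℝ f y w)
        + G (f y) (fderiv ℝ (fderiv ℝ f) y u v) (fderiv ℝ f y w)
        + G (f y) (fderiv ℝ f y v) (fderiv ℝ (fderiv ℝ f) y u w) := by
    intro u v w
    have he : (fun z => P z v w) =ᶠ[𝓝 y]
        fun z => G (f z) (fderiv ℝ f z v) (fderiv ℝ f z w) := hP.mono fun z hz => hz v w
    rw [← fderiv_apply₂ hPd, he.fderiv_eq]
    have h1 := hdf.hasFDerivAt.clm_apply (hasFDerivAt_const v y)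
    have h2 := hdf.hasFDerivAt.clm_apply (hasFDerivAt_const w y)
    have h3 := ((hGd.hasFDerivAt.comp y hfd.hasFDerivAt).clm_apply h1).clm_apply h2
    refine (congrArg (fun L => L u) h3.fderiv).trans ?_
    simp
    ring
  have hsymm : ∀ a b, fderiv ℝ (fderiv ℝ f) y a b = fderiv ℝ (fderiv ℝ f) y b a := fun a b =>
    (hf.isSymmSndFDerivAt
      (by rw [minSmoothness_of_isRCLikeNormedField]; exact ENat.LEInfty.out)).eq a b
  simp only [koszul, key]
  rw [hsymm v u, hsymm w u, hsymm w v, hs (fderiv ℝ f y v), hs (fderiv ℝ f y u)]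
  ring

end Koszul

/-! ### Bilinear forms and maps in the preferred charts -/

section Local

variable {E : Type*} [NormedAddCommGroup E] [NormedSpace ℝ E] [FiniteDimensional ℝ E]
  {H : Type*} [TopologicalSpace H] {I : ModelWithCorners ℝ E H} [I.Boundaryless]
  {M : Type*} [TopologicalSpace M] [ChartedSpace H M] [IsManifold I ∞ M]
  {E' : Type*} [NormedAddCommGroup E'] [NormedSpace ℝ E'] [FiniteDimensional ℝ E']
  {H' : Type*} [TopologicalSpace H'] {I' : ModelWithCorners ℝ E' H'} [I'.Boundaryless]
  {M' : Type*} [TopologicalSpace M'] [ChartedSpace H' M'] [IsManifold I' ∞ M']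

instance : IsManifold I 1 M := IsManifold.of_le (n := ∞) (by simp)

/-- The coordinate expression, in the chart at `p`, of a field of bilinear forms on the tangent
spaces. -/
def localForm (B : ∀ x : M, TangentSpace I x →L[ℝ] TangentSpace I x →L[ℝ] ℝ) (p : M) (y : E) :
    E →L[ℝ] E →L[ℝ] ℝ :=
  letI x := (extChartAt I p).symm y
  (ContinuousLinearMap.precomp ℝ
      ((trivializationAt E (TangentSpace I : M → Type _) p).symmL ℝ x)).comp
    ((B x).comp ((trivializationAt E (TangentSpace I : M → Type _) p).symmL ℝ x))

theorem localForm_apply (B : ∀ x : M, TangentSpace I x →L[ℝ] TangentSpace I x →L[ℝ] ℝ) (p : M)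
    (y v w : E) : localForm B p y v w = B ((extChartAt I p).symm y)
      ((trivializationAt E (TangentSpace I : M → Type _) p).symmL ℝ ((extChartAt I p).symm y) v)
      ((trivializationAt E (TangentSpace I : M → Type _) p).symmL ℝ ((extChartAt I p).symm y) w) :=
  rfl

theorem localForm_chart (B : ∀ x : M, TangentSpace I x →L[ℝ] TangentSpace I x →L[ℝ] ℝ) {p x : M}
    (hx : x ∈ (extChartAt I p).source) (v w : E) :
    localForm B p (extChartAt I p x) v w = B x
      ((trivializationAt E (TangentSpace I : M → Type _) p).symmL ℝ x v)
      ((trivializationAt E (TangentSpace I : M → Type _) p).symmL ℝ x w) := by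
  rw [localForm_apply, (extChartAt I p).left_inv hx]

theorem symmL_self (p : M) (v : E) :
    (trivializationAt E (TangentSpace I : M → Type _) p).symmL ℝ p v = v := by
  rw [TangentBundle.symmL_trivializationAt_eq_core (mem_chart_source H p)]
  exact (tangentBundleCore I M).coordChange_self (achart H p) p (mem_chart_source H p) v

theorem localForm_self (B : ∀ x : M, TangentSpace I x →L[ℝ] TangentSpace I x →L[ℝ] ℝ) (p : M)
    (v w : E) : localForm B p (extChartAt I p p) v w = B p v w := by
  rw [localForm_chart B (mem_extChartAt_source p), symmL_self, symmL_self]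

theorem symmL_eq_mfderiv {p : M} {y : E} (hy : y ∈ (extChartAt I p).target) (v : E) :
    (trivializationAt E (TangentSpace I : M → Type _) p).symmL ℝ ((extChartAt I p).symm y) v =
      mfderiv 𝓘(ℝ, E) I (extChartAt I p).symm y v := by
  have hs : (extChartAt I p).symm y ∈ (chartAt H p).source := by
    rw [← extChartAt_source I]
    exact (extChartAt I p).map_target hy
  rw [TangentBundle.symmL_trivializationAt hs, I.range_eq_univ, mfderivWithin_univ]
  have : ∀ z, z = y → (mfderiv 𝓘(ℝ, E) I (extChartAt I p).symm z v : E) =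
      mfderiv 𝓘(ℝ, E) I (extChartAt I p).symm y v := by
    rintro _ rfl
    rfl
  exact this _ ((extChartAt I p).right_inv hy)

theorem mdifferentiableAt_extChartAt_symm {p : M} {y : E} (hy : y ∈ (extChartAt I p).target) :
    MDifferentiableAt 𝓘(ℝ, E) I (extChartAt I p).symm y := by
  have := mdifferentiableWithinAt_extChartAt_symm hy
  rwa [I.range_eq_univ, mdifferentiableWithinAt_univ] at this

variable (I I') in
/-- The coordinate expression of a map in the charts at `p` and `q`. -/
abbrev chartMap (φ : M → M') (p : M) (q : M') : E → E' :=
  extChartAt I' q ∘ φ ∘ (extChartAt I p).symm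

/-- The chain rule for a map read in charts. -/
theorem fderiv_chartMap {φ : M → M'} {p : M} {q : M'} {y : E}
    (hy : y ∈ (extChartAt I p).target)
    (hφ : MDifferentiableAt I I' φ ((extChartAt I p).symm y))
    (hq : φ ((extChartAt I p).symm y) ∈ (extChartAt I' q).source) (v : E) :
    fderiv ℝ (chartMap I I' φ p q) y v =
      (trivializationAt E' (TangentSpace I' : M' → Type _) q).continuousLinearMapAt ℝ
        (φ ((extChartAt I p).symm y))
        (mfderiv I I' φ ((extChartAt I p).symm y)
          ((trivializationAt E (TangentSpace I : M → Type _) p).symmL ℝ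
            ((extChartAt I p).symm y) v)) := by
  have hq' : φ ((extChartAt I p).symm y) ∈ (chartAt H' q).source := by
    rwa [← extChartAt_source I']
  have h1 := mdifferentiableAt_extChartAt_symm hy
  have h3 : MDifferentiableAt I' 𝓘(ℝ, E') (extChartAt I' q) (φ ((extChartAt I p).symm y)) :=
    mdifferentiableAt_extChartAt hq'
  rw [symmL_eq_mfderiv hy, TangentBundle.continuousLinearMapAt_trivializationAt hq',
    ← mfderiv_eq_fderiv]
  have h2 : MDifferentiableAt 𝓘(ℝ, E) I' (φ ∘ (extChartAt I p).symm) y := hφ.comp y h1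
  rw [mfderiv_comp y h3 h2, mfderiv_comp y hφ h1]
  rfl

theorem contDiffAt_chartMap {φ : M → M'} (hφ : ContMDiff I I' ∞ φ) {p : M} {q : M'} {y : E}
    (hy : y ∈ (extChartAt I p).target)
    (hq : φ ((extChartAt I p).symm y) ∈ (extChartAt I' q).source) :
    ContDiffAt ℝ ∞ (chartMap I I' φ p q) y := by
  rw [← contMDiffAt_iff_contDiffAt]
  have h1 : ContMDiffAt 𝓘(ℝ, E) I ∞ (extChartAt I p).symm y :=
    (contMDiffOn_extChartAt_symm p).contMDiffAt ((isOpen_extChartAt_target p).mem_nhds hy)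
  have h3 : ContMDiffAt I' 𝓘(ℝ, E') ∞ (extChartAt I' q) (φ ((extChartAt I p).symm y)) :=
    contMDiffAt_extChartAt' (by rwa [← extChartAt_source I'])
  exact h3.comp y (hφ.contMDiffAt.comp y h1)

theorem eventually_chartMap {φ : M → M'} (hφ : Continuous φ) {p : M} {q : M'} {y : E}
    (hy : y ∈ (extChartAt I p).target)
    (hq : φ ((extChartAt I p).symm y) ∈ (extChartAt I' q).source) :
    ∀ᶠ z in 𝓝 y, z ∈ (extChartAt I p).target ∧
      φ ((extChartAt I p).symm z) ∈ (extChartAt I' q).source := by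
  have ht := (isOpen_extChartAt_target (I := I) p).mem_nhds hy
  have hc : ContinuousAt (φ ∘ (extChartAt I p).symm) y :=
    hφ.continuousAt.comp ((continuousOn_extChartAt_symm p).continuousAt ht)
  exact (eventually_mem_set.2 ht).and
    (hc.eventually ((isOpen_extChartAt_source (I := I') q).mem_nhds hq))

/-- The pull-back of a Riemannian metric by a map. -/
def pullbackForm (g' : Metric I' M') (φ : M → M') (x : M) :
    TangentSpace I x →L[ℝ] TangentSpace I x →L[ℝ] ℝ :=
  (ContinuousLinearMap.precomp ℝ (mfderiv I I' φ x)).comp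
    ((g'.inner (φ x)).comp (mfderiv I I' φ x))

theorem pullbackForm_apply (g' : Metric I' M') (φ : M → M') (x : M) (v w : TangentSpace I x) :
    pullbackForm g' φ x v w = g'.inner (φ x) (mfderiv I I' φ x v) (mfderiv I I' φ x w) := rfl

theorem localForm_pullbackForm (g' : Metric I' M') {φ : M → M'} {p : M} {q : M'} {y : E}
    (hy : y ∈ (extChartAt I p).target)
    (hφ : MDifferentiableAt I I' φ ((extChartAt I p).symm y))
    (hq : φ ((extChartAt I p).symm y) ∈ (extChartAt I' q).source) (v w : E) :
    localForm (pullbackForm (I := I) g' φ) p y v w =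
      localForm g'.inner q ((chartMap I I' φ p q) y)
        (fderiv ℝ (chartMap I I' φ p q) y v)
        (fderiv ℝ (chartMap I I' φ p q) y w) := by
  have hb : φ ((extChartAt I p).symm y) ∈
      (trivializationAt E' (TangentSpace I' : M' → Type _) q).baseSet := by
    rwa [TangentBundle.trivializationAt_baseSet, ← extChartAt_source I']
  rw [fderiv_chartMap hy hφ hq, fderiv_chartMap hy hφ hq]
  refine Eq.trans ?_ (localForm_chart g'.inner hq _ _).symm
  rw [Trivialization.symmL_continuousLinearMapAt _ hb,
    Trivialization.symmL_continuousLinearMapAt _ hb]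
  rfl

theorem localForm_inner_eq_of_id (g : Metric I M) {p q : M} {y : E}
    (hy : y ∈ (extChartAt I p).target)
    (hq : (extChartAt I p).symm y ∈ (extChartAt I q).source) (v w : E) :
    localForm g.inner p y v w =
      localForm g.inner q ((chartMap I I id p q) y)
        (fderiv ℝ (chartMap I I id p q) y v)
        (fderiv ℝ (chartMap I I id p q) y w) := by
  rw [← localForm_pullbackForm (I := I) g hy mdifferentiableAt_id hq, localForm_apply,
    localForm_apply, pullbackForm_apply]
  simp only [mfderiv_id]
  rfl

theorem contDiffAt_localForm_inner (g : Metric I M) (p : M) :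
    ContDiffAt ℝ ∞ (localForm g.inner p) (extChartAt I p p) := by
  refine contDiffAt_of_apply₂ fun v w => ?_
  have h := (contMDiffAt_hom_bundle _).1 (g.contMDiff p)
  have h1 : ContMDiffAt I 𝓘(ℝ, ℝ) ∞ (fun x => g.inner x
      ((trivializationAt E (TangentSpace I : M → Type _) p).symmL ℝ x v)
      ((trivializationAt E (TangentSpace I : M → Type _) p).symmL ℝ x w)) p := by
    refine ((h.2.clm_apply (contMDiffAt_const (c := v))).clm_apply
      (contMDiffAt_const (c := w))).congr_of_eventuallyEq ?_
    have hb : (trivializationAt E (TangentSpace I : M → Type _) p).baseSet ∈ nhds p :=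
      (trivializationAt E (TangentSpace I : M → Type _) p).open_baseSet.mem_nhds
        (FiberBundle.mem_baseSet_trivializationAt' p)
    filter_upwards [hb] with x hx
    have := inCoordinates_apply_eq₂ (𝕜 := ℝ) (F₁ := E) (F₂ := E) (F₃ := ℝ)
      (E₁ := (TangentSpace I : M → Type _)) (E₂ := (TangentSpace I : M → Type _))
      (E₃ := Bundle.Trivial M ℝ) (x₀ := p) (ϕ := g.inner x) (v := v) (w := w) hx hx
      (Set.mem_univ _)
    refine Eq.trans ?_ this.symm
    rw [Trivialization.symmL_apply _ hx, Trivialization.symmL_apply _ hx]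
    simp
  rw [← contMDiffAt_iff_contDiffAt]
  have h2 : ContMDiffAt 𝓘(ℝ, E) I ∞ (extChartAt I p).symm (extChartAt I p p) :=
    (contMDiffOn_extChartAt_symm p).contMDiffAt (extChartAt_target_mem_nhds p)
  rw [← (extChartAt I p).left_inv (mem_extChartAt_source p)] at h1
  exact ContMDiffAt.comp (extChartAt I p p) (by simpa using h1) h2

theorem contDiffAt_localForm_pullbackForm (g' : Metric I' M') {φ : M → M'}
    (hφ : ContMDiff I I' ∞ φ) (p : M) :
    ContDiffAt ℝ ∞ (localForm (pullbackForm (I := I) g' φ) p) (extChartAt I p p) := by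
  have hy := mem_extChartAt_target (I := I) p
  have hq : φ ((extChartAt I p).symm (extChartAt I p p)) ∈ (extChartAt I' (φ p)).source := by
    simp
  refine contDiffAt_pullback (contDiffAt_chartMap hφ hy hq) (G := localForm g'.inner (φ p)) ?_ ?_
  · simpa using contDiffAt_localForm_inner g' (φ p)
  · filter_upwards [eventually_chartMap hφ.continuous hy hq] with z hz v w
    exact localForm_pullbackForm g' hz.1 (hφ.mdifferentiableAt (by simp)) hz.2 v w

/-- The manifold derivative of a vector-valued map is computed in the preferred chart. -/
theorem mfderiv_eq_fderiv_chart {F : Type*} [NormedAddCommGroup F] [NormedSpace ℝ F] {f : M → F}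
    {p : M} {h : E → F} (hh : DifferentiableAt ℝ h (extChartAt I p p))
    (hf : f ∘ (extChartAt I p).symm =ᶠ[𝓝 (extChartAt I p p)] h) (v : TangentSpace I p) :
    mfderiv I 𝓘(ℝ, F) f p v = fderiv ℝ h (extChartAt I p p) v := by
  have hfd : DifferentiableAt ℝ (f ∘ (extChartAt I p).symm) (extChartAt I p p) :=
    hf.differentiableAt_iff.2 hh
  have hc : ContinuousAt f p := by
    have h1 : ContinuousAt (f ∘ (extChartAt I p).symm ∘ extChartAt I p) p :=
      ContinuousAt.comp (g := f ∘ (extChartAt I p).symm) hfd.continuousAt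
        (continuousAt_extChartAt p)
    refine h1.congr ?_
    filter_upwards [extChartAt_source_mem_nhds (I := I) p] with x hx
    exact congrArg f ((extChartAt I p).left_inv hx)
  have hm : HasMFDerivAt I 𝓘(ℝ, F) f p (fderiv ℝ h (extChartAt I p p)) := by
    have hd : HasFDerivAt (f ∘ (extChartAt I p).symm) (fderiv ℝ h (extChartAt I p p))
        (extChartAt I p p) := (hf.fderiv_eq (𝕜 := ℝ)) ▸ hfd.hasFDerivAt
    have hw : HasFDerivWithinAt (writtenInExtChartAt I 𝓘(ℝ, F) p f)
        (fderiv ℝ h (extChartAt I p p)) (Set.range I) (extChartAt I p p) := hd.hasFDerivWithinAt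
    exact ⟨hc, hw⟩
  exact DFunLike.congr_fun hm.mfderiv v

end Local

/-! ### The second fundamental form in coordinates -/

section SecondFundamentalForm

variable {E : Type*} [NormedAddCommGroup E] [NormedSpace ℝ E] [FiniteDimensional ℝ E]
  {H : Type*} [TopologicalSpace H] {I : ModelWithCorners ℝ E H} [I.Boundaryless]
  {M : Type*} [TopologicalSpace M] [ChartedSpace H M] [IsManifold I ∞ M]
  {E' : Type*} [NormedAddCommGroup E'] [NormedSpace ℝ E'] [FiniteDimensional ℝ E']
  {H' : Type*} [TopologicalSpace H'] {I' : ModelWithCorners ℝ E' H'} [I'.Boundaryless]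
  {M' : Type*} [TopologicalSpace M'] [ChartedSpace H' M'] [IsManifold I' ∞ M']

theorem inner_christoffel (g : Metric I M) (p : M) (u v w : TangentSpace I p) :
    g.inner p (christoffel g p u v) w =
      koszul (fderiv ℝ (localForm g.inner p) (extChartAt I p p)) u v w := by
  have h : ∀ a : E, coordMetricDeriv g p a =
      fderiv ℝ (localForm g.inner p) (extChartAt I p p) a := fun a =>
    mfderiv_eq_fderiv_chart ((contDiffAt_localForm_inner g p).differentiableAt (by simp))
      (Eventually.of_forall fun z => rfl) a
  have key : ∀ (D : E →L[ℝ] E →L[ℝ] E →L[ℝ] ℝ) (u v w : E),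
      ((1 / 2 : ℝ) • (D u v + D v u - (D.flip u).flip v) : E →L[ℝ] ℝ) w = koszul D u v w :=
    fun D u v w => by simp [koszul]
  exact ((inner_sharp g p _ w).trans (key (coordMetricDeriv g p) u v w)).trans
    (koszul_congr h u v w)

theorem continuousLinearMapAt_self (p : M) (v : E) :
    (trivializationAt E (TangentSpace I : M → Type _) p).continuousLinearMapAt ℝ p v = v := by
  have h := Trivialization.continuousLinearMapAt_symmL (R := ℝ)
    (trivializationAt E (TangentSpace I : M → Type _) p)
    (FiberBundle.mem_baseSet_trivializationAt' p) v
  have h' : ∀ a : E, a = v →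
      (trivializationAt E (TangentSpace I : M → Type _) p).continuousLinearMapAt ℝ p a = v →
      (trivializationAt E (TangentSpace I : M → Type _) p).continuousLinearMapAt ℝ p v = v := by
    rintro _ rfl h
    exact h
  exact h' _ (symmL_self p v) h

theorem extend_eq_symmL {p x : M} (hx : x ∈ (extChartAt I p).source) (v : TangentSpace I p) :
    FiberBundle.extend E v x =
      (trivializationAt E (TangentSpace I : M → Type _) p).symmL ℝ x v := by
  have hb : x ∈ (trivializationAt E (TangentSpace I : M → Type _) p).baseSet := by
    rwa [TangentBundle.trivializationAt_baseSet, ← extChartAt_source I]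
  have h1 : ((trivializationAt E (TangentSpace I : M → Type _) p) ⟨p, v⟩).2 = v :=
    (Trivialization.continuousLinearMapAt_apply_of_mem (R := ℝ) _
      (FiberBundle.mem_baseSet_trivializationAt' p) v).symm.trans
        (continuousLinearMapAt_self (I := I) (E := E) p v)
  exact (congrArg _ h1).trans (Trivialization.symmL_apply (R := ℝ) _ hb v).symm

variable (I) in
/-- The tangent vector at `p` with given coordinates in the chart at `p`. -/
def ofCoord (p : M) (v : E) : TangentSpace I p := v

theorem covDerivAlong_eq (g' : Metric I' M') (φ : M → M') {W : ∀ x, TangentSpace I' (φ x)} {p : M}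
    {h : E → E'} (hh : DifferentiableAt ℝ h (extChartAt I p p))
    (hW : ∀ᶠ z in 𝓝 (extChartAt I p p), (trivializationAt E' (TangentSpace I' : M' → Type _) (φ p)
      ⟨φ ((extChartAt I p).symm z), W ((extChartAt I p).symm z)⟩).2 = h z)
    (v : TangentSpace I p) :
    covDerivAlong g' φ W p v =
      ofCoord I' (φ p) (fderiv ℝ h (extChartAt I p p) v)
        + christoffel g' (φ p) (mfderiv I I' φ p v) (W p) := by
  have hd := mfderiv_eq_fderiv_chart (f := fun x =>
    (trivializationAt E' (TangentSpace I' : M' → Type _) (φ p) ⟨φ x, W x⟩).2) hh hW v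
  exact congrArg (fun a : TangentSpace I' (φ p) =>
    a + christoffel g' (φ p) (mfderiv I I' φ p v) (W p)) hd

theorem covDeriv_eq (g : Metric I M) {Y : ∀ x : M, TangentSpace I x} {p : M}
    {h : E → E} (hh : DifferentiableAt ℝ h (extChartAt I p p))
    (hY : ∀ᶠ z in 𝓝 (extChartAt I p p), (trivializationAt E (TangentSpace I : M → Type _) p
      ⟨(extChartAt I p).symm z, Y ((extChartAt I p).symm z)⟩).2 = h z)
    (v : TangentSpace I p) :
    covDeriv g Y p v =
      ofCoord I p (fderiv ℝ h (extChartAt I p p) v) + christoffel g p v (Y p) := by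
  rw [covDeriv, covDerivAlong_eq g (fun x => x) hh hY v]
  have : mfderiv I I (fun x : M => x) p = ContinuousLinearMap.id ℝ (TangentSpace I p) := mfderiv_id
  rw [this]
  rfl

theorem trivialization_mfderiv_extend {φ : M → M'} (hφ : ContMDiff I I' ∞ φ) (p : M) (v : E) :
    ∀ᶠ z in 𝓝 (extChartAt I p p), (trivializationAt E' (TangentSpace I' : M' → Type _) (φ p)
      ⟨φ ((extChartAt I p).symm z), mfderiv I I' φ ((extChartAt I p).symm z)
        (FiberBundle.extend E (E := (TangentSpace I : M → Type _)) (x := p) v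
          ((extChartAt I p).symm z))⟩).2 =
      fderiv ℝ (chartMap I I' φ p (φ p)) z v := by
  filter_upwards [eventually_chartMap (I' := I') (q := φ p) hφ.continuous
    (mem_extChartAt_target (I := I) p) (by simp)] with z hz
  have hb : φ ((extChartAt I p).symm z) ∈
      (trivializationAt E' (TangentSpace I' : M' → Type _) (φ p)).baseSet := by
    rw [TangentBundle.trivializationAt_baseSet, ← extChartAt_source I']
    exact hz.2
  rw [fderiv_chartMap hz.1 (hφ.mdifferentiableAt (by simp)) hz.2,
    ← Trivialization.continuousLinearMapAt_apply_of_mem (R := ℝ) _ hb]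
  exact congrArg (fun a => (trivializationAt E' (TangentSpace I' : M' → Type _)
    (φ p)).continuousLinearMapAt ℝ _ (mfderiv I I' φ ((extChartAt I p).symm z) a))
      (extend_eq_symmL ((extChartAt I p).map_target hz.1) v)

theorem trivialization_extend (p : M) (v : E) :
    ∀ᶠ z in 𝓝 (extChartAt I p p), (trivializationAt E (TangentSpace I : M → Type _) p
      ⟨(extChartAt I p).symm z, FiberBundle.extend E (E := (TangentSpace I : M → Type _)) (x := p) v
          ((extChartAt I p).symm z)⟩).2 = v := by
  filter_upwards [extChartAt_target_mem_nhds (I := I) p] with z hz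
  have hb : (extChartAt I p).symm z ∈
      (trivializationAt E (TangentSpace I : M → Type _) p).baseSet := by
    rw [TangentBundle.trivializationAt_baseSet, ← extChartAt_source I]
    exact (extChartAt I p).map_target hz
  rw [← Trivialization.continuousLinearMapAt_apply_of_mem (R := ℝ) _ hb]
  exact (congrArg (fun a => (trivializationAt E (TangentSpace I : M → Type _)
    p).continuousLinearMapAt ℝ ((extChartAt I p).symm z) a)
      (extend_eq_symmL ((extChartAt I p).map_target hz) v)).trans
    (Trivialization.continuousLinearMapAt_symmL _ hb v)

theorem differentiableAt_fderiv_chartMap {φ : M → M'} (hφ : ContMDiff I I' ∞ φ) (p : M) :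
    DifferentiableAt ℝ (fderiv ℝ (chartMap I I' φ p (φ p))) (extChartAt I p p) :=
  ((contDiffAt_chartMap hφ (mem_extChartAt_target (I := I) p) (by simp)).fderiv_right
    (m := ∞) le_rfl).differentiableAt (by simp)

theorem secondFundamentalForm_eq (g : Metric I M) (g' : Metric I' M') {φ : M → M'}
    (hφ : ContMDiff I I' ∞ φ) (p : M) (u v : E) :
    secondFundamentalForm g g' φ p u v =
      ofCoord I' (φ p) (fderiv ℝ (fderiv ℝ (chartMap I I' φ p (φ p))) (extChartAt I p p) u v)
        + christoffel g' (φ p) (mfderiv I I' φ p u) (mfderiv I I' φ p v)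
        - mfderiv I I' φ p (christoffel g p u v) := by
  have hdf := differentiableAt_fderiv_chartMap hφ p
  have hval : FiberBundle.extend E (E := (TangentSpace I : M → Type _)) (x := p) v p = v :=
    FiberBundle.extend_apply_self E (E := (TangentSpace I : M → Type _)) (x := p) v
  have h1 := covDerivAlong_eq g' φ (h := fun z => fderiv ℝ (chartMap I I' φ p (φ p)) z v)
    (W := fun x => mfderiv I I' φ x
      (FiberBundle.extend E (E := (TangentSpace I : M → Type _)) (x := p) v x))
    (hdf.clm_apply (differentiableAt_const _)) (trivialization_mfderiv_extend hφ p v) u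
  have h1' : fderiv ℝ (fun z => fderiv ℝ (chartMap I I' φ p (φ p)) z v) (extChartAt I p p) u =
      fderiv ℝ (fderiv ℝ (chartMap I I' φ p (φ p))) (extChartAt I p p) u v := by
    rw [(hdf.hasFDerivAt.clm_apply (hasFDerivAt_const v _)).fderiv]
    simp
  have h2 := covDeriv_eq g (h := fun _ => v)
    (Y := fun x => FiberBundle.extend E (E := (TangentSpace I : M → Type _)) (x := p) v x)
    (differentiableAt_const _) (trivialization_extend p v) u
  have h2' : fderiv ℝ (fun _ : E => v) (extChartAt I p p) u = 0 := by simp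
  rw [h1'] at h1
  rw [h2'] at h2
  have h0 : ofCoord I p 0 = 0 := rfl
  rw [h0, zero_add] at h2
  simp only [hval] at h1 h2
  exact congrArg₂ (fun a b => a - mfderiv I I' φ p b) h1 h2

theorem chartMap_self (φ : M → M') (p : M) (q : M') :
    chartMap I I' φ p q (extChartAt I p p) = extChartAt I' q (φ p) := by
  simp [chartMap]

/-- The derivative at the base point of a map read in the preferred charts. -/
theorem fderiv_chartMap_self {φ : M → M'} {p : M} (hφ : MDifferentiableAt I I' φ p) (v : E) :
    fderiv ℝ (chartMap I I' φ p (φ p)) (extChartAt I p p) v = mfderiv I I' φ p v := by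
  have hp := (extChartAt I p).left_inv (mem_extChartAt_source (I := I) p)
  have h := fderiv_chartMap (I := I) (I' := I') (φ := φ) (q := φ p)
    (mem_extChartAt_target (I := I) p) (by rwa [hp]) (by simp) v
  rw [hp] at h
  rw [h]
  exact (continuousLinearMapAt_self (I := I') (φ p) _).trans
    (congrArg (mfderiv I I' φ p) (symmL_self p v))

/-- The second fundamental form is the difference of the Christoffel symbols of the pulled back form
`φ^* g'`, possibly degenerate, and of `g`. -/
theorem inner_secondFundamentalForm (g : Metric I M) (g' : Metric I' M') {φ : M → M'}
    (hφ : ContMDiff I I' ∞ φ) (p : M) (u v w : E) :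
    g'.inner (φ p) (secondFundamentalForm g g' φ p u v) (mfderiv I I' φ p w) =
      koszul (fderiv ℝ (localForm (pullbackForm (I := I) g' φ) p) (extChartAt I p p)) u v w
        - g'.inner (φ p) (mfderiv I I' φ p (christoffel g p u v)) (mfderiv I I' φ p w) := by
  have hy := mem_extChartAt_target (I := I) p
  have hq : φ ((extChartAt I p).symm (extChartAt I p p)) ∈ (extChartAt I' (φ p)).source := by
    simp
  have hd : ∀ a : E, fderiv ℝ (chartMap I I' φ p (φ p)) (extChartAt I p p) a =
      mfderiv I I' φ p a := fderiv_chartMap_self (hφ.mdifferentiableAt (by simp))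
  have hk := koszul_pullback (contDiffAt_chartMap hφ hy hq) (G := localForm g'.inner (φ p))
    (P := localForm (pullbackForm (I := I) g' φ) p)
    (by rw [chartMap_self]; exact contDiffAt_localForm_inner g' (φ p))
    (fun a b => g'.symm _ _ _)
    (by
      filter_upwards [eventually_chartMap hφ.continuous hy hq] with z hz v w
      exact localForm_pullbackForm g' hz.1 (hφ.mdifferentiableAt (by simp)) hz.2 v w)
    u v w
  rw [chartMap_self, localForm_self, hd u, hd v, hd w] at hk
  have hc := inner_christoffel g' (φ p) (mfderiv I I' φ p u) (mfderiv I I' φ p v)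
    (mfderiv I I' φ p w)
  rw [secondFundamentalForm_eq g g' hφ, hk]
  simp only [map_sub, map_add, sub_apply, add_apply]
  rw [hc, add_comm (g'.inner (φ p) (ofCoord I' (φ p) _) _)]
  rfl

end SecondFundamentalForm

/-! ### The defect form of a Riemannian submersion -/

section Submersion

variable {E : Type*} [NormedAddCommGroup E] [NormedSpace ℝ E] [FiniteDimensional ℝ E]
  {H : Type*} [TopologicalSpace H] {I : ModelWithCorners ℝ E H} [I.Boundaryless]
  {M : Type*} [TopologicalSpace M] [ChartedSpace H M] [IsManifold I ∞ M]
  {E' : Type*} [NormedAddCommGroup E'] [NormedSpace ℝ E'] [FiniteDimensional ℝ E']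
  {H' : Type*} [TopologicalSpace H'] {I' : ModelWithCorners ℝ E' H'} [I'.Boundaryless]
  {M' : Type*} [TopologicalSpace M'] [ChartedSpace H' M'] [IsManifold I' ∞ M']

theorem inner_self_nonneg (g : Metric I M) (p : M) (v : TangentSpace I p) :
    0 ≤ g.inner p v v := by
  rcases eq_or_ne v 0 with rfl | h
  · simp
  · exact (g.pos p v h).le

theorem eq_zero_of_inner_eq_zero (g : Metric I M) (p : M) {v : TangentSpace I p}
    (h : ∀ w, g.inner p v w = 0) : v = 0 := by
  by_contra hv
  exact (g.pos p v hv).ne' (h v)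

theorem mem_vertical {φ : M → M'} {p : M} {v : TangentSpace I p} :
    v ∈ vertical (I := I) (I' := I') φ p ↔ mfderiv I I' φ p v = 0 := Iff.rfl

theorem inner_vertical_horizontal (g : Metric I M) {φ : M → M'} {p : M} {u x : TangentSpace I p}
    (hu : u ∈ vertical (I := I) (I' := I') φ p) (hx : x ∈ horizontal I I' g φ p) :
    g.inner p u x = 0 := hx u hu

theorem verticalProj_mem (g : Metric I M) (φ : M → M') (p : M) (v : TangentSpace I p) :
    verticalProj I I' g φ p v ∈ vertical (I := I) (I' := I') φ p :=
  Submodule.projection_apply_mem _ _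

theorem horizontalProj_mem (g : Metric I M) (φ : M → M') (p : M) (v : TangentSpace I p) :
    horizontalProj I I' g φ p v ∈ horizontal I I' g φ p :=
  Submodule.projection_apply_mem _ _

theorem verticalProj_add_horizontalProj (g : Metric I M) (φ : M → M') (p : M)
    (v : TangentSpace I p) : verticalProj I I' g φ p v + horizontalProj I I' g φ p v = v :=
  Submodule.projection_add_projection_eq_self _ v

theorem mfderiv_horizontalProj (g : Metric I M) (φ : M → M') (p : M) (v : TangentSpace I p) :
    mfderiv I I' φ p (horizontalProj I I' g φ p v) = mfderiv I I' φ p v := by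
  conv_rhs => rw [← verticalProj_add_horizontalProj (I' := I') g φ p v, map_add]
  rw [mem_vertical.1 (verticalProj_mem g φ p v), zero_add]

/-- A Riemannian submersion is isometric on horizontal vectors; as vertical vectors are
orthogonal to them, one of the two arguments may be arbitrary. -/
theorem IsRiemannianSubmersion.inner_mfderiv {g : Metric I M} {g' : Metric I' M'} {φ : M → M'}
    (hφ : IsRiemannianSubmersion I I' g g' φ) {p : M} {x : TangentSpace I p}
    (hx : x ∈ horizontal I I' g φ p) (w : TangentSpace I p) :
    g'.inner (φ p) (mfderiv I I' φ p x) (mfderiv I I' φ p w) = g.inner p x w := by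
  have sq : ∀ v ∈ horizontal I I' g φ p,
      g'.inner (φ p) (mfderiv I I' φ p v) (mfderiv I I' φ p v) = g.inner p v v := fun v hv =>
    (Real.sqrt_inj (inner_self_nonneg g' _ _) (inner_self_nonneg g _ _)).1 (hφ.len_mfderiv p v hv)
  have hh : ∀ y ∈ horizontal I I' g φ p,
      g'.inner (φ p) (mfderiv I I' φ p x) (mfderiv I I' φ p y) = g.inner p x y := by
    intro y hy
    have h1 := sq (x + y) (add_mem hx hy)
    simp only [map_add, add_apply] at h1
    rw [sq x hx, sq y hy, g.symm p y x, g'.symm _ (mfderiv I I' φ p y)] at h1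
    linarith
  conv_rhs => rw [← verticalProj_add_horizontalProj (I' := I') g φ p w, map_add]
  rw [g.symm p x, inner_vertical_horizontal g (verticalProj_mem g φ p w) hx, zero_add,
    ← hh _ (horizontalProj_mem g φ p w), mfderiv_horizontalProj]

/-- The form `g - φ^* g'`, which is the metric on vertical vectors and zero on horizontal ones. -/
def defect (g : Metric I M) (g' : Metric I' M') (φ : M → M') (x : M) :
    TangentSpace I x →L[ℝ] TangentSpace I x →L[ℝ] ℝ :=
  g.inner x - pullbackForm g' φ x

theorem defect_apply (g : Metric I M) (g' : Metric I' M') (φ : M → M') (x : M)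
    (v w : TangentSpace I x) : defect g g' φ x v w = g.inner x v w - pullbackForm g' φ x v w := rfl

theorem defect_symm (g : Metric I M) (g' : Metric I' M') (φ : M → M') (x : M)
    (v w : TangentSpace I x) : defect g g' φ x v w = defect g g' φ x w v := by
  rw [defect_apply, defect_apply, pullbackForm_apply, pullbackForm_apply, g.symm, g'.symm]

theorem IsRiemannianSubmersion.defect_horizontal {g : Metric I M} {g' : Metric I' M'} {φ : M → M'}
    (hφ : IsRiemannianSubmersion I I' g g' φ) {p : M} {x : TangentSpace I p}
    (hx : x ∈ horizontal I I' g φ p) (w : TangentSpace I p) : defect g g' φ p x w = 0 := by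
  rw [defect_apply, pullbackForm_apply, hφ.inner_mfderiv hx, sub_self]

theorem defect_vertical (g : Metric I M) (g' : Metric I' M') {φ : M → M'} {p : M}
    {u : TangentSpace I p} (hu : u ∈ vertical (I := I) (I' := I') φ p) (w : TangentSpace I p) :
    defect g g' φ p u w = g.inner p u w := by
  rw [defect_apply, pullbackForm_apply, mem_vertical.1 hu]
  simp

theorem IsRiemannianSubmersion.defect_eq_inner_verticalProj {g : Metric I M} {g' : Metric I' M'}
    {φ : M → M'} (hφ : IsRiemannianSubmersion I I' g g' φ) (p : M) (v w : TangentSpace I p) :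
    defect g g' φ p v w = g.inner p (verticalProj I I' g φ p v) w := by
  conv_lhs => rw [← verticalProj_add_horizontalProj (I' := I') g φ p v, map_add, add_apply]
  rw [hφ.defect_horizontal (horizontalProj_mem g φ p v), add_zero,
    defect_vertical g g' (verticalProj_mem g φ p v)]

theorem IsRiemannianSubmersion.defect_self {g : Metric I M} {g' : Metric I' M'}
    {φ : M → M'} (hφ : IsRiemannianSubmersion I I' g g' φ) (p : M) (v : TangentSpace I p) :
    defect g g' φ p v v =
      g.inner p (verticalProj I I' g φ p v) (verticalProj I I' g φ p v) := by
  have h := congrArg (g.inner p (verticalProj I I' g φ p v))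
    (verticalProj_add_horizontalProj (I' := I') g φ p v)
  rw [map_add, inner_vertical_horizontal (I' := I') g (verticalProj_mem g φ p _)
    (horizontalProj_mem g φ p _), add_zero] at h
  rw [hφ.defect_eq_inner_verticalProj, h]

theorem localForm_defect (g : Metric I M) (g' : Metric I' M') (φ : M → M') (p : M) (z v w : E) :
    localForm (defect g g' φ) p z v w =
      localForm g.inner p z v w - localForm (pullbackForm (I := I) g' φ) p z v w := rfl

theorem contDiffAt_localForm_defect (g : Metric I M) (g' : Metric I' M') {φ : M → M'}
    (hφ : ContMDiff I I' ∞ φ) (p : M) :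
    ContDiffAt ℝ ∞ (localForm (defect g g' φ) p) (extChartAt I p p) := by
  refine contDiffAt_of_apply₂ fun v w => ?_
  simp only [localForm_defect]
  exact (((contDiffAt_localForm_inner g p).clm_apply contDiffAt_const).clm_apply
    contDiffAt_const).sub (((contDiffAt_localForm_pullbackForm g' hφ p).clm_apply
      contDiffAt_const).clm_apply contDiffAt_const)

/-- The derivative at `p` of the defect form in the chart at `p`. -/
def defectDeriv (g : Metric I M) (g' : Metric I' M') (φ : M → M') (p : M) :
    E →L[ℝ] E →L[ℝ] E →L[ℝ] ℝ :=
  fderiv ℝ (localForm (defect g g' φ) p) (extChartAt I p p)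

theorem defectDeriv_eq_sub (g : Metric I M) (g' : Metric I' M') {φ : M → M'}
    (hφ : ContMDiff I I' ∞ φ) (p : M) (u v w : E) :
    defectDeriv g g' φ p u v w =
      fderiv ℝ (localForm g.inner p) (extChartAt I p p) u v w
        - fderiv ℝ (localForm (pullbackForm (I := I) g' φ) p) (extChartAt I p p) u v w := by
  have hg := (contDiffAt_localForm_inner g p).differentiableAt (by simp)
  have hp := (contDiffAt_localForm_pullbackForm g' hφ p).differentiableAt (by simp)
  rw [defectDeriv, ← fderiv_apply₂ ((contDiffAt_localForm_defect g g' hφ p).differentiableAt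
    (by simp)), ← fderiv_apply₂ hg, ← fderiv_apply₂ hp]
  simp only [localForm_defect]
  rw [fderiv_fun_sub ((hg.clm_apply (differentiableAt_const v)).clm_apply
    (differentiableAt_const w)) ((hp.clm_apply (differentiableAt_const v)).clm_apply
    (differentiableAt_const w)), sub_apply]

theorem defectDeriv_symm (g : Metric I M) (g' : Metric I' M') {φ : M → M'}
    (hφ : ContMDiff I I' ∞ φ) (p : M) (u v w : E) :
    defectDeriv g g' φ p u v w = defectDeriv g g' φ p u w v := by
  have hd := (contDiffAt_localForm_defect g g' hφ p).differentiableAt (by simp)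
  rw [defectDeriv, ← fderiv_apply₂ hd, ← fderiv_apply₂ hd]
  congr 2
  ext z
  exact defect_symm g g' φ _ _ _

/-- The second fundamental form of a Riemannian submersion, paired with a horizontal vector. -/
theorem IsRiemannianSubmersion.inner_secondFundamentalForm {g : Metric I M} {g' : Metric I' M'}
    {φ : M → M'} (hφ : IsRiemannianSubmersion I I' g g' φ) (p : M) (u v : E)
    {w : E} (hw : (w : TangentSpace I p) ∈ horizontal I I' g φ p) :
    g'.inner (φ p) (secondFundamentalForm g g' φ p u v) (mfderiv I I' φ p w) =
      -koszul (defectDeriv g g' φ p) u v w := by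
  have h1 : g'.inner (φ p) (mfderiv I I' φ p (christoffel g p u v)) (mfderiv I I' φ p w) =
      koszul (fderiv ℝ (localForm g.inner p) (extChartAt I p p)) u v w := by
    rw [g'.symm, hφ.inner_mfderiv hw]
    exact (g.symm p _ _).trans (inner_christoffel g p u v w)
  rw [ClairautWarped.inner_secondFundamentalForm g g' hφ.contMDiff, h1,
    koszul_sub (defectDeriv_eq_sub g g' hφ.contMDiff p)]
  ring

/-- The defect form is nonnegative and vanishes on horizontal vectors, so that its derivative
vanishes on them as well. -/
theorem IsRiemannianSubmersion.defectDeriv_horizontal {g : Metric I M} {g' : Metric I' M'}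
    {φ : M → M'} (hφ : IsRiemannianSubmersion I I' g g' φ) (p : M) (u : E)
    {x y : E} (hx : (x : TangentSpace I p) ∈ horizontal I I' g φ p)
    (hy : (y : TangentSpace I p) ∈ horizontal I I' g φ p) :
    defectDeriv g g' φ p u x y = 0 := by
  have hd := (contDiffAt_localForm_defect g g' hφ.contMDiff p).differentiableAt (by simp)
  have key : ∀ x : E, (x : TangentSpace I p) ∈ horizontal I I' g φ p →
      defectDeriv g g' φ p u x x = 0 := by
    intro x hx
    rw [defectDeriv, ← fderiv_apply₂ hd]
    have hmin : IsLocalMin (fun z => localForm (defect g g' φ) p z x x) (extChartAt I p p) := by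
      refine Eventually.of_forall fun z => ?_
      have h0 : localForm (defect g g' φ) p (extChartAt I p p) x x = 0 := by
        rw [localForm_self]
        exact hφ.defect_horizontal hx _
      refine h0.le.trans ?_
      change 0 ≤ localForm (defect g g' φ) p z x x
      rw [localForm_apply, hφ.defect_self]
      exact inner_self_nonneg g _ _
    rw [hmin.fderiv_eq_zero]
    rfl
  have h := key (x + y) (add_mem (S := Submodule ℝ (TangentSpace I p)) hx hy)
  simp only [map_add, add_apply] at h
  rw [key x hx, key y hy, defectDeriv_symm g g' hφ.contMDiff p u y x] at h
  linarith

/-- The second fundamental form of a Riemannian submersion vanishes on horizontal vectors. -/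
theorem IsRiemannianSubmersion.koszul_horizontal {g : Metric I M} {g' : Metric I' M'}
    {φ : M → M'} (hφ : IsRiemannianSubmersion I I' g g' φ) (p : M)
    {x y z : E} (hx : (x : TangentSpace I p) ∈ horizontal I I' g φ p)
    (hy : (y : TangentSpace I p) ∈ horizontal I I' g φ p)
    (hz : (z : TangentSpace I p) ∈ horizontal I I' g φ p) :
    koszul (defectDeriv g g' φ p) x y z = 0 := by
  simp only [koszul]
  rw [hφ.defectDeriv_horizontal p x hy hz, hφ.defectDeriv_horizontal p y hx hz,
    hφ.defectDeriv_horizontal p z hx hy]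
  ring

end Submersion

/-! ### Local existence of geodesics -/

section Geodesic

variable {E : Type*} [NormedAddCommGroup E] [NormedSpace ℝ E] [FiniteDimensional ℝ E]
  {H : Type*} [TopologicalSpace H] {I : ModelWithCorners ℝ E H} [I.Boundaryless]
  {M : Type*} [TopologicalSpace M] [ChartedSpace H M] [IsManifold I ∞ M]

/-- The velocity of a curve given in a chart. -/
theorem mfderiv_extChartAt_symm_comp {p : M} {x : ℝ → E} {t : ℝ} {v : E} (hx : HasDerivAt x v t)
    (ht : x t ∈ (extChartAt I p).target) :
    mfderiv 𝓘(ℝ, ℝ) I ((extChartAt I p).symm ∘ x) t (1 : ℝ) =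
      (trivializationAt E (TangentSpace I : M → Type _) p).symmL ℝ
        ((extChartAt I p).symm (x t)) v := by
  rw [mfderiv_comp t (mdifferentiableAt_extChartAt_symm ht)
    hx.differentiableAt.mdifferentiableAt, symmL_eq_mfderiv ht, mfderiv_eq_fderiv]
  have : fderiv ℝ x t 1 = v := hx.deriv
  exact congrArg (mfderiv 𝓘(ℝ, E) I (extChartAt I p).symm (x t)) this

theorem localForm_inner_pos (g : Metric I M) {p : M} {y : E} (hy : y ∈ (extChartAt I p).target)
    {v : E} (hv : v ≠ 0) : 0 < localForm g.inner p y v v := by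
  have hb : (extChartAt I p).symm y ∈
      (trivializationAt E (TangentSpace I : M → Type _) p).baseSet := by
    rw [TangentBundle.trivializationAt_baseSet, ← extChartAt_source I]
    exact (extChartAt I p).map_target hy
  rw [localForm_apply]
  refine g.pos _ _ fun h => hv ?_
  rw [← Trivialization.continuousLinearMapAt_symmL (R := ℝ) _ hb v, h, map_zero]

theorem fderiv_chartMap_id_surjective {p q : M} {y : E} (hy : y ∈ (extChartAt I p).target)
    (hq : (extChartAt I p).symm y = q) (w : E) :
    ∃ z, fderiv ℝ (chartMap I I id p q) y z = w := by
  subst hq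
  have hb : (extChartAt I p).symm y ∈
      (trivializationAt E (TangentSpace I : M → Type _) p).baseSet := by
    rw [TangentBundle.trivializationAt_baseSet, ← extChartAt_source I]
    exact (extChartAt I p).map_target hy
  refine ⟨(trivializationAt E (TangentSpace I : M → Type _) p).continuousLinearMapAt ℝ
    ((extChartAt I p).symm y) w, ?_⟩
  rw [fderiv_chartMap (q := (extChartAt I p).symm y) hy mdifferentiableAt_id
    (mem_extChartAt_source _), mfderiv_id]
  exact (congrArg _ (Trivialization.symmL_continuousLinearMapAt _ hb w)).trans
    (continuousLinearMapAt_self (I := I) _ w)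

theorem inner_ofCoord_add_christoffel (g : Metric I M) (q : M) (b c v w : E) :
    g.inner q (ofCoord I q (b + c) + christoffel g q v v) w =
      localForm g.inner q (extChartAt I q q) b w + localForm g.inner q (extChartAt I q q) c w
        + koszul (fderiv ℝ (localForm g.inner q) (extChartAt I q q)) v v w := by
  have h : ∀ (b c : TangentSpace I q) (w : TangentSpace I q),
      g.inner q (b + c) w = g.inner q b w + g.inner q c w := fun b c w => by
    rw [map_add, add_apply]
  rw [localForm_self, localForm_self]
  exact (h _ _ w).trans (congrArg₂ (· + ·) (h b c w) (inner_christoffel g q v v w))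

/-- The Christoffel symbols transform under changes of charts in such a way that a solution of the
geodesic equation in one chart is a geodesic. -/
theorem isGeodesicOn_of_hasDerivAt (g : Metric I M) {p : M} {s : Set ℝ} (hs : IsOpen s)
    {x x' a : ℝ → E} (hx : ∀ t ∈ s, HasDerivAt x (x' t) t) (hx' : ∀ t ∈ s, HasDerivAt x' (a t) t)
    (ha : ContinuousOn a s) (hxt : ∀ t ∈ s, x t ∈ (extChartAt I p).target)
    (hode : ∀ t ∈ s, ∀ z, localForm g.inner p (x t) (a t) z =
      -koszul (fderiv ℝ (localForm g.inner p) (x t)) (x' t) (x' t) z) :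
    IsGeodesicOn g ((extChartAt I p).symm ∘ x) s := by
  constructor
  · have hxc : ContDiffOn ℝ 2 x s := by
      have h1 : ContDiffOn ℝ 1 x' s := by
        rw [show (1 : WithTop ℕ∞) = 0 + 1 by simp, contDiffOn_succ_iff_deriv_of_isOpen hs]
        refine ⟨fun t ht => (hx' t ht).differentiableAt.differentiableWithinAt, by simp, ?_⟩
        rw [contDiffOn_zero]
        exact ha.congr fun t ht => (hx' t ht).deriv
      rw [show (2 : WithTop ℕ∞) = 1 + 1 by norm_num, contDiffOn_succ_iff_deriv_of_isOpen hs]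
      exact ⟨fun t ht => (hx t ht).differentiableAt.differentiableWithinAt, by simp,
        h1.congr fun t ht => (hx t ht).deriv⟩
    exact ((contMDiffOn_extChartAt_symm (n := ∞) p).of_le ENat.LEInfty.out).comp
      hxc.contMDiffOn hxt
  · intro t ht
    -- the covariant derivative at time `t` is defined in the chart at `q = c(t)`
    obtain ⟨q, hq⟩ : ∃ q, (extChartAt I p).symm (x t) = q := ⟨_, rfl⟩
    set A := chartMap I I id p q with hA
    have hqs : (extChartAt I p).symm (x t) ∈ (extChartAt I q).source := by
      rw [hq]
      exact mem_extChartAt_source q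
    have hAt : A (x t) = extChartAt I q q := by
      rw [hA, ← hq]
      rfl
    have hAc : ContDiffAt ℝ ∞ A (x t) := contDiffAt_chartMap contMDiff_id (hxt t ht) hqs
    have hdA : DifferentiableAt ℝ (fderiv ℝ A) (x t) :=
      (hAc.fderiv_right (m := ∞) le_rfl).differentiableAt (by simp)
    have hev := eventually_chartMap continuous_id (hxt t ht) hqs
    -- the velocity in the chart at `q`
    have hvel : ∀ τ ∈ s, (extChartAt I p).symm (x τ) ∈ (extChartAt I q).source →
        (trivializationAt E (TangentSpace I : M → Type _) q ⟨(extChartAt I p).symm (x τ),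
          mfderiv 𝓘(ℝ, ℝ) I ((extChartAt I p).symm ∘ x) τ (1 : ℝ)⟩).2 =
            fderiv ℝ A (x τ) (x' τ) := by
      intro τ hτ hτq
      have hb : (extChartAt I p).symm (x τ) ∈
          (trivializationAt E (TangentSpace I : M → Type _) q).baseSet := by
        rwa [TangentBundle.trivializationAt_baseSet, ← extChartAt_source I]
      rw [hA, fderiv_chartMap (hxt τ hτ) mdifferentiableAt_id hτq, mfderiv_id,
        ← Trivialization.continuousLinearMapAt_apply_of_mem (R := ℝ) _ hb]
      exact congrArg _ (mfderiv_extChartAt_symm_comp (hx τ hτ) (hxt τ hτ))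
    have hW : ∀ᶠ τ in 𝓝 t, (trivializationAt E (TangentSpace I : M → Type _) q
        ⟨(extChartAt I p).symm (x τ),
          mfderiv 𝓘(ℝ, ℝ) I ((extChartAt I p).symm ∘ x) τ (1 : ℝ)⟩).2 =
            fderiv ℝ A (x τ) (x' τ) := by
      filter_upwards [hs.mem_nhds ht, (hx t ht).continuousAt.eventually hev] with τ hτ h2
      exact hvel τ hτ h2.2
    have hh : HasDerivAt (fun τ => fderiv ℝ A (x τ) (x' τ))
        (fderiv ℝ (fderiv ℝ A) (x t) (x' t) (x' t) + fderiv ℝ A (x t) (a t)) t :=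
      (hdA.hasFDerivAt.comp_hasDerivAt t (hx t ht)).clm_apply (hx' t ht)
    have hk := fun z : E => koszul_pullback hAc (G := localForm g.inner q)
      (by rw [hAt]; exact contDiffAt_localForm_inner g q) (fun a b => g.symm _ _ _)
      (P := localForm g.inner p)
      (by
        filter_upwards [hev] with z hz v w
        exact localForm_inner_eq_of_id g hz.1 hz.2 v w) (x' t) (x' t) z
    have hG := fun z : E => localForm_inner_eq_of_id g (hxt t ht) hqs (a t) z
    rw [hAt] at hk
    rw [← hA, hAt] at hG
    simp only [localForm_self] at hk hG
    have hsurj := fderiv_chartMap_id_surjective (hxt t ht) hq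
    have hvt := hvel t ht hqs
    clear_value A
    subst hq
    have hv : mfderiv 𝓘(ℝ, ℝ) I ((extChartAt I p).symm ∘ x) t (1 : ℝ) =
        fderiv ℝ A (x t) (x' t) := by
      rw [← hvt, ← Trivialization.continuousLinearMapAt_apply_of_mem (R := ℝ) _
        (FiberBundle.mem_baseSet_trivializationAt' _)]
      exact (continuousLinearMapAt_self (I := I) _ _).symm
    have h1 := covDerivAlong_eq (I := 𝓘(ℝ, ℝ)) (p := t) g ((extChartAt I p).symm ∘ x)
      (h := fun τ => fderiv ℝ A (x τ) (x' τ))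
      (W := fun τ => mfderiv 𝓘(ℝ, ℝ) I ((extChartAt I p).symm ∘ x) τ (1 : ℝ))
      hh.differentiableAt hW (1 : ℝ)
    refine h1.trans (eq_zero_of_inner_eq_zero g _ fun w => ?_)
    obtain ⟨z, hz⟩ := hsurj w
    have h2 := hode t ht z
    rw [hk z, hG z] at h2
    have h4 : fderiv ℝ (fun τ => fderiv ℝ A (x τ) (x' τ)) t 1 =
      fderiv ℝ (fderiv ℝ A) (x t) (x' t) (x' t) + fderiv ℝ A (x t) (a t) := hh.deriv
    have key : ∀ e v w : E,
        e = fderiv ℝ (fderiv ℝ A) (x t) (x' t) (x' t) + fderiv ℝ A (x t) (a t) →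
        v = fderiv ℝ A (x t) (x' t) → w = fderiv ℝ A (x t) z →
        g.inner ((extChartAt I p).symm (x t)) (ofCoord I ((extChartAt I p).symm (x t)) e
          + christoffel g ((extChartAt I p).symm (x t)) v v) w = 0 := by
      rintro _ _ _ rfl rfl rfl
      refine (inner_ofCoord_add_christoffel g _ _ _ _ _).trans ?_
      rw [localForm_self, localForm_self, h2]
      ring
    rw [← hA] at hz
    exact key _ _ _ h4 hv hz.symm

/-- The covector `w ↦ koszul D v v w`. -/
def koszulCovector (D : E →L[ℝ] E →L[ℝ] E →L[ℝ] ℝ) (v : E) : E →L[ℝ] ℝ :=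
  (1 / 2 : ℝ) • (D v v + D v v - (D.flip v).flip v)

theorem koszulCovector_apply (D : E →L[ℝ] E →L[ℝ] E →L[ℝ] ℝ) (v w : E) :
    koszulCovector D v w = koszul D v v w := by
  simp [koszulCovector, koszul]

/-- A positive definite form identifies a finite-dimensional space with its dual. -/
theorem exists_continuousLinearEquiv_of_pos {B : E →L[ℝ] E →L[ℝ] ℝ}
    (hB : ∀ v, v ≠ 0 → 0 < B v v) : ∃ e : E ≃L[ℝ] (E →L[ℝ] ℝ), (e : E →L[ℝ] E →L[ℝ] ℝ) = B := by
  have hinj : Function.Injective B.toLinearMap := by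
    rw [← LinearMap.ker_eq_bot, LinearMap.ker_eq_bot']
    intro v hv
    by_contra h
    refine (hB v h).ne' ?_
    exact DFunLike.congr_fun hv v
  have hdim : finrank ℝ E = finrank ℝ (E →L[ℝ] ℝ) := by
    rw [← (LinearMap.toContinuousLinearMap : (E →ₗ[ℝ] ℝ) ≃ₗ[ℝ] (E →L[ℝ] ℝ)).finrank_eq]
    exact (Subspace.dual_finrank_eq (K := ℝ) (V := E)).symm
  refine ⟨(LinearMap.linearEquivOfInjective B.toLinearMap hinj hdim).toContinuousLinearEquiv, ?_⟩
  ext v w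
  rfl

theorem contDiffAt_of_apply {F G : Type*} [NormedAddCommGroup F] [NormedSpace ℝ F]
    [NormedAddCommGroup G] [NormedSpace ℝ G]
    {B : F → E →L[ℝ] G} {y : F} (h : ∀ v, ContDiffAt ℝ ∞ (fun z => B z v) y) :
    ContDiffAt ℝ ∞ B y := by
  rw [← contMDiffAt_iff_contDiffAt]
  exact contMDiffAt_clm _ fun v => (h v).contMDiffAt

/-- The vector field on `E × E` whose integral curves are the geodesics read in the chart
at `p`. -/
def geodesicField (g : Metric I M) (p : M) (y : E × E) : E × E :=
  (y.2, -(localForm g.inner p y.1).inverse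
    (koszulCovector (fderiv ℝ (localForm g.inner p) y.1) y.2))

theorem localForm_geodesicField (g : Metric I M) {p : M} {y : E × E}
    (hy : y.1 ∈ (extChartAt I p).target) (w : E) :
    localForm g.inner p y.1 (geodesicField g p y).2 w =
      -koszul (fderiv ℝ (localForm g.inner p) y.1) y.2 y.2 w := by
  obtain ⟨e, he⟩ := exists_continuousLinearEquiv_of_pos
    (B := localForm g.inner p y.1) fun v hv => localForm_inner_pos g hy hv
  have h : localForm g.inner p y.1 (geodesicField g p y).2 =
      -koszulCovector (fderiv ℝ (localForm g.inner p) y.1) y.2 := by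
    rw [geodesicField, ← he, ContinuousLinearMap.inverse_equiv, map_neg]
    simp
  rw [h, neg_apply, koszulCovector_apply]

theorem contDiffAt_inverse_localForm (g : Metric I M) (p : M) :
    ContDiffAt ℝ ∞ (fun y => (localForm g.inner p y).inverse) (extChartAt I p p) := by
  have := FiniteDimensional.complete ℝ E
  obtain ⟨e, he⟩ := exists_continuousLinearEquiv_of_pos
    (B := localForm g.inner p (extChartAt I p p))
      fun v hv => localForm_inner_pos g (mem_extChartAt_target p) hv
  have h := contDiffAt_map_inverse (n := ∞) e
  rw [he] at h
  exact h.comp _ (contDiffAt_localForm_inner g p)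

theorem contDiffAt_geodesicField (g : Metric I M) (p : M) (v : E) :
    ContDiffAt ℝ ∞ (geodesicField g p) (extChartAt I p p, v) := by
  have hfst : ContDiffAt ℝ ∞ (Prod.fst : E × E → E) (extChartAt I p p, v) := contDiffAt_fst
  have hsnd : ContDiffAt ℝ ∞ (Prod.snd : E × E → E) (extChartAt I p p, v) := contDiffAt_snd
  have hd := ContDiffAt.comp (f := (Prod.fst : E × E → E)) (extChartAt I p p, v)
    ((contDiffAt_localForm_inner g p).fderiv_right (m := ∞) le_rfl) hfst
  have hk : ContDiffAt ℝ ∞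
      (fun y : E × E => koszulCovector (fderiv ℝ (localForm g.inner p) y.1) y.2)
      (extChartAt I p p, v) := by
    refine contDiffAt_of_apply fun w => ?_
    simp only [koszulCovector_apply, koszul]
    have h1 := ((hd.clm_apply hsnd).clm_apply hsnd).clm_apply (contDiffAt_const (c := w))
    have h2 := ((hd.clm_apply (contDiffAt_const (c := w))).clm_apply hsnd).clm_apply hsnd
    exact contDiffAt_const.mul ((h1.add h1).sub h2)
  exact hsnd.prodMk ((ContDiffAt.comp (f := (Prod.fst : E × E → E)) (extChartAt I p p, v)
    (contDiffAt_inverse_localForm g p) hfst).clm_apply hk).neg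

/-- Through every tangent vector there is a geodesic; it is given together with its coordinate
expression `x`, the velocity `x'` and the acceleration `a` in the chart at the initial point. -/
theorem exists_isGeodesicOn (g : Metric I M) (p : M) (v : E) :
    ∃ (x x' a : ℝ → E) (ε : ℝ), 0 < ε ∧ x 0 = extChartAt I p p ∧ x' 0 = v ∧
      (∀ t ∈ Set.Ioo (-ε) ε, HasDerivAt x (x' t) t ∧ HasDerivAt x' (a t) t ∧
        x t ∈ (extChartAt I p).target) ∧
      (∀ w, localForm g.inner p (extChartAt I p p) (a 0) w =
        -koszul (fderiv ℝ (localForm g.inner p) (extChartAt I p p)) v v w) ∧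
      IsGeodesicOn g ((extChartAt I p).symm ∘ x) (Set.Ioo (-ε) ε) := by
  have := FiniteDimensional.complete ℝ E
  have hF : ContDiffAt ℝ 1 (geodesicField g p) (extChartAt I p p, v) :=
    (contDiffAt_geodesicField g p v).of_le (by simp)
  obtain ⟨α, hα0, ε, hε, hα⟩ :=
    hF.exists_forall_mem_closedBall_exists_eq_forall_mem_Ioo_hasDerivAt₀ 0
  rw [zero_sub, zero_add] at hα
  have hev : ∀ᶠ t in 𝓝 (0 : ℝ), ContDiffAt ℝ 1 (geodesicField g p) (α t) ∧
      (α t).1 ∈ (extChartAt I p).target := by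
    have hc : ContinuousAt α 0 := (hα 0 ⟨by linarith, hε⟩).continuousAt
    have h : ∀ᶠ y in 𝓝 (α 0), ContDiffAt ℝ 1 (geodesicField g p) y ∧
        y.1 ∈ (extChartAt I p).target := by
      rw [hα0]
      exact (hF.eventually (by simp)).and
        (continuousAt_fst.eventually (extChartAt_target_mem_nhds p))
    exact hc.eventually h
  obtain ⟨δ, hδ, hball⟩ := Metric.eventually_nhds_iff_ball.1 hev
  have hsub : ∀ t ∈ Set.Ioo (-min ε δ) (min ε δ), t ∈ Set.Ioo (-ε) ε ∧ t ∈ Metric.ball 0 δ := by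
    intro t ht
    have h1 := min_le_left ε δ
    have h2 := min_le_right ε δ
    rw [Real.ball_eq_Ioo]
    exact ⟨⟨by linarith [ht.1], by linarith [ht.2]⟩, by linarith [ht.1], by linarith [ht.2]⟩
  have h1 : ∀ t ∈ Set.Ioo (-min ε δ) (min ε δ), HasDerivAt (fun t => (α t).1) (α t).2 t :=
    fun t ht => ((ContinuousLinearMap.fst ℝ E E).hasFDerivAt.comp_hasDerivAt t
      (hα t (hsub t ht).1))
  have h2 : ∀ t ∈ Set.Ioo (-min ε δ) (min ε δ),
      HasDerivAt (fun t => (α t).2) (geodesicField g p (α t)).2 t :=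
    fun t ht => ((ContinuousLinearMap.snd ℝ E E).hasFDerivAt.comp_hasDerivAt t
      (hα t (hsub t ht).1))
  have h3 : ∀ t ∈ Set.Ioo (-min ε δ) (min ε δ), (α t).1 ∈ (extChartAt I p).target :=
    fun t ht => (hball t (hsub t ht).2).2
  refine ⟨fun t => (α t).1, fun t => (α t).2, fun t => (geodesicField g p (α t)).2, min ε δ,
    lt_min hε hδ, by simp only [hα0], by simp only [hα0],
    fun t ht => ⟨h1 t ht, h2 t ht, h3 t ht⟩, fun w => ?_, ?_⟩
  · have h := localForm_geodesicField g (y := α 0) (p := p)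
      (by rw [hα0]; exact mem_extChartAt_target p) w
    simpa only [hα0] using h
  · refine isGeodesicOn_of_hasDerivAt g isOpen_Ioo h1 h2 ?_ h3
      fun t ht z => localForm_geodesicField g (h3 t ht) z
    intro t ht
    exact (continuousAt_snd.comp ((hball t (hsub t ht).2).1.continuousAt.comp
      (hα t (hsub t ht).1).continuousAt)).continuousWithinAt

end Geodesic

/-! ### The infinitesimal Clairaut relation -/

section Clairaut

variable {E : Type*} [NormedAddCommGroup E] [NormedSpace ℝ E] [FiniteDimensional ℝ E]
  {H : Type*} [TopologicalSpace H] {I : ModelWithCorners ℝ E H} [I.Boundaryless]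
  {M : Type*} [TopologicalSpace M] [ChartedSpace H M] [IsManifold I ∞ M]
  {E' : Type*} [NormedAddCommGroup E'] [NormedSpace ℝ E'] [FiniteDimensional ℝ E']
  {H' : Type*} [TopologicalSpace H'] {I' : ModelWithCorners ℝ E' H'} [I'.Boundaryless]
  {M' : Type*} [TopologicalSpace M'] [ChartedSpace H' M'] [IsManifold I' ∞ M']

/-- Up to the factor `g(v, v)`, the squared sine of the angle between `v` and the horizontal space
is the defect form. For vertical `v` the quotient in the definition of the angle is `0 / 0 = 0`,
which gives the right angle. -/
theorem IsRiemannianSubmersion.inner_mul_sin_angle_sq {g : Metric I M} {g' : Metric I' M'}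
    {φ : M → M'} (hφ : IsRiemannianSubmersion I I' g g' φ) (p : M) (v : TangentSpace I p) :
    g.inner p v v * Real.sin (angle g p v (horizontalProj I I' g φ p v)) ^ 2 =
      defect g g' φ p v v := by
  set h := horizontalProj I I' g φ p v with hh
  have hV := verticalProj_add_horizontalProj (I' := I') g φ p v
  have h0 : g.inner p (verticalProj I I' g φ p v) h = 0 :=
    inner_vertical_horizontal g (verticalProj_mem g φ p v) (horizontalProj_mem g φ p v)
  have h1 : g.inner p v h = g.inner p h h := by
    have := congrArg (fun a => g.inner p a h) hV
    simp only [map_add, add_apply] at this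
    rw [← this, h0, zero_add]
  have h2 : g.inner p v v = defect g g' φ p v v + g.inner p h h := by
    rw [hφ.defect_self, ← h1, g.symm p v h]
    have := congrArg (fun a => g.inner p a v) hV
    have h3 := congrArg (g.inner p (verticalProj I I' g φ p v)) hV
    simp only [map_add, add_apply] at this h3
    rw [← this, ← h3, h0, add_zero]
  have hd : 0 ≤ defect g g' φ p v v := by
    rw [hφ.defect_self]
    exact inner_self_nonneg g _ _
  have hn := inner_self_nonneg g p h
  rw [angle, Real.sin_arccos, h1, len, len]
  rcases eq_or_ne h 0 with hz | hz
  · rw [h2, hz]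
    simp
  · have hp := g.pos p h hz
    have hv : 0 < g.inner p v v := by linarith
    have hq : (g.inner p h h / (√(g.inner p v v) * √(g.inner p h h))) ^ 2 =
        g.inner p h h / g.inner p v v := by
      rw [div_pow, mul_pow, Real.sq_sqrt hv.le, Real.sq_sqrt hn]
      field_simp
    have hle : g.inner p h h / g.inner p v v ≤ 1 := by
      rw [div_le_one hv]
      linarith
    rw [hq, Real.sq_sqrt (by linarith)]
    field_simp
    linarith

/-- The transformation law of the Christoffel symbols has a factor `φ_* w`, which is zero for
vertical `w`. -/
theorem koszul_pullbackForm_vertical (g : Metric I M) (g' : Metric I' M') {φ : M → M'}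
    (hφ : ContMDiff I I' ∞ φ) (p : M) (u v : E) {w : E}
    (hw : (w : TangentSpace I p) ∈ vertical (I := I) (I' := I') φ p) :
    koszul (fderiv ℝ (localForm (pullbackForm (I := I) g' φ) p) (extChartAt I p p)) u v w = 0 := by
  have h := inner_secondFundamentalForm g g' hφ p u v w
  have hw' : mfderiv I I' φ p w = 0 := hw
  rw [hw'] at h
  simpa using h.symm

theorem hasDerivAt_clm_comp {G : Type*} [NormedAddCommGroup G] [NormedSpace ℝ G]
    {B : E → E →L[ℝ] G} {x x' : ℝ → E} {t : ℝ} {v a : E}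
    (hB : DifferentiableAt ℝ B (x t)) (hx : HasDerivAt x v t) (hx' : HasDerivAt x' a t) :
    HasDerivAt (fun τ => B (x τ) (x' τ)) (fderiv ℝ B (x t) v (x' t) + B (x t) a) t :=
  (hB.hasFDerivAt.comp_hasDerivAt t hx).clm_apply hx'

theorem hasDerivAt_form {B : E → E →L[ℝ] E →L[ℝ] ℝ} {x x' : ℝ → E} {t : ℝ} {v a : E}
    (hB : DifferentiableAt ℝ B (x t)) (hx : HasDerivAt x v t) (hx' : HasDerivAt x' a t) :
    HasDerivAt (fun τ => B (x τ) (x' τ) (x' τ))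
      (fderiv ℝ B (x t) v (x' t) (x' t) + B (x t) a (x' t) + B (x t) (x' t) a) t := by
  have h := (hasDerivAt_clm_comp hB hx hx').clm_apply hx'
  rwa [add_apply] at h

/-- The derivative `dψ(v)` of a function in the direction of a tangent vector, as a real
number. -/
def dirDeriv (ψ : M → ℝ) (p : M) (v : TangentSpace I p) : ℝ := mfderiv I 𝓘(ℝ, ℝ) ψ p v

/-- The derivative at `t = 0` of the squared Clairaut relation along the geodesic with initial
velocity `v`. The geodesic equation turns the acceleration terms into Christoffel symbols of `g`, of
which the vertical part of `v` only sees those of the defect form. -/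
theorem IsClairautWith.dirDeriv_mul_defect {g : Metric I M} {g' : Metric I' M'}
    {φ : M → M'} (hφ : IsRiemannianSubmersion I I' g g' φ) {ψ : M → ℝ}
    (hψ : ContMDiff I 𝓘(ℝ, ℝ) ∞ ψ) (hc : IsClairautWith I I' g φ (fun p => Real.exp (ψ p)))
    (p : M) (v : E) :
    dirDeriv (I := I) ψ p v * defect g g' φ p v v =
      -koszul (defectDeriv g g' φ p) v v (horizontalProj I I' g φ p v) := by
  obtain ⟨x, x', a, ε, hε, hx0, hx'0, hode, ha, hgeo⟩ := exists_isGeodesicOn g p v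
  have h0 : (0 : ℝ) ∈ Set.Ioo (-ε) ε := ⟨by linarith, hε⟩
  obtain ⟨k, hk⟩ := hc _ _ isOpen_Ioo Set.ordConnected_Ioo hgeo
  have hψd : DifferentiableAt ℝ (ψ ∘ (extChartAt I p).symm) (extChartAt I p p) := by
    have h := contDiffAt_chartMap (I' := 𝓘(ℝ, ℝ)) hψ (mem_extChartAt_target (I := I) p)
      (q := (0 : ℝ)) (by rw [extChartAt_model_space_eq_id]; trivial)
    exact h.differentiableAt (by simp)
  have hψv : dirDeriv (I := I) ψ p v =
      fderiv ℝ (ψ ∘ (extChartAt I p).symm) (extChartAt I p p) v :=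
    mfderiv_eq_fderiv_chart hψd EventuallyEq.rfl v
  -- the Clairaut relation, squared, in coordinates
  have hrel : ∀ t ∈ Set.Ioo (-ε) ε,
      Real.exp (ψ ((extChartAt I p).symm (x t))) ^ 2
        * localForm (defect g g' φ) p (x t) (x' t) (x' t) =
      k ^ 2 * localForm g.inner p (x t) (x' t) (x' t) := by
    intro t ht
    have h1 := hk t ht
    obtain ⟨hd, -, htar⟩ := hode t ht
    rw [mfderiv_extChartAt_symm_comp hd htar] at h1
    rw [← h1, localForm_apply, localForm_apply]
    rw [← hφ.inner_mul_sin_angle_sq]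
    simp only [Function.comp_apply]
    ring
  have hD := (contDiffAt_localForm_defect g g' hφ.contMDiff p).differentiableAt (by simp)
  have hG := (contDiffAt_localForm_inner g p).differentiableAt (by simp)
  obtain ⟨hx, hx', -⟩ := hode 0 h0
  rw [← hx0] at hD hG hψd
  have hD' := hasDerivAt_form hD hx hx'
  have hG' := hasDerivAt_form hG hx hx'
  have he := (((hψd.hasFDerivAt.comp_hasDerivAt 0 hx).exp).pow 2).mul hD'
  have heq := he.unique ((hG'.const_mul (k ^ 2)).congr_of_eventuallyEq (by
    filter_upwards [Ioo_mem_nhds h0.1 h0.2] with t ht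
    exact hrel t ht))
  simp only [Pi.pow_apply, Function.comp_apply, hx0, hx'0, Nat.cast_ofNat,
    Nat.add_one_sub_one, pow_one] at heq
  set G₀ := localForm g.inner p (extChartAt I p p) with hG₀
  set D₀ := localForm (defect g g' φ) p (extChartAt I p p) with hD₀
  -- the speed of a geodesic is constant
  have hN : fderiv ℝ (localForm g.inner p) (extChartAt I p p) v v v + G₀ (a 0) v + G₀ v (a 0)
      = 0 := by
    have hs : G₀ v (a 0) = G₀ (a 0) v := g.symm _ _ _
    rw [hs, ha v, koszul]
    ring
  obtain ⟨V, hV⟩ : ∃ V : E, V = verticalProj I I' g φ p v := ⟨_, rfl⟩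
  have hVm : (V : TangentSpace I p) ∈ vertical (I := I) (I' := I') φ p :=
    hV ▸ verticalProj_mem g φ p v
  have hDa : ∀ b : E, D₀ b v = G₀ b V := by
    intro b
    rw [hV]
    exact (localForm_self (defect g g' φ) p b v).trans ((defect_symm g g' φ p b v).trans
      ((hφ.defect_eq_inner_verticalProj p v b).trans ((g.symm p _ _).trans
        (localForm_self g.inner p b (verticalProj I I' g φ p v)).symm)))
  have hDs : D₀ v (a 0) = D₀ (a 0) v := defect_symm g g' φ _ _ _
  rw [hN, mul_zero, hDs, hDa (a 0), ha] at heq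
  have hpos : Real.exp (ψ ((extChartAt I p).symm (extChartAt I p p))) ≠ 0 := (Real.exp_pos _).ne'
  have hk3 : koszul (defectDeriv g g' φ p) v v v =
      1 / 2 * fderiv ℝ (localForm (defect g g' φ) p) (extChartAt I p p) v v v := by
    simp only [koszul, defectDeriv]
    ring
  have h1 : dirDeriv (I := I) ψ p v * D₀ v v + koszul (defectDeriv g g' φ p) v v v
      - koszul (fderiv ℝ (localForm g.inner p) (extChartAt I p p)) v v V = 0 := by
    have h2 : 2 * Real.exp (ψ ((extChartAt I p).symm (extChartAt I p p))) ^ 2 *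
        (dirDeriv (I := I) ψ p v * D₀ v v + koszul (defectDeriv g g' φ p) v v v
          - koszul (fderiv ℝ (localForm g.inner p) (extChartAt I p p)) v v V) = 0 := by
      rw [← heq, hψv, hk3]
      ring
    exact (mul_eq_zero.1 h2).resolve_left (by positivity)
  -- only the horizontal part of the last argument contributes
  have h2 : koszul (defectDeriv g g' φ p) v v v =
      koszul (defectDeriv g g' φ p) v v V
        + koszul (defectDeriv g g' φ p) v v (horizontalProj I I' g φ p v) := by
    obtain ⟨W, hW⟩ : ∃ W : E, W = horizontalProj I I' g φ p v := ⟨_, rfl⟩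
    have hsum : v = V + W := by
      rw [hV, hW]
      exact (verticalProj_add_horizontalProj (I' := I') g φ p v).symm
    rw [← hW, ← koszul_add_right, ← hsum]
  rw [koszul_sub (defectDeriv_eq_sub g g' hφ.contMDiff p) v v V,
    koszul_pullbackForm_vertical g g' hφ.contMDiff p v v hVm] at h2
  have h3 : D₀ v v = defect g g' φ p v v := localForm_self _ _ _ _
  rw [← h3]
  linarith

theorem horizontalProj_add_smul (g : Metric I M) (φ : M → M') (p : M)
    {u x : TangentSpace I p} (hu : u ∈ vertical (I := I) (I' := I') φ p)
    (hx : x ∈ horizontal I I' g φ p) (t : ℝ) :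
    horizontalProj I I' g φ p (u + t • x) = t • x := by
  rw [map_add, map_smul]
  have h1 : horizontalProj I I' g φ p u = 0 :=
    (Submodule.projection_apply_eq_zero_iff _).2 hu
  have h2 : horizontalProj I I' g φ p x = x := Submodule.projection_apply_left _ ⟨x, hx⟩
  rw [h1, h2, zero_add]

/-- The potential of a Clairaut submersion is constant along the fibers. -/
theorem IsClairautWith.dirDeriv_vertical {g : Metric I M} {g' : Metric I' M'}
    {φ : M → M'} (hφ : IsRiemannianSubmersion I I' g g' φ) {ψ : M → ℝ}
    (hψ : ContMDiff I 𝓘(ℝ, ℝ) ∞ ψ) (hc : IsClairautWith I I' g φ (fun p => Real.exp (ψ p)))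
    {p : M} {u : E} (hu : (u : TangentSpace I p) ∈ vertical (I := I) (I' := I') φ p) :
    dirDeriv (I := I) ψ p u = 0 := by
  rcases eq_or_ne (u : TangentSpace I p) 0 with rfl | h0
  · exact map_zero (mfderiv I 𝓘(ℝ, ℝ) ψ p)
  · have h := dirDeriv_mul_defect hφ hψ hc p u
    have hz : horizontalProj I I' g φ p u = (0 : E) :=
      (Submodule.projection_apply_eq_zero_iff _).2 hu
    have hk : koszul (defectDeriv g g' φ p) u u 0 = 0 := by simp [koszul]
    rw [hz, hk, neg_zero] at h
    refine (mul_eq_zero.1 h).resolve_right (ne_of_gt ?_)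
    exact (g.pos p u h0).trans_eq (defect_vertical g g' hu _).symm

/-- The fibers of a Clairaut submersion are totally umbilical, and their mean curvature is the
negative gradient of the potential: the right-hand side is `g'(∇φ_*(U, U), φ_* X)`, that is,
`-g(T_U U, X)`. -/
theorem IsClairautWith.dirDeriv_horizontal {g : Metric I M} {g' : Metric I' M'}
    {φ : M → M'} (hφ : IsRiemannianSubmersion I I' g g' φ) {ψ : M → ℝ}
    (hψ : ContMDiff I 𝓘(ℝ, ℝ) ∞ ψ) (hc : IsClairautWith I I' g φ (fun p => Real.exp (ψ p)))
    {p : M} {u x : E} (hu : (u : TangentSpace I p) ∈ vertical (I := I) (I' := I') φ p)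
    (hx : (x : TangentSpace I p) ∈ horizontal I I' g φ p) :
    dirDeriv (I := I) ψ p x * g.inner p u u = -koszul (defectDeriv g g' φ p) u u x := by
  -- the Clairaut identity for `u + t x` is a polynomial identity in `t`
  have key : ∀ t : ℝ, t * dirDeriv (I := I) ψ p x * g.inner p u u =
      -t * (koszul (defectDeriv g g' φ p) u u x +
        2 * t * koszul (defectDeriv g g' φ p) u x x) := by
    intro t
    have h := dirDeriv_mul_defect hφ hψ hc p (u + t • x)
    have hh : horizontalProj I I' g φ p (u + t • x : E) = (t • x : E) :=
      horizontalProj_add_smul g φ p hu hx t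
    have hd : defect g g' φ p (u + t • x : E) (u + t • x : E) = g.inner p u u := by
      have h1 := hφ.defect_horizontal hx (u : TangentSpace I p)
      have h2 := hφ.defect_horizontal hx (x : TangentSpace I p)
      have h3 := defect_vertical g g' hu (u : TangentSpace I p)
      have h4 := (defect_symm g g' φ p u x).trans h1
      have e : ∀ B : E →L[ℝ] E →L[ℝ] ℝ, B x u = 0 → B x x = 0 → B u x = 0 →
          B (u + t • x) (u + t • x) = B u u := by
        intro B b1 b2 b3
        simp [b1, b2, b3]
      exact (e _ h1 h2 h4).trans h3
    have hp : dirDeriv (I := I) ψ p (u + t • x : E) = t * dirDeriv (I := I) ψ p x := by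
      have h1 := dirDeriv_vertical hφ hψ hc hu
      have e : ∀ A : E →L[ℝ] ℝ, A u = 0 → A (u + t • x) = t * A x := by
        intro A a1
        simp [a1]
      exact e _ h1
    rw [hh, hd, hp, koszul_smul_right, koszul_add_left, koszul_add_middle, koszul_add_middle,
      koszul_smul_left, koszul_smul_left, koszul_smul_middle, koszul_smul_middle,
      hφ.koszul_horizontal p hx hx hx,
      koszul_symm _ (defectDeriv_symm g g' hφ.contMDiff p) x u x] at h
    rw [h]
    ring
  have h1 := key 1
  have h2 := key (-1)
  linarith

end Clairaut

/-! ### Traces with respect to a positive definite form -/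

section Trace

variable {V : Type*} [AddCommGroup V] [Module ℝ V]

theorem trace_eq_sum_of_orthonormal {ι : Type*} [Fintype ι] [DecidableEq ι]
    (B : LinearMap.BilinForm ℝ V) (e : Basis ι ℝ V)
    (he : ∀ i j, B (e i) (e j) = if i = j then 1 else 0) (A : V →ₗ[ℝ] V) :
    LinearMap.trace ℝ V A = ∑ i, B (A (e i)) (e i) := by
  rw [LinearMap.trace_eq_matrix_trace ℝ e A, Matrix.trace]
  refine Finset.sum_congr rfl fun i _ => ?_
  rw [Matrix.diag_apply, LinearMap.toMatrix_apply]
  have h : B (∑ j, e.repr (A (e i)) j • e j) (e i) = e.repr (A (e i)) i := by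
    simp only [map_sum, LinearMap.sum_apply, map_smul, LinearMap.smul_apply, he]
    simp
  rw [e.sum_repr] at h
  exact h.symm

/-- The trace of a form with respect to an orthonormal basis does not depend on the basis; it can
be computed with a basis adapted to a subspace `S` and its orthogonal complement. -/
theorem sum_orthonormal_eq_of_isCompl [FiniteDimensional ℝ V] {B : LinearMap.BilinForm ℝ V}
    (hs : ∀ v w, B v w = B w v) (hp : ∀ v, v ≠ 0 → 0 < B v v) {ι : Type*} [Fintype ι]
    [DecidableEq ι] (e : Basis ι ℝ V) (he : ∀ i j, B (e i) (e j) = if i = j then 1 else 0)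
    (b : LinearMap.BilinForm ℝ V) (S : Submodule ℝ V) {c : ℝ}
    (hS : ∀ v ∈ S, b v v = c * B v v) (hT : ∀ v ∈ B.orthogonal S, b v v = 0) :
    ∑ i, b (e i) (e i) = c * finrank ℝ S := by
  classical
  have hA : ∀ v w, B ((B.toDual (nondegenerate_of_pos hp)).symm (b v)) w = b v w := fun v w =>
    LinearMap.BilinForm.apply_toDual_symm_apply (B := B) (b v) w
  obtain ⟨u, hu⟩ := exists_orthonormal_basis hs hp S
  obtain ⟨h, hh⟩ := exists_orthonormal_basis hs hp (B.orthogonal S)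
  let e' := (u.prod h).map (Submodule.prodEquivOfIsCompl _ _ (isCompl_orthogonal_of_pos hs hp S))
  have e'l : ∀ i, e' (Sum.inl i) = u i := fun i => by simp [e']
  have e'r : ∀ i, e' (Sum.inr i) = h i := fun i => by simp [e']
  have h0 : ∀ i j, B (u i : V) (h j : V) = 0 := fun i j => (h j).2 _ (u i).2
  have he' : ∀ i j, B (e' i) (e' j) = if i = j then 1 else 0 := by
    rintro (i | i) (j | j)
    · simp [e'l, hu]
    · simp [e'l, e'r, h0]
    · rw [hs]
      simp [e'l, e'r, h0]
    · simp [e'r, hh]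
  let A : V →ₗ[ℝ] V := (B.toDual (nondegenerate_of_pos hp)).symm.toLinearMap.comp b
  have h1 := trace_eq_sum_of_orthonormal B e he A
  rw [trace_eq_sum_of_orthonormal B e' he' A] at h1
  simp only [A, LinearMap.comp_apply, LinearEquiv.coe_coe, hA, Fintype.sum_sum_type, e'l, e'r] at h1
  rw [← h1, Finset.sum_eq_zero (s := Finset.univ) (f := fun i => b (h i : V) (h i : V))
    (fun i _ => hT _ (h i).2)]
  simp [hS _ (u _).2, hu, mul_comm]

end Trace

/-! ### The tension field of a Clairaut submersion -/

section Tension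

variable {E : Type*} [NormedAddCommGroup E] [NormedSpace ℝ E] [FiniteDimensional ℝ E]
  {H : Type*} [TopologicalSpace H] {I : ModelWithCorners ℝ E H} [I.Boundaryless]
  {M : Type*} [TopologicalSpace M] [ChartedSpace H M] [IsManifold I ∞ M]
  {E' : Type*} [NormedAddCommGroup E'] [NormedSpace ℝ E'] [FiniteDimensional ℝ E']
  {H' : Type*} [TopologicalSpace H'] {I' : ModelWithCorners ℝ E' H'} [I'.Boundaryless]
  {M' : Type*} [TopologicalSpace M'] [ChartedSpace H' M'] [IsManifold I' ∞ M']

/-- The form `(u, v) ↦ -koszul D u v x`. -/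
def koszulForm (D : E →L[ℝ] E →L[ℝ] E →L[ℝ] ℝ) (x : E) : LinearMap.BilinForm ℝ E :=
  LinearMap.mk₂ ℝ (fun u v => -koszul D u v x)
    (fun u u' v => by rw [koszul_add_left, neg_add])
    (fun c u v => by rw [koszul_smul_left, smul_eq_mul, mul_neg])
    (fun u v v' => by rw [koszul_add_middle, neg_add])
    (fun c u v => by rw [koszul_smul_middle, smul_eq_mul, mul_neg])

theorem IsRiemannianSubmersion.finrank_vertical {g : Metric I M} {g' : Metric I' M'}
    {φ : M → M'} (hφ : IsRiemannianSubmersion I I' g g' φ) (p : M) :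
    finrank ℝ (vertical (I := I) (I' := I') φ p) + finrank ℝ E' = finrank ℝ E := by
  have h := LinearMap.finrank_range_add_finrank_ker (mfderiv I I' φ p).toLinearMap
  rw [LinearMap.range_eq_top.2 (hφ.surjective_mfderiv p), finrank_top] at h
  rw [add_comm]
  exact h

theorem IsRiemannianSubmersion.eq_zero_of_inner_horizontal {g : Metric I M} {g' : Metric I' M'}
    {φ : M → M'} (hφ : IsRiemannianSubmersion I I' g g' φ) {p : M} {y : TangentSpace I' (φ p)}
    (h : ∀ x ∈ horizontal I I' g φ p, g'.inner (φ p) y (mfderiv I I' φ p x) = 0) : y = 0 := by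
  refine eq_zero_of_inner_eq_zero g' (φ p) fun w => ?_
  obtain ⟨v, rfl⟩ := hφ.surjective_mfderiv p w
  rw [← mfderiv_horizontalProj (I' := I') g φ p v]
  exact h _ (horizontalProj_mem g φ p v)

/-- If the fibers are totally umbilical at `p`, with `g'(∇φ_*(U, U), φ_* X) = c g(U, U)`, then the
tension field pairs with `φ_* X` to `c` times the dimension of the fibers: horizontal vectors do
not contribute. -/
theorem IsRiemannianSubmersion.inner_tensionField {g : Metric I M} {g' : Metric I' M'}
    {φ : M → M'} (hφ : IsRiemannianSubmersion I I' g g' φ) (p : M) {x : E}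
    (hx : (x : TangentSpace I p) ∈ horizontal I I' g φ p) {c : ℝ}
    (hc : ∀ u : E, (u : TangentSpace I p) ∈ vertical (I := I) (I' := I') φ p →
      -koszul (defectDeriv g g' φ p) u u x = c * g.inner p u u) :
    g'.inner (φ p) (tensionField g g' φ p) (mfderiv I I' φ p x) =
      c * finrank ℝ (vertical (I := I) (I' := I') φ p) := by
  have h1 := sum_orthonormal_eq_of_isCompl (V := TangentSpace I p) (form_symm g p) (form_pos g p)
    ((frame g p ⊤).map Submodule.topEquiv) (fun i j => inner_frame g p ⊤ i j)
    (@id (LinearMap.BilinForm ℝ (TangentSpace I p)) (koszulForm (E := E) (defectDeriv g g' φ p) x))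
    (vertical (I := I) (I' := I') φ p) (c := c) hc
    (fun v hv => neg_eq_zero.2 (hφ.koszul_horizontal p hv hv hx))
  rw [← h1, tensionField, map_sum, sum_apply]
  exact Finset.sum_congr rfl fun i _ => hφ.inner_secondFundamentalForm p _ _ hx

theorem IsRiemannianSubmersion.tensionField_eq_zero_of_finrank_eq {g : Metric I M}
    {g' : Metric I' M'} {φ : M → M'} (hφ : IsRiemannianSubmersion I I' g g' φ) (p : M)
    (hk : finrank ℝ E = finrank ℝ E') : tensionField g g' φ p = 0 := by
  have h0 : finrank ℝ (vertical (I := I) (I' := I') φ p) = 0 := by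
    have := hφ.finrank_vertical p
    omega
  have hb : ∀ u ∈ vertical (I := I) (I' := I') φ p, u = 0 := by
    rw [Submodule.finrank_eq_zero] at h0
    intro u hu
    rw [h0] at hu
    exact hu
  refine hφ.eq_zero_of_inner_horizontal fun x hx => ?_
  have h := hφ.inner_tensionField p hx (c := 0) (fun u hu => by
    have hu0 : u = 0 := hb u hu
    subst hu0
    have e : ∀ (D : E →L[ℝ] E →L[ℝ] E →L[ℝ] ℝ) (x : E), -koszul D 0 0 x = 0 := by simp [koszul]
    rw [zero_mul]
    exact e _ x)
  rw [zero_mul] at h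
  exact h

/-- A Clairaut submersion is harmonic if and only if its potential has no derivative or its fibers
are points. -/
theorem IsClairautWith.isHarmonic_iff {g : Metric I M} {g' : Metric I' M'}
    {φ : M → M'} (hφ : IsRiemannianSubmersion I I' g g' φ) {ψ : M → ℝ}
    (hψ : ContMDiff I 𝓘(ℝ, ℝ) ∞ ψ) (hc : IsClairautWith I I' g φ (fun p => Real.exp (ψ p))) :
    IsHarmonic g g' φ ↔ finrank ℝ E = finrank ℝ E' ∨
      ∀ p (v : TangentSpace I p), dirDeriv ψ p v = 0 := by
  have ht : ∀ p (x : E), (x : TangentSpace I p) ∈ horizontal I I' g φ p →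
      g'.inner (φ p) (tensionField g g' φ p) (mfderiv I I' φ p x) =
        dirDeriv (I := I) ψ p x * finrank ℝ (vertical (I := I) (I' := I') φ p) := by
    intro p x hx
    exact hφ.inner_tensionField p hx fun u hu => (dirDeriv_horizontal hφ hψ hc hu hx).symm
  constructor
  · intro h
    by_cases hk : finrank ℝ E = finrank ℝ E'
    · exact Or.inl hk
    refine Or.inr fun p v => ?_
    have hx := ht p _ (horizontalProj_mem (I' := I') g φ p v)
    have hk' : (finrank ℝ (vertical (I := I) (I' := I') φ p) : ℝ) ≠ 0 := by
      have := hφ.finrank_vertical p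
      exact_mod_cast fun h0 => hk (by omega)
    rw [h p, map_zero] at hx
    have h1 := (mul_eq_zero.1 hx.symm).resolve_right hk'
    have h2 := dirDeriv_vertical hφ hψ hc (verticalProj_mem (I' := I') g φ p v)
    have h3 := congrArg (mfderiv I 𝓘(ℝ, ℝ) ψ p)
      (verticalProj_add_horizontalProj (I' := I') g φ p v)
    rw [map_add] at h3
    refine (h3.symm.trans (congrArg₂ (fun a b : ℝ => a + b) h2 h1)).trans (add_zero 0)
  · rintro (hk | h) p
    · exact hφ.tensionField_eq_zero_of_finrank_eq p hk
    · refine hφ.eq_zero_of_inner_horizontal fun x hx => ?_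
      refine (ht p x hx).trans ?_
      have := h p x
      rw [this, zero_mul]

theorem gradient_eq_zero_iff (g : Metric I M) (ψ : M → ℝ) (p : M) :
    gradient g ψ p = 0 ↔ ∀ v : TangentSpace I p, dirDeriv ψ p v = 0 := by
  have h : ∀ v, g.inner p (gradient g ψ p) v = dirDeriv ψ p v := fun v => inner_sharp g p _ v
  constructor
  · intro h0 v
    rw [← h, h0]
    simp
  · intro h0
    exact eq_zero_of_inner_eq_zero g p fun w => (h w).trans (h0 w)

end Tension

/-! ### The mean curvature of the fibers -/

section MeanCurvature

variable {E : Type*} [NormedAddCommGroup E] [NormedSpace ℝ E] [FiniteDimensional ℝ E]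
  {H : Type*} [TopologicalSpace H] {I : ModelWithCorners ℝ E H} [I.Boundaryless]
  {M : Type*} [TopologicalSpace M] [ChartedSpace H M] [IsManifold I ∞ M]
  {E' : Type*} [NormedAddCommGroup E'] [NormedSpace ℝ E'] [FiniteDimensional ℝ E']
  {H' : Type*} [TopologicalSpace H'] {I' : ModelWithCorners ℝ E' H'} [I'.Boundaryless]
  {M' : Type*} [TopologicalSpace M'] [ChartedSpace H' M'] [IsManifold I' ∞ M']

/-- In coordinates, the vertical part of the constant vector field `u` solves the linear equation
with matrix `g` and right-hand side `defect (u, ·)`. -/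
theorem IsRiemannianSubmersion.localForm_verticalProj {g : Metric I M} {g' : Metric I' M'}
    {φ : M → M'} (hφ : IsRiemannianSubmersion I I' g g' φ) (p : M) (u : E) {z : E}
    (hz : z ∈ (extChartAt I p).target) (w : E) :
    localForm g.inner p z ((trivializationAt E (TangentSpace I : M → Type _) p
      ⟨(extChartAt I p).symm z, verticalProj I I' g φ ((extChartAt I p).symm z)
        (FiberBundle.extend E (E := (TangentSpace I : M → Type _)) (x := p) u
          ((extChartAt I p).symm z))⟩).2) w = localForm (defect g g' φ) p z u w := by
  have hb : (extChartAt I p).symm z ∈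
      (trivializationAt E (TangentSpace I : M → Type _) p).baseSet := by
    rw [TangentBundle.trivializationAt_baseSet, ← extChartAt_source I]
    exact (extChartAt I p).map_target hz
  rw [← Trivialization.continuousLinearMapAt_apply_of_mem (R := ℝ) _ hb, localForm_apply,
    Trivialization.symmL_continuousLinearMapAt _ hb, ← hφ.defect_eq_inner_verticalProj,
    localForm_apply]
  exact congrArg (fun a => defect g g' φ ((extChartAt I p).symm z) a _)
    (extend_eq_symmL ((extChartAt I p).map_target hz) u)

/-- O'Neill's tensor of the fibers, paired with a horizontal vector. It is computed by
differentiating the linear equation of `localForm_verticalProj`. -/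
theorem IsRiemannianSubmersion.inner_fiberTensor {g : Metric I M} {g' : Metric I' M'}
    {φ : M → M'} (hφ : IsRiemannianSubmersion I I' g g' φ) (p : M) {u x : E}
    (hu : (u : TangentSpace I p) ∈ vertical (I := I) (I' := I') φ p)
    (hx : (x : TangentSpace I p) ∈ horizontal I I' g φ p) :
    g.inner p (fiberTensor I I' g φ p u u) x = koszul (defectDeriv g g' φ p) u u x := by
  have := FiniteDimensional.complete ℝ E
  have hG := (contDiffAt_localForm_inner g p).differentiableAt (by simp)
  have hD := (contDiffAt_localForm_defect g g' hφ.contMDiff p).differentiableAt (by simp)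
  have hinv := (contDiffAt_inverse_localForm g p).differentiableAt (by simp)
  set h : E → E := fun z =>
    (localForm g.inner p z).inverse (localForm (defect g g' φ) p z u) with hh
  have hhd : DifferentiableAt ℝ h (extChartAt I p p) :=
    hinv.clm_apply (hD.clm_apply (differentiableAt_const u))
  have hW : ∀ᶠ z in 𝓝 (extChartAt I p p), (trivializationAt E (TangentSpace I : M → Type _) p
      ⟨(extChartAt I p).symm z, verticalProj I I' g φ ((extChartAt I p).symm z)
        (FiberBundle.extend E (E := (TangentSpace I : M → Type _)) (x := p) u
          ((extChartAt I p).symm z))⟩).2 = h z := by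
    filter_upwards [extChartAt_target_mem_nhds (I := I) p] with z hz
    obtain ⟨e, he⟩ := exists_continuousLinearEquiv_of_pos (B := localForm g.inner p z)
      fun v hv => localForm_inner_pos g hz hv
    have h1 : localForm (defect g g' φ) p z u = localForm g.inner p z _ :=
      ContinuousLinearMap.ext fun w => (hφ.localForm_verticalProj p u hz w).symm
    rw [hh]
    simp only
    rw [h1, ← he, ContinuousLinearMap.inverse_equiv]
    exact (e.symm_apply_apply _).symm
  have hval : FiberBundle.extend E (E := (TangentSpace I : M → Type _)) (x := p) u p = u :=
    FiberBundle.extend_apply_self E (E := (TangentSpace I : M → Type _)) (x := p) u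
  have hVu : verticalProj I I' g φ p u = u := Submodule.projection_apply_left _ ⟨u, hu⟩
  have hcov := covDeriv_eq g (Y := fun x => verticalProj I I' g φ x
    (FiberBundle.extend E (E := (TangentSpace I : M → Type _)) (x := p) u x)) hhd hW u
  simp only [hval] at hcov
  -- the equation defining `h`, at the base point and differentiated in the direction `u`
  have hGh : ∀ᶠ z in 𝓝 (extChartAt I p p),
      localForm g.inner p z (h z) x = localForm (defect g g' φ) p z u x := by
    filter_upwards [hW, extChartAt_target_mem_nhds (I := I) p] with z h1 hz
    rw [← h1]
    exact hφ.localForm_verticalProj p u hz x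
  have h0 : h (extChartAt I p p) = u := by
    obtain ⟨e, he⟩ := exists_continuousLinearEquiv_of_pos
      (B := localForm g.inner p (extChartAt I p p))
      fun v hv => localForm_inner_pos g (mem_extChartAt_target p) hv
    have h1 : localForm (defect g g' φ) p (extChartAt I p p) u =
        localForm g.inner p (extChartAt I p p) u := by
      refine ContinuousLinearMap.ext fun w => ?_
      exact (localForm_self _ p u w).trans ((defect_vertical g g' hu w).trans
        (localForm_self g.inner p u w).symm)
    rw [hh]
    simp only
    rw [h1, ← he, ContinuousLinearMap.inverse_equiv]
    exact e.symm_apply_apply u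
  have hder : fderiv ℝ (localForm g.inner p) (extChartAt I p p) u u x
      + localForm g.inner p (extChartAt I p p) (fderiv ℝ h (extChartAt I p p) u) x =
      defectDeriv g g' φ p u u x := by
    have e1 := ((hG.hasFDerivAt.clm_apply hhd.hasFDerivAt).clm_apply
      (hasFDerivAt_const x _)).congr_of_eventuallyEq
      (f₁ := fun z => localForm (defect g g' φ) p z u x)
      (hGh.mono fun z hz => hz.symm)
    have e2 := fderiv_apply₂ hD u u x
    rw [e1.fderiv, h0] at e2
    rw [defectDeriv, ← e2]
    simp [add_comm]
  have hP := koszul_pullbackForm_vertical g g' hφ.contMDiff p x u hu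
  have hsub := defectDeriv_eq_sub g g' hφ.contMDiff p x u u
  have hloc := localForm_self g.inner p (fderiv ℝ h (extChartAt I p p) u) x
  have hchr := inner_christoffel g p u u x
  have hadd : ∀ a b w : TangentSpace I p, g.inner p (a + b) w = g.inner p a w + g.inner p b w :=
    fun a b w => by rw [map_add, add_apply]
  have hproj : ∀ y : TangentSpace I p,
      g.inner p (horizontalProj I I' g φ p y) x = g.inner p y x := by
    intro y
    have h1 := congrArg (fun a => g.inner p a x)
      (verticalProj_add_horizontalProj (I' := I') g φ p y)
    have h2 := inner_vertical_horizontal (I' := I') g (verticalProj_mem g φ p y) hx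
    exact (((hadd _ _ _).trans (congrArg (· + _) h2)).trans (zero_add _)).symm.trans h1
  have hT : g.inner p (fiberTensor I I' g φ p u u) x =
      localForm g.inner p (extChartAt I p p) (fderiv ℝ h (extChartAt I p p) u) x +
        koszul (fderiv ℝ (localForm g.inner p) (extChartAt I p p)) u u x := by
    refine (hproj _).trans ?_
    rw [hcov, hloc]
    have e : ∀ a b c d : TangentSpace I p, b = d → g.inner p (a + christoffel g p c b) x =
        g.inner p a x + g.inner p (christoffel g p c d) x := by
      rintro a b c _ rfl
      exact hadd _ _ _
    exact (e _ _ _ _ hVu).trans (congrArg (_ + ·) hchr)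
  rw [hT]
  simp only [koszul] at hP ⊢
  rw [hsub]
  linarith

theorem IsRiemannianSubmersion.meanCurvature_eq_zero {g : Metric I M} {g' : Metric I' M'}
    {φ : M → M'} (hφ : IsRiemannianSubmersion I I' g g' φ) (p : M)
    (h : ∀ u x : E, (u : TangentSpace I p) ∈ vertical (I := I) (I' := I') φ p →
      (x : TangentSpace I p) ∈ horizontal I I' g φ p → koszul (defectDeriv g g' φ p) u u x = 0) :
    meanCurvature I I' g φ p = 0 := by
  rw [meanCurvature, Finset.sum_eq_zero, smul_zero]
  intro i _
  set u := (frame g p (vertical (I := I) (I' := I') φ p) i : TangentSpace I p) with hu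
  have hum : u ∈ vertical (I := I) (I' := I') φ p :=
    (frame g p (vertical (I := I) (I' := I') φ p) i).2
  have hT : fiberTensor I I' g φ p u u ∈ horizontal I I' g φ p := horizontalProj_mem g φ p _
  by_contra h0
  have hpos := g.pos p _ h0
  have hz := (hφ.inner_fiberTensor p hum hT).trans (h _ _ hum hT)
  exact hpos.ne' hz

end MeanCurvature

/-! ### Functions with vanishing derivative and scaled metrics -/

section Constant

variable {E : Type*} [NormedAddCommGroup E] [NormedSpace ℝ E] [FiniteDimensional ℝ E]
  {H : Type*} [TopologicalSpace H] {I : ModelWithCorners ℝ E H} [I.Boundaryless]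
  {M : Type*} [TopologicalSpace M] [ChartedSpace H M] [IsManifold I ∞ M]

theorem apply_eq_of_dirDeriv_eq_zero [PreconnectedSpace M] {f : M → ℝ}
    (hf : ContMDiff I 𝓘(ℝ, ℝ) ∞ f) (h0 : ∀ x (v : TangentSpace I x), dirDeriv f x v = 0)
    (x y : M) : f x = f y := by
  refine IsLocallyConstant.apply_eq_of_preconnectedSpace
    ((IsLocallyConstant.iff_eventually_eq f).2 fun p => ?_) x y
  have hfd : MDifferentiable I 𝓘(ℝ, ℝ) f := hf.mdifferentiable (by simp)
  have ht := mem_extChartAt_target (I := I) p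
  obtain ⟨r, hr, hball⟩ := Metric.isOpen_iff.1 (isOpen_extChartAt_target (I := I) p) _ ht
  have hd : ∀ z ∈ Metric.ball (extChartAt I p p) r,
      HasFDerivAt (f ∘ (extChartAt I p).symm) (0 : E →L[ℝ] ℝ) z := by
    intro z hz
    have hs := mdifferentiableAt_extChartAt_symm (I := I) (hball hz)
    have hc := (hfd ((extChartAt I p).symm z)).hasMFDerivAt.comp z hs.hasMFDerivAt
    have hz0 : mfderiv I 𝓘(ℝ, ℝ) f ((extChartAt I p).symm z) = 0 :=
      ContinuousLinearMap.ext fun v => h0 _ v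
    rw [hz0, ContinuousLinearMap.zero_comp] at hc
    exact hc.hasFDerivAt
  have hconst : ∀ z ∈ Metric.ball (extChartAt I p p) r,
      f ((extChartAt I p).symm z) = f ((extChartAt I p).symm (extChartAt I p p)) := by
    intro z hz
    exact Metric.isOpen_ball.is_const_of_fderiv_eq_zero (𝕜 := ℝ)
      (convex_ball _ _).isPreconnected
      (fun w hw => (hd w hw).differentiableAt.differentiableWithinAt)
      (fun w hw => (hd w hw).fderiv) hz (Metric.mem_ball_self hr)
  filter_upwards [extChartAt_source_mem_nhds (I := I) p,
    (continuousAt_extChartAt (I := I) p).preimage_mem_nhds (Metric.ball_mem_nhds _ hr)]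
    with q hq hq'
  have := hconst _ hq'
  rwa [(extChartAt I p).left_inv hq, (extChartAt I p).left_inv (mem_extChartAt_source p)] at this

/-- The metric `c g` for a constant `c > 0`. -/
def scaledMetric (g : Metric I M) (c : ℝ) (hc : 0 < c) : Metric I M where
  inner p := c • g.inner p
  symm p v w := by
    simp only [smul_apply]
    rw [g.symm]
  pos p v hv := by
    have := g.pos p v hv
    exact mul_pos hc this
  isVonNBounded p := by
    have b : Bornology.IsVonNBounded ℝ {v : E | g.inner p v v < 1} := g.isVonNBounded p
    have hb := b.image ((√c)⁻¹ • ContinuousLinearMap.id ℝ E)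
    refine Bornology.IsVonNBounded.subset ?_ hb
    intro v hv
    refine ⟨√c • v, ?_, ?_⟩
    · have e : ∀ (a : ℝ) (u : TangentSpace I p),
          g.inner p (a • u) (a • u) = a * a * g.inner p u u := fun a u => by simp [mul_assoc]
      refine lt_of_eq_of_lt (e (√c) v) ?_
      rw [Real.mul_self_sqrt hc.le]
      exact hv
    · exact inv_smul_smul₀ (Real.sqrt_pos.2 hc).ne' v
  contMDiff := ContMDiff.const_smul_section (a := c) g.contMDiff

theorem scaledMetric_inner (g : Metric I M) (c : ℝ) (hc : 0 < c) (p : M) (v w : TangentSpace I p) :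
    (scaledMetric g c hc).inner p v w = c * g.inner p v w := rfl

end Constant

/-! ### Warped product submersions -/

section Product

variable {E₁ : Type*} [NormedAddCommGroup E₁] [NormedSpace ℝ E₁] [FiniteDimensional ℝ E₁]
  {H₁ : Type*} [TopologicalSpace H₁] {I₁ : ModelWithCorners ℝ E₁ H₁} [I₁.Boundaryless]
  {M₁ : Type*} [TopologicalSpace M₁] [ChartedSpace H₁ M₁] [IsManifold I₁ ∞ M₁]
  {E₂ : Type*} [NormedAddCommGroup E₂] [NormedSpace ℝ E₂] [FiniteDimensional ℝ E₂]
  {H₂ : Type*} [TopologicalSpace H₂] {I₂ : ModelWithCorners ℝ E₂ H₂} [I₂.Boundaryless]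
  {M₂ : Type*} [TopologicalSpace M₂] [ChartedSpace H₂ M₂] [IsManifold I₂ ∞ M₂]
  {F₁ : Type*} [NormedAddCommGroup F₁] [NormedSpace ℝ F₁] [FiniteDimensional ℝ F₁]
  {K₁ : Type*} [TopologicalSpace K₁] {J₁ : ModelWithCorners ℝ F₁ K₁} [J₁.Boundaryless]
  {N₁ : Type*} [TopologicalSpace N₁] [ChartedSpace K₁ N₁] [IsManifold J₁ ∞ N₁]
  {F₂ : Type*} [NormedAddCommGroup F₂] [NormedSpace ℝ F₂] [FiniteDimensional ℝ F₂]
  {K₂ : Type*} [TopologicalSpace K₂] {J₂ : ModelWithCorners ℝ F₂ K₂} [J₂.Boundaryless]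
  {N₂ : Type*} [TopologicalSpace N₂] [ChartedSpace K₂ N₂] [IsManifold J₂ ∞ N₂]

theorem warpedMetric_inner (g₁ : Metric I₁ M₁) (g₂ : Metric I₂ M₂) {f : M₁ → ℝ}
    (hf : ContMDiff I₁ 𝓘(ℝ, ℝ) ∞ f) (hf0 : ∀ x, 0 < f x) (p : M₁ × M₂) (v w : E₁ × E₂) :
    (warpedMetric g₁ g₂ f hf hf0).inner p v w =
      g₁.inner p.1 v.1 w.1 + f p.1 ^ 2 * g₂.inner p.2 v.2 w.2 := by
  have h : ∀ v w : TangentSpace (I₁.prod I₂) p, warpedForm g₁ g₂ f p v w =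
      g₁.inner p.1 v.1 w.1 + f p.1 ^ 2 * g₂.inner p.2 v.2 w.2 := fun v w => by
    rw [warpedForm_apply, tangentFst_apply, tangentFst_apply, tangentSnd_apply, tangentSnd_apply]
  exact h v w

theorem mfderiv_prodMap_apply {φ₁ : M₁ → N₁} {φ₂ : M₂ → N₂} (h₁ : ContMDiff I₁ J₁ ∞ φ₁)
    (h₂ : ContMDiff I₂ J₂ ∞ φ₂) (p : M₁ × M₂) (v : E₁ × E₂) :
    mfderiv (I₁.prod I₂) (J₁.prod J₂) (Prod.map φ₁ φ₂) p v =
      ((mfderiv I₁ J₁ φ₁ p.1 v.1, mfderiv I₂ J₂ φ₂ p.2 v.2) : F₁ × F₂) := by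
  rw [mfderiv_prodMap (h₁.mdifferentiableAt (by simp)) (h₂.mdifferentiableAt (by simp))]
  rfl

variable {g₁ : Metric I₁ M₁} {g₂ : Metric I₂ M₂} {f : M₁ → ℝ}
  {g₁' : Metric J₁ N₁} {g₂' : Metric J₂ N₂} {ρ : N₁ → ℝ} {φ₁ : M₁ → N₁} {φ₂ : M₂ → N₂}

theorem mem_vertical_prodMap (h₁ : ContMDiff I₁ J₁ ∞ φ₁) (h₂ : ContMDiff I₂ J₂ ∞ φ₂)
    {p : M₁ × M₂} {v : E₁ × E₂} :
    (v : TangentSpace (I₁.prod I₂) p) ∈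
        vertical (I := I₁.prod I₂) (I' := J₁.prod J₂) (Prod.map φ₁ φ₂) p ↔
      v.1 ∈ vertical (I := I₁) (I' := J₁) φ₁ p.1 ∧ v.2 ∈ vertical (I := I₂) (I' := J₂) φ₂ p.2 := by
  refine mem_vertical.trans ?_
  rw [mfderiv_prodMap_apply h₁ h₂ p v]
  exact Prod.ext_iff

theorem mem_horizontal_prodMap (h₁ : ContMDiff I₁ J₁ ∞ φ₁) (h₂ : ContMDiff I₂ J₂ ∞ φ₂)
    (hf : ContMDiff I₁ 𝓘(ℝ, ℝ) ∞ f) (hf0 : ∀ x, 0 < f x) {p : M₁ × M₂} {v : E₁ × E₂} :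
    (v : TangentSpace (I₁.prod I₂) p) ∈
        horizontal (I₁.prod I₂) (J₁.prod J₂) (warpedMetric g₁ g₂ f hf hf0) (Prod.map φ₁ φ₂) p ↔
      v.1 ∈ horizontal I₁ J₁ g₁ φ₁ p.1 ∧ v.2 ∈ horizontal I₂ J₂ g₂ φ₂ p.2 := by
  constructor
  · intro h
    constructor
    · intro u hu
      have h' := h ((u, 0) : E₁ × E₂) ((mem_vertical_prodMap h₁ h₂).2 ⟨hu, zero_mem _⟩)
      have e := warpedMetric_inner g₁ g₂ hf hf0 p ((u, 0) : E₁ × E₂) v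
      have z : g₂.inner p.2 (0 : E₂) v.2 = 0 := by
        exact congrArg (fun a : E₂ →L[ℝ] ℝ => a v.2) (map_zero (g₂.inner p.2))
      refine Eq.trans ?_ (e.symm.trans h')
      change _ = _ + f p.1 ^ 2 * g₂.inner p.2 (0 : E₂) v.2
      rw [z, mul_zero, add_zero]
      rfl
    · intro u hu
      have h' := h ((0, u) : E₁ × E₂) ((mem_vertical_prodMap h₁ h₂).2 ⟨zero_mem _, hu⟩)
      have e := warpedMetric_inner g₁ g₂ hf hf0 p ((0, u) : E₁ × E₂) v
      have z : g₁.inner p.1 (0 : E₁) v.1 = 0 := by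
        exact congrArg (fun a : E₁ →L[ℝ] ℝ => a v.1) (map_zero (g₁.inner p.1))
      have h3 : g₁.inner p.1 (0 : E₁) v.1 + f p.1 ^ 2 * g₂.inner p.2 u v.2 = 0 := e.symm.trans h'
      rw [z, zero_add] at h3
      exact (mul_eq_zero.1 h3).resolve_left (pow_pos (hf0 _) 2).ne'
  · rintro ⟨hv1, hv2⟩ u hu
    obtain ⟨hu1, hu2⟩ := (mem_vertical_prodMap h₁ h₂).1 hu
    refine (warpedMetric_inner g₁ g₂ hf hf0 p u v).trans ?_
    have e1 := inner_vertical_horizontal g₁ hu1 hv1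
    have e2 := inner_vertical_horizontal g₂ hu2 hv2
    have e : ∀ a b c : ℝ, a = 0 → b = 0 → a + c * b = 0 := by
      rintro _ _ c rfl rfl
      simp
    exact e _ _ _ e1 e2

theorem IsRiemannianWarpedProductSubmersion.isRiemannianSubmersion
    (hφ : IsRiemannianWarpedProductSubmersion g₁ g₂ f g₁' g₂' ρ φ₁ φ₂)
    (hf : ContMDiff I₁ 𝓘(ℝ, ℝ) ∞ f) (hf0 : ∀ x, 0 < f x)
    (hρ : ContMDiff J₁ 𝓘(ℝ, ℝ) ∞ ρ) (hρ0 : ∀ x, 0 < ρ x) :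
    IsRiemannianSubmersion (I₁.prod I₂) (J₁.prod J₂) (warpedMetric g₁ g₂ f hf hf0)
      (warpedMetric g₁' g₂' ρ hρ hρ0) (Prod.map φ₁ φ₂) where
  contMDiff := hφ.fst.contMDiff.prodMap hφ.snd.contMDiff
  surjective := hφ.fst.surjective.prodMap hφ.snd.surjective
  surjective_mfderiv p := by
    rintro w
    obtain ⟨a, ha⟩ := hφ.fst.surjective_mfderiv p.1 w.1
    obtain ⟨b, hb⟩ := hφ.snd.surjective_mfderiv p.2 w.2
    exact ⟨((a, b) : E₁ × E₂), (mfderiv_prodMap_apply hφ.fst.contMDiff hφ.snd.contMDiff p _).trans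
      (Prod.ext ha hb)⟩
  len_mfderiv p v hv := by
    obtain ⟨h1, h2⟩ := (mem_horizontal_prodMap hφ.fst.contMDiff hφ.snd.contMDiff hf hf0).1 hv
    have e := mfderiv_prodMap_apply hφ.fst.contMDiff hφ.snd.contMDiff p v
    have e1 := hφ.fst.inner_mfderiv h1 v.1
    have e2 := hφ.snd.inner_mfderiv h2 v.2
    have hw : f p.1 = ρ (φ₁ p.1) := congrFun hφ.warping p.1
    rw [len, len, e]
    refine congrArg Real.sqrt ?_
    refine (warpedMetric_inner g₁' g₂' hρ hρ0 (Prod.map φ₁ φ₂ p) _ _).trans ?_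
    refine Eq.trans ?_ (warpedMetric_inner g₁ g₂ hf hf0 p v v).symm
    rw [hw]
    exact congrArg₂ (fun a b => a + ρ (φ₁ p.1) ^ 2 * b) e1 e2

end Product

/-! ### The defect form of a warped product submersion -/

section ProductDefect

variable {E₁ : Type*} [NormedAddCommGroup E₁] [NormedSpace ℝ E₁] [FiniteDimensional ℝ E₁]
  {H₁ : Type*} [TopologicalSpace H₁] {I₁ : ModelWithCorners ℝ E₁ H₁} [I₁.Boundaryless]
  {M₁ : Type*} [TopologicalSpace M₁] [ChartedSpace H₁ M₁] [IsManifold I₁ ∞ M₁]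
  {E₂ : Type*} [NormedAddCommGroup E₂] [NormedSpace ℝ E₂] [FiniteDimensional ℝ E₂]
  {H₂ : Type*} [TopologicalSpace H₂] {I₂ : ModelWithCorners ℝ E₂ H₂} [I₂.Boundaryless]
  {M₂ : Type*} [TopologicalSpace M₂] [ChartedSpace H₂ M₂] [IsManifold I₂ ∞ M₂]
  {F₁ : Type*} [NormedAddCommGroup F₁] [NormedSpace ℝ F₁] [FiniteDimensional ℝ F₁]
  {K₁ : Type*} [TopologicalSpace K₁] {J₁ : ModelWithCorners ℝ F₁ K₁} [J₁.Boundaryless]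
  {N₁ : Type*} [TopologicalSpace N₁] [ChartedSpace K₁ N₁] [IsManifold J₁ ∞ N₁]
  {F₂ : Type*} [NormedAddCommGroup F₂] [NormedSpace ℝ F₂] [FiniteDimensional ℝ F₂]
  {K₂ : Type*} [TopologicalSpace K₂] {J₂ : ModelWithCorners ℝ F₂ K₂} [J₂.Boundaryless]
  {N₂ : Type*} [TopologicalSpace N₂] [ChartedSpace K₂ N₂] [IsManifold J₂ ∞ N₂]

/-- The product rule for a form `B₁ + F² B₂` on a product. -/
theorem fderiv_warped {B : E₁ × E₂ → E₁ × E₂ →L[ℝ] E₁ × E₂ →L[ℝ] ℝ}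
    {B₁ : E₁ → E₁ →L[ℝ] E₁ →L[ℝ] ℝ} {B₂ : E₂ → E₂ →L[ℝ] E₂ →L[ℝ] ℝ} {F : E₁ → ℝ} {a : E₁} {b : E₂}
    (hB : DifferentiableAt ℝ B (a, b)) (hB₁ : DifferentiableAt ℝ B₁ a)
    (hB₂ : DifferentiableAt ℝ B₂ b) (hF : DifferentiableAt ℝ F a)
    (h : ∀ᶠ z in 𝓝 (a, b), ∀ v w, B z v w = B₁ z.1 v.1 w.1 + F z.1 ^ 2 * B₂ z.2 v.2 w.2)
    (u v w : E₁ × E₂) :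
    fderiv ℝ B (a, b) u v w = fderiv ℝ B₁ a u.1 v.1 w.1
      + 2 * F a * fderiv ℝ F a u.1 * B₂ b v.2 w.2 + F a ^ 2 * fderiv ℝ B₂ b u.2 v.2 w.2 := by
  have hfst : HasFDerivAt (Prod.fst : E₁ × E₂ → E₁) (ContinuousLinearMap.fst ℝ E₁ E₂) (a, b) :=
    hasFDerivAt_fst
  have hsnd : HasFDerivAt (Prod.snd : E₁ × E₂ → E₂) (ContinuousLinearMap.snd ℝ E₁ E₂) (a, b) :=
    hasFDerivAt_snd
  have d₁ : HasFDerivAt (fun y => B₁ y v.1 w.1) (fderiv ℝ (fun y => B₁ y v.1 w.1) a) a :=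
    ((hB₁.clm_apply (differentiableAt_const v.1)).clm_apply
      (differentiableAt_const w.1)).hasFDerivAt
  have d₂ : HasFDerivAt (fun y => B₂ y v.2 w.2) (fderiv ℝ (fun y => B₂ y v.2 w.2) b) b :=
    ((hB₂.clm_apply (differentiableAt_const v.2)).clm_apply
      (differentiableAt_const w.2)).hasFDerivAt
  have c₁ := HasFDerivAt.comp (f := (Prod.fst : E₁ × E₂ → E₁)) (a, b) d₁ hfst
  have c₂ := HasFDerivAt.comp (f := (Prod.snd : E₁ × E₂ → E₂)) (a, b) d₂ hsnd
  have cF := HasFDerivAt.comp (f := (Prod.fst : E₁ × E₂ → E₁)) (a, b) hF.hasFDerivAt hfst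
  have hd := (c₁.add ((cF.pow 2).mul c₂)).congr_of_eventuallyEq
    (f₁ := fun z => B z v w) (h.mono fun z hz => hz v w)
  rw [← fderiv_apply₂ hB, hd.fderiv, ← fderiv_apply₂ hB₁, ← fderiv_apply₂ hB₂]
  simp
  ring

theorem symmL_prod (p : M₁ × M₂) {z : E₁ × E₂}
    (hz : z ∈ (extChartAt (I₁.prod I₂) p).target) (v : E₁ × E₂) :
    (trivializationAt (E₁ × E₂) (TangentSpace (I₁.prod I₂) : M₁ × M₂ → Type _) p).symmL ℝ
        ((extChartAt (I₁.prod I₂) p).symm z) v =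
      (((trivializationAt E₁ (TangentSpace I₁ : M₁ → Type _) p.1).symmL ℝ
          ((extChartAt I₁ p.1).symm z.1) v.1,
        (trivializationAt E₂ (TangentSpace I₂ : M₂ → Type _) p.2).symmL ℝ
          ((extChartAt I₂ p.2).symm z.2) v.2) : E₁ × E₂) := by
  have hz' : z.1 ∈ (extChartAt I₁ p.1).target ∧ z.2 ∈ (extChartAt I₂ p.2).target := by
    rw [extChartAt_prod] at hz
    exact hz
  have hs := mdifferentiableAt_extChartAt_symm (I := I₁.prod I₂) hz
  have e1 : Prod.fst ∘ (extChartAt (I₁.prod I₂) p).symm = (extChartAt I₁ p.1).symm ∘ Prod.fst := by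
    rw [extChartAt_prod]
    rfl
  have e2 : Prod.snd ∘ (extChartAt (I₁.prod I₂) p).symm = (extChartAt I₂ p.2).symm ∘ Prod.snd := by
    rw [extChartAt_prod]
    rfl
  have c1 := mfderiv_comp z (mdifferentiableAt_fst (I := I₁) (I' := I₂)) hs
  have c2 := mfderiv_comp z (mdifferentiableAt_snd (I := I₁) (I' := I₂)) hs
  rw [e1, mfderiv_comp (I' := 𝓘(ℝ, E₁)) z (mdifferentiableAt_extChartAt_symm hz'.1)
    differentiableAt_fst.mdifferentiableAt, mfderiv_eq_fderiv, fderiv_fst, mfderiv_fst] at c1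
  rw [e2, mfderiv_comp (I' := 𝓘(ℝ, E₂)) z (mdifferentiableAt_extChartAt_symm hz'.2)
    differentiableAt_snd.mdifferentiableAt, mfderiv_eq_fderiv, fderiv_snd, mfderiv_snd] at c2
  rw [symmL_eq_mfderiv hz, symmL_eq_mfderiv hz'.1, symmL_eq_mfderiv hz'.2]
  exact Prod.ext (DFunLike.congr_fun c1 v).symm (DFunLike.congr_fun c2 v).symm

variable {g₁ : Metric I₁ M₁} {g₂ : Metric I₂ M₂} {f : M₁ → ℝ}
  {g₁' : Metric J₁ N₁} {g₂' : Metric J₂ N₂} {ρ : N₁ → ℝ} {φ₁ : M₁ → N₁} {φ₂ : M₂ → N₂}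

namespace IsRiemannianWarpedProductSubmersion

theorem defect_apply (hφ : IsRiemannianWarpedProductSubmersion g₁ g₂ f g₁' g₂' ρ φ₁ φ₂)
    (hf : ContMDiff I₁ 𝓘(ℝ, ℝ) ∞ f) (hf0 : ∀ x, 0 < f x)
    (hρ : ContMDiff J₁ 𝓘(ℝ, ℝ) ∞ ρ) (hρ0 : ∀ x, 0 < ρ x) (p : M₁ × M₂) (v w : E₁ × E₂) :
    defect (warpedMetric g₁ g₂ f hf hf0) (warpedMetric g₁' g₂' ρ hρ hρ0) (Prod.map φ₁ φ₂) p v w =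
      defect g₁ g₁' φ₁ p.1 v.1 w.1 + f p.1 ^ 2 * defect g₂ g₂' φ₂ p.2 v.2 w.2 := by
  have hw : f p.1 = ρ (φ₁ p.1) := congrFun hφ.warping p.1
  have e1 := warpedMetric_inner g₁ g₂ hf hf0 p v w
  have e2 := warpedMetric_inner g₁' g₂' hρ hρ0 (Prod.map φ₁ φ₂ p)
    (mfderiv I₁ J₁ φ₁ p.1 v.1, mfderiv I₂ J₂ φ₂ p.2 v.2)
    (mfderiv I₁ J₁ φ₁ p.1 w.1, mfderiv I₂ J₂ φ₂ p.2 w.2)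
  have e2' := (congrArg₂ (fun a b : F₁ × F₂ =>
    (warpedMetric g₁' g₂' ρ hρ hρ0).inner (Prod.map φ₁ φ₂ p) a b)
    (mfderiv_prodMap_apply hφ.fst.contMDiff hφ.snd.contMDiff p v)
    (mfderiv_prodMap_apply hφ.fst.contMDiff hφ.snd.contMDiff p w)).trans e2
  have e3 : ∀ a b c d : ℝ, (a + f p.1 ^ 2 * b) - (c + ρ (φ₁ p.1) ^ 2 * d) =
      (a - c) + f p.1 ^ 2 * (b - d) := by
    intro a b c d
    rw [← hw]
    ring
  exact (congrArg₂ (· - ·) e1 e2').trans (e3 _ _ _ _)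

theorem localForm_defect (hφ : IsRiemannianWarpedProductSubmersion g₁ g₂ f g₁' g₂' ρ φ₁ φ₂)
    (hf : ContMDiff I₁ 𝓘(ℝ, ℝ) ∞ f) (hf0 : ∀ x, 0 < f x)
    (hρ : ContMDiff J₁ 𝓘(ℝ, ℝ) ∞ ρ) (hρ0 : ∀ x, 0 < ρ x) (p : M₁ × M₂) {z : E₁ × E₂}
    (hz : z ∈ (extChartAt (I₁.prod I₂) p).target) (v w : E₁ × E₂) :
    localForm (defect (warpedMetric g₁ g₂ f hf hf0) (warpedMetric g₁' g₂' ρ hρ hρ0)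
        (Prod.map φ₁ φ₂)) p z v w =
      localForm (defect g₁ g₁' φ₁) p.1 z.1 v.1 w.1 +
        (f ∘ (extChartAt I₁ p.1).symm) z.1 ^ 2 *
          localForm (defect g₂ g₂' φ₂) p.2 z.2 v.2 w.2 := by
  have e : (extChartAt (I₁.prod I₂) p).symm z =
      ((extChartAt I₁ p.1).symm z.1, (extChartAt I₂ p.2).symm z.2) := by
    rw [extChartAt_prod]
    rfl
  rw [localForm_apply, symmL_prod p hz v, symmL_prod p hz w]
  refine (hφ.defect_apply hf hf0 hρ hρ0 _ _ _).trans ?_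
  rw [e]
  rfl

theorem koszul_defectDeriv (hφ : IsRiemannianWarpedProductSubmersion g₁ g₂ f g₁' g₂' ρ φ₁ φ₂)
    (hf : ContMDiff I₁ 𝓘(ℝ, ℝ) ∞ f) (hf0 : ∀ x, 0 < f x)
    (hρ : ContMDiff J₁ 𝓘(ℝ, ℝ) ∞ ρ) (hρ0 : ∀ x, 0 < ρ x) (p : M₁ × M₂) (u v w : E₁ × E₂) :
    koszul (defectDeriv (warpedMetric g₁ g₂ f hf hf0) (warpedMetric g₁' g₂' ρ hρ hρ0)
        (Prod.map φ₁ φ₂) p) u v w =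
      koszul (defectDeriv g₁ g₁' φ₁ p.1) u.1 v.1 w.1
        + f p.1 ^ 2 * koszul (defectDeriv g₂ g₂' φ₂ p.2) u.2 v.2 w.2
        + f p.1 * (dirDeriv (I := I₁) f p.1 u.1 * defect g₂ g₂' φ₂ p.2 v.2 w.2
          + dirDeriv (I := I₁) f p.1 v.1 * defect g₂ g₂' φ₂ p.2 u.2 w.2
          - dirDeriv (I := I₁) f p.1 w.1 * defect g₂ g₂' φ₂ p.2 u.2 v.2) := by
  have hΦ := (hφ.isRiemannianSubmersion hf hf0 hρ hρ0).contMDiff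
  have hB := (contDiffAt_localForm_defect (warpedMetric g₁ g₂ f hf hf0)
    (warpedMetric g₁' g₂' ρ hρ hρ0) hΦ p).differentiableAt (by simp)
  have hB₁ := (contDiffAt_localForm_defect g₁ g₁' hφ.fst.contMDiff p.1).differentiableAt (by simp)
  have hB₂ := (contDiffAt_localForm_defect g₂ g₂' hφ.snd.contMDiff p.2).differentiableAt (by simp)
  have hF : DifferentiableAt ℝ (f ∘ (extChartAt I₁ p.1).symm) (extChartAt I₁ p.1 p.1) := by
    have h := contDiffAt_chartMap (I' := 𝓘(ℝ, ℝ)) hf (mem_extChartAt_target (I := I₁) p.1)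
      (q := (0 : ℝ)) (by rw [extChartAt_model_space_eq_id]; trivial)
    exact h.differentiableAt (by simp)
  have hFv : ∀ a : E₁, dirDeriv (I := I₁) f p.1 a =
      fderiv ℝ (f ∘ (extChartAt I₁ p.1).symm) (extChartAt I₁ p.1 p.1) a := fun a =>
    mfderiv_eq_fderiv_chart hF EventuallyEq.rfl a
  have hF0 : (f ∘ (extChartAt I₁ p.1).symm) (extChartAt I₁ p.1 p.1) = f p.1 := by simp
  have hk : extChartAt (I₁.prod I₂) p p = (extChartAt I₁ p.1 p.1, extChartAt I₂ p.2 p.2) := by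
    rw [extChartAt_prod]
    rfl
  have hev := Filter.Eventually.mono (extChartAt_target_mem_nhds (I := I₁.prod I₂) p)
    fun z hz v w => hφ.localForm_defect hf hf0 hρ hρ0 p hz v w
  have hd : ∀ u v w : E₁ × E₂, defectDeriv (warpedMetric g₁ g₂ f hf hf0)
      (warpedMetric g₁' g₂' ρ hρ hρ0) (Prod.map φ₁ φ₂) p u v w =
      defectDeriv g₁ g₁' φ₁ p.1 u.1 v.1 w.1
        + 2 * f p.1 * dirDeriv (I := I₁) f p.1 u.1 * defect g₂ g₂' φ₂ p.2 v.2 w.2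
        + f p.1 ^ 2 * defectDeriv g₂ g₂' φ₂ p.2 u.2 v.2 w.2 := by
    intro u v w
    rw [hk] at hB hev
    have h := fderiv_warped hB hB₁ hB₂ hF hev u v w
    rw [hF0, ← hFv, localForm_self] at h
    refine Eq.trans ?_ h
    rw [defectDeriv, hk]
  have hs : ∀ a b : E₂, defect g₂ g₂' φ₂ p.2 a b = defect g₂ g₂' φ₂ p.2 b a :=
    fun a b => defect_symm g₂ g₂' φ₂ p.2 a b
  simp only [koszul]
  rw [hd, hd, hd]
  ring

end IsRiemannianWarpedProductSubmersion

end ProductDefect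

/-! ### Clairaut warped product submersions -/

section Final

theorem IsRiemannianSubmersion.exists_mem_vertical_ne_zero
    {E : Type*} [NormedAddCommGroup E] [NormedSpace ℝ E] [FiniteDimensional ℝ E]
    {H : Type*} [TopologicalSpace H] {I : ModelWithCorners ℝ E H} [I.Boundaryless]
    {M : Type*} [TopologicalSpace M] [ChartedSpace H M] [IsManifold I ∞ M]
    {E' : Type*} [NormedAddCommGroup E'] [NormedSpace ℝ E'] [FiniteDimensional ℝ E']
    {H' : Type*} [TopologicalSpace H'] {I' : ModelWithCorners ℝ E' H'} [I'.Boundaryless]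
    {M' : Type*} [TopologicalSpace M'] [ChartedSpace H' M'] [IsManifold I' ∞ M']
    {g : Metric I M} {g' : Metric I' M'} {φ : M → M'}
    (hφ : IsRiemannianSubmersion I I' g g' φ) (h : finrank ℝ E' < finrank ℝ E) (p : M) :
    ∃ u : TangentSpace I p, u ∈ vertical (I := I) (I' := I') φ p ∧ u ≠ 0 := by
  refine Submodule.exists_mem_ne_zero_of_ne_bot fun h0 => ?_
  have h1 := hφ.finrank_vertical p
  have h2 := Submodule.finrank_eq_zero.2 h0
  omega

variable {E₁ : Type*} [NormedAddCommGroup E₁] [NormedSpace ℝ E₁] [FiniteDimensional ℝ E₁]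
  {H₁ : Type*} [TopologicalSpace H₁] {I₁ : ModelWithCorners ℝ E₁ H₁} [I₁.Boundaryless]
  {M₁ : Type*} [TopologicalSpace M₁] [ChartedSpace H₁ M₁] [IsManifold I₁ ∞ M₁]
  {E₂ : Type*} [NormedAddCommGroup E₂] [NormedSpace ℝ E₂] [FiniteDimensional ℝ E₂]
  {H₂ : Type*} [TopologicalSpace H₂] {I₂ : ModelWithCorners ℝ E₂ H₂} [I₂.Boundaryless]
  {M₂ : Type*} [TopologicalSpace M₂] [ChartedSpace H₂ M₂] [IsManifold I₂ ∞ M₂]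
  {F₁ : Type*} [NormedAddCommGroup F₁] [NormedSpace ℝ F₁] [FiniteDimensional ℝ F₁]
  {K₁ : Type*} [TopologicalSpace K₁] {J₁ : ModelWithCorners ℝ F₁ K₁} [J₁.Boundaryless]
  {N₁ : Type*} [TopologicalSpace N₁] [ChartedSpace K₁ N₁] [IsManifold J₁ ∞ N₁]
  {F₂ : Type*} [NormedAddCommGroup F₂] [NormedSpace ℝ F₂] [FiniteDimensional ℝ F₂]
  {K₂ : Type*} [TopologicalSpace K₂] {J₂ : ModelWithCorners ℝ F₂ K₂} [J₂.Boundaryless]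
  {N₂ : Type*} [TopologicalSpace N₂] [ChartedSpace K₂ N₂] [IsManifold J₂ ∞ N₂]
  {g₁ : Metric I₁ M₁} {g₂ : Metric I₂ M₂} {f : M₁ → ℝ}
  {g₁' : Metric J₁ N₁} {g₂' : Metric J₂ N₂} {ρ : N₁ → ℝ} {φ₁ : M₁ → N₁} {φ₂ : M₂ → N₂}

theorem isRiemannianProduct_of_eq_const (hf : ContMDiff I₁ 𝓘(ℝ, ℝ) ∞ f) (hf0 : ∀ x, 0 < f x)
    (h : ∀ x y, f x = f y) : IsRiemannianProduct (warpedMetric g₁ g₂ f hf hf0) := by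
  rcases isEmpty_or_nonempty M₁ with hM | ⟨⟨x₀⟩⟩
  · exact ⟨g₁, g₂, fun p => (hM.false p.1).elim⟩
  · refine ⟨g₁, scaledMetric g₂ (f x₀ ^ 2) (pow_pos (hf0 x₀) 2), fun p v w => ?_⟩
    rw [scaledMetric_inner, h x₀ p.1]
    exact warpedForm_apply g₁ g₂ f p v w

theorem eq_of_isRiemannianProduct [Nonempty M₂] (hf : ContMDiff I₁ 𝓘(ℝ, ℝ) ∞ f)
    (hf0 : ∀ x, 0 < f x) (hE : 0 < finrank ℝ E₂)
    (h : IsRiemannianProduct (warpedMetric g₁ g₂ f hf hf0)) (x y : M₁) : f x = f y := by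
  obtain ⟨h₁, h₂, hp⟩ := h
  obtain ⟨b⟩ := ‹Nonempty M₂›
  have : Nontrivial E₂ := finrank_pos_iff.1 hE
  obtain ⟨u, hu⟩ := exists_ne (0 : E₂)
  have key : ∀ a : M₁, f a ^ 2 * g₂.inner b u u = h₂.inner b u u := by
    intro a
    have e : ∀ v : TangentSpace (I₁.prod I₂) (a, b),
        g₁.inner a v.1 v.1 + f a ^ 2 * g₂.inner b v.2 v.2 =
          h₁.inner a v.1 v.1 + h₂.inner b v.2 v.2 := by
      intro v
      have := hp (a, b) v v
      rw [tangentFst_apply, tangentSnd_apply] at this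
      exact (warpedMetric_inner g₁ g₂ hf hf0 (a, b) v v).symm.trans this
    have e0 := e ((0, u) : E₁ × E₂)
    have z : ∀ h : Metric I₁ M₁, h.inner a (0 : E₁) (0 : E₁) = 0 := fun h =>
      map_zero (h.inner a (0 : E₁))
    have e1 : g₁.inner a (0 : E₁) (0 : E₁) + f a ^ 2 * g₂.inner b u u =
        h₁.inner a (0 : E₁) (0 : E₁) + h₂.inner b u u := e0
    rw [z, z, zero_add, zero_add] at e1
    exact e1
  have hpos : 0 < g₂.inner b u u := g₂.pos b u hu
  have h2 : f x ^ 2 = f y ^ 2 := mul_right_cancel₀ hpos.ne' ((key x).trans (key y).symm)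
  exact (pow_left_inj₀ (hf0 x).le (hf0 y).le two_ne_zero).1 h2

theorem koszul_zero_zero {E : Type*} [NormedAddCommGroup E] [NormedSpace ℝ E]
    (D : E →L[ℝ] E →L[ℝ] E →L[ℝ] ℝ) (x : E) : koszul D 0 0 x = 0 := by
  simp [koszul]

theorem koszul_zero_right {E : Type*} [NormedAddCommGroup E] [NormedSpace ℝ E]
    (D : E →L[ℝ] E →L[ℝ] E →L[ℝ] ℝ) (u v : E) : koszul D u v 0 = 0 := by
  simp [koszul]

namespace IsRiemannianWarpedProductSubmersion

/-- The warping function is constant along the fibers of `φ₁`. -/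
theorem dirDeriv_vertical (hφ : IsRiemannianWarpedProductSubmersion g₁ g₂ f g₁' g₂' ρ φ₁ φ₂)
    (hρ : ContMDiff J₁ 𝓘(ℝ, ℝ) ∞ ρ) {x : M₁} {u : TangentSpace I₁ x}
    (hu : u ∈ vertical (I := I₁) (I' := J₁) φ₁ x) : dirDeriv (I := I₁) f x u = 0 := by
  have h := mfderiv_comp x (hρ.mdifferentiableAt (x := φ₁ x) (by simp))
    (hφ.fst.contMDiff.mdifferentiableAt (x := x) (by simp))
  have hu' : mfderiv I₁ J₁ φ₁ x u = 0 := hu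
  rw [dirDeriv, hφ.warping, h, ContinuousLinearMap.comp_apply, hu', map_zero]
  rfl

variable {ψ : M₁ × M₂ → ℝ}

/-- The umbilicity equation `IsClairautWith.dirDeriv_horizontal` in terms of the two factors. -/
theorem dirDeriv_mul_inner (hφ : IsRiemannianWarpedProductSubmersion g₁ g₂ f g₁' g₂' ρ φ₁ φ₂)
    (hf : ContMDiff I₁ 𝓘(ℝ, ℝ) ∞ f) (hf0 : ∀ x, 0 < f x)
    (hρ : ContMDiff J₁ 𝓘(ℝ, ℝ) ∞ ρ) (hρ0 : ∀ x, 0 < ρ x)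
    (hψ : ContMDiff (I₁.prod I₂) 𝓘(ℝ, ℝ) ∞ ψ)
    (hc : IsClairautWith (I₁.prod I₂) (J₁.prod J₂) (warpedMetric g₁ g₂ f hf hf0)
      (Prod.map φ₁ φ₂) (fun p => Real.exp (ψ p))) (p : M₁ × M₂) {u₁ x₁ : E₁} {u₂ x₂ : E₂}
    (hu₁ : u₁ ∈ vertical (I := I₁) (I' := J₁) φ₁ p.1)
    (hu₂ : u₂ ∈ vertical (I := I₂) (I' := J₂) φ₂ p.2)
    (hx₁ : x₁ ∈ horizontal I₁ J₁ g₁ φ₁ p.1) (hx₂ : x₂ ∈ horizontal I₂ J₂ g₂ φ₂ p.2) :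
    dirDeriv (I := I₁.prod I₂) ψ p ((x₁, x₂) : E₁ × E₂) *
        (g₁.inner p.1 u₁ u₁ + f p.1 ^ 2 * g₂.inner p.2 u₂ u₂) =
      -koszul (defectDeriv g₁ g₁' φ₁ p.1) u₁ u₁ x₁
        - f p.1 ^ 2 * koszul (defectDeriv g₂ g₂' φ₂ p.2) u₂ u₂ x₂
        + f p.1 * dirDeriv (I := I₁) f p.1 x₁ * g₂.inner p.2 u₂ u₂ := by
  have hΦ := hφ.isRiemannianSubmersion hf hf0 hρ hρ0
  have h := IsClairautWith.dirDeriv_horizontal hΦ hψ hc (p := p)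
    (u := (u₁, u₂)) (x := (x₁, x₂))
    ((mem_vertical_prodMap hφ.fst.contMDiff hφ.snd.contMDiff).2 ⟨hu₁, hu₂⟩)
    ((mem_horizontal_prodMap hφ.fst.contMDiff hφ.snd.contMDiff hf hf0).2 ⟨hx₁, hx₂⟩)
  have hK := hφ.koszul_defectDeriv hf hf0 hρ hρ0 p (u₁, u₂) (u₁, u₂) (x₁, x₂)
  have hD : defect g₂ g₂' φ₂ p.2 u₂ u₂ = g₂.inner p.2 u₂ u₂ := defect_vertical g₂ g₂' hu₂ _
  have hD0 : defect g₂ g₂' φ₂ p.2 u₂ x₂ = 0 :=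
    (defect_symm g₂ g₂' φ₂ p.2 u₂ x₂).trans (hφ.snd.defect_horizontal hx₂ u₂)
  have hG := warpedMetric_inner g₁ g₂ hf hf0 p (u₁, u₂) (u₁, u₂)
  rw [hG, hK] at h
  refine h.trans ?_
  simp only
  rw [hD0, hD]
  ring

/-- If `φ₂` has a fiber of positive dimension, then `∇ψ` and `∇ log f` have the same component
along the horizontal space of `φ₁`. -/
theorem dirDeriv_fst
    (hφ : IsRiemannianWarpedProductSubmersion g₁ g₂ f g₁' g₂' ρ φ₁ φ₂)
    (hf : ContMDiff I₁ 𝓘(ℝ, ℝ) ∞ f) (hf0 : ∀ x, 0 < f x)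
    (hρ : ContMDiff J₁ 𝓘(ℝ, ℝ) ∞ ρ) (hρ0 : ∀ x, 0 < ρ x)
    (hψ : ContMDiff (I₁.prod I₂) 𝓘(ℝ, ℝ) ∞ ψ)
    (hc : IsClairautWith (I₁.prod I₂) (J₁.prod J₂) (warpedMetric g₁ g₂ f hf hf0)
      (Prod.map φ₁ φ₂) (fun p => Real.exp (ψ p))) (p : M₁ × M₂)
    {u₂ : E₂} (hu₂ : u₂ ∈ vertical (I := I₂) (I' := J₂) φ₂ p.2) (h0 : u₂ ≠ 0)
    {x₁ : E₁} (hx₁ : x₁ ∈ horizontal I₁ J₁ g₁ φ₁ p.1) :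
    dirDeriv (I := I₁.prod I₂) ψ p ((x₁, 0) : E₁ × E₂) * f p.1 =
      dirDeriv (I := I₁) f p.1 x₁ := by
  have h := hφ.dirDeriv_mul_inner hf hf0 hρ hρ0 hψ hc p (u₁ := 0) (x₂ := 0)
    (Submodule.zero_mem _) hu₂ hx₁ (Submodule.zero_mem _)
  have z : g₁.inner p.1 (0 : E₁) (0 : E₁) = 0 := map_zero (g₁.inner p.1 (0 : E₁))
  rw [koszul_zero_zero, koszul_zero_right, z] at h
  have hq : g₂.inner p.2 u₂ u₂ ≠ 0 := (g₂.pos p.2 u₂ h0).ne'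
  have hfp := (hf0 p.1).ne'
  have e : ∀ a b q c : ℝ, q ≠ 0 → c ≠ 0 → a * (0 + c ^ 2 * q) = -0 - c ^ 2 * 0 + c * b * q →
      a * c = b := by
    intro a b q c hq hc h
    have : (c * q) * (a * c) = (c * q) * b := by linarith
    exact mul_left_cancel₀ (mul_ne_zero hc hq) this
  exact e _ _ _ _ hq hfp h

/-- If `φ₁` has a fiber of positive dimension, then `∇ψ` has no component along the horizontal
space of `φ₂`. -/
theorem dirDeriv_snd
    (hφ : IsRiemannianWarpedProductSubmersion g₁ g₂ f g₁' g₂' ρ φ₁ φ₂)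
    (hf : ContMDiff I₁ 𝓘(ℝ, ℝ) ∞ f) (hf0 : ∀ x, 0 < f x)
    (hρ : ContMDiff J₁ 𝓘(ℝ, ℝ) ∞ ρ) (hρ0 : ∀ x, 0 < ρ x)
    (hψ : ContMDiff (I₁.prod I₂) 𝓘(ℝ, ℝ) ∞ ψ)
    (hc : IsClairautWith (I₁.prod I₂) (J₁.prod J₂) (warpedMetric g₁ g₂ f hf hf0)
      (Prod.map φ₁ φ₂) (fun p => Real.exp (ψ p))) (p : M₁ × M₂)
    {u₁ : E₁} (hu₁ : u₁ ∈ vertical (I := I₁) (I' := J₁) φ₁ p.1) (h0 : u₁ ≠ 0)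
    {x₂ : E₂} (hx₂ : x₂ ∈ horizontal I₂ J₂ g₂ φ₂ p.2) :
    dirDeriv (I := I₁.prod I₂) ψ p ((0, x₂) : E₁ × E₂) = 0 := by
  have h := hφ.dirDeriv_mul_inner hf hf0 hρ hρ0 hψ hc p (u₂ := 0) (x₁ := 0)
    hu₁ (Submodule.zero_mem _) (Submodule.zero_mem _) hx₂
  have z : g₂.inner p.2 (0 : E₂) (0 : E₂) = 0 := map_zero (g₂.inner p.2 (0 : E₂))
  rw [koszul_zero_zero, koszul_zero_right, z] at h
  have hq : g₁.inner p.1 u₁ u₁ ≠ 0 := (g₁.pos p.1 u₁ h0).ne'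
  have e : ∀ a b q c : ℝ, q ≠ 0 → a * (q + c ^ 2 * 0) = -0 - c ^ 2 * 0 + c * b * 0 → a = 0 := by
    intro a b q c hq h
    have : a * q = 0 := by linarith
    exact (mul_eq_zero.1 this).resolve_right hq
  exact e _ _ _ _ hq h

/-- If `∇ψ = 0`, then the fibers of `φ₁` are minimal. -/
theorem meanCurvature_fst_eq_zero
    (hφ : IsRiemannianWarpedProductSubmersion g₁ g₂ f g₁' g₂' ρ φ₁ φ₂)
    (hf : ContMDiff I₁ 𝓘(ℝ, ℝ) ∞ f) (hf0 : ∀ x, 0 < f x)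
    (hρ : ContMDiff J₁ 𝓘(ℝ, ℝ) ∞ ρ) (hρ0 : ∀ x, 0 < ρ x)
    (hψ : ContMDiff (I₁.prod I₂) 𝓘(ℝ, ℝ) ∞ ψ)
    (hc : IsClairautWith (I₁.prod I₂) (J₁.prod J₂) (warpedMetric g₁ g₂ f hf hf0)
      (Prod.map φ₁ φ₂) (fun p => Real.exp (ψ p))) (p : M₁ × M₂)
    (h0 : ∀ v : E₁ × E₂, dirDeriv (I := I₁.prod I₂) ψ p v = 0) :
    meanCurvature I₁ J₁ g₁ φ₁ p.1 = 0 := by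
  refine hφ.fst.meanCurvature_eq_zero p.1 fun u x hu hx => ?_
  have h := hφ.dirDeriv_mul_inner hf hf0 hρ hρ0 hψ hc p (u₂ := 0) (x₂ := 0)
    hu (Submodule.zero_mem _) hx (Submodule.zero_mem _)
  have z : g₂.inner p.2 (0 : E₂) (0 : E₂) = 0 := map_zero (g₂.inner p.2 (0 : E₂))
  rw [koszul_zero_zero, z, h0] at h
  linarith

/-- If `∇ψ = 0` and `φ₂` has fibers of positive dimension, then the warping function has
vanishing derivative. -/
theorem dirDeriv_warping_eq_zero [Nonempty M₂]
    (hφ : IsRiemannianWarpedProductSubmersion g₁ g₂ f g₁' g₂' ρ φ₁ φ₂)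
    (hf : ContMDiff I₁ 𝓘(ℝ, ℝ) ∞ f) (hf0 : ∀ x, 0 < f x)
    (hρ : ContMDiff J₁ 𝓘(ℝ, ℝ) ∞ ρ) (hρ0 : ∀ x, 0 < ρ x)
    (hψ : ContMDiff (I₁.prod I₂) 𝓘(ℝ, ℝ) ∞ ψ)
    (hc : IsClairautWith (I₁.prod I₂) (J₁.prod J₂) (warpedMetric g₁ g₂ f hf hf0)
      (Prod.map φ₁ φ₂) (fun p => Real.exp (ψ p))) (hk : finrank ℝ F₂ < finrank ℝ E₂)
    (h0 : ∀ p (v : TangentSpace (I₁.prod I₂) p), dirDeriv (I := I₁.prod I₂) ψ p v = 0)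
    (x : M₁) (v : TangentSpace I₁ x) : dirDeriv (I := I₁) f x v = 0 := by
  obtain ⟨y⟩ := ‹Nonempty M₂›
  obtain ⟨u, hu, hu0⟩ := hφ.snd.exists_mem_vertical_ne_zero hk y
  have h := hφ.dirDeriv_fst hf hf0 hρ hρ0 hψ hc (x, y) hu hu0
    (horizontalProj_mem (I' := J₁) g₁ φ₁ x v)
  have h1 := hφ.dirDeriv_vertical hρ (verticalProj_mem (I' := J₁) g₁ φ₁ x v)
  have h2 : dirDeriv (I := I₁) f x (horizontalProj I₁ J₁ g₁ φ₁ x v) = 0 :=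
    h.symm.trans ((congrArg (· * f x) (h0 (x, y) _)).trans (zero_mul _))
  have h3 := congrArg (mfderiv I₁ 𝓘(ℝ, ℝ) f x)
    (verticalProj_add_horizontalProj (I' := J₁) g₁ φ₁ x v)
  rw [map_add] at h3
  exact (h3.symm.trans (congrArg₂ (fun a b : ℝ => a + b) h1 h2)).trans (add_zero 0)

/-- If the warping function has vanishing derivative and both factors have fibers of positive
dimension, then `∇ψ = 0`. -/
theorem dirDeriv_eq_zero
    (hφ : IsRiemannianWarpedProductSubmersion g₁ g₂ f g₁' g₂' ρ φ₁ φ₂)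
    (hf : ContMDiff I₁ 𝓘(ℝ, ℝ) ∞ f) (hf0 : ∀ x, 0 < f x)
    (hρ : ContMDiff J₁ 𝓘(ℝ, ℝ) ∞ ρ) (hρ0 : ∀ x, 0 < ρ x)
    (hψ : ContMDiff (I₁.prod I₂) 𝓘(ℝ, ℝ) ∞ ψ)
    (hc : IsClairautWith (I₁.prod I₂) (J₁.prod J₂) (warpedMetric g₁ g₂ f hf hf0)
      (Prod.map φ₁ φ₂) (fun p => Real.exp (ψ p)))
    (hk₁ : finrank ℝ F₁ < finrank ℝ E₁) (hk₂ : finrank ℝ F₂ < finrank ℝ E₂)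
    (h0 : ∀ x (v : TangentSpace I₁ x), dirDeriv (I := I₁) f x v = 0)
    (p : M₁ × M₂) (v : TangentSpace (I₁.prod I₂) p) : dirDeriv (I := I₁.prod I₂) ψ p v = 0 := by
  have hΦ := hφ.isRiemannianSubmersion hf hf0 hρ hρ0
  obtain ⟨u₁, hu₁, hu₁0⟩ := hφ.fst.exists_mem_vertical_ne_zero hk₁ p.1
  obtain ⟨u₂, hu₂, hu₂0⟩ := hφ.snd.exists_mem_vertical_ne_zero hk₂ p.2
  obtain ⟨X, hX⟩ : ∃ X : E₁ × E₂, X = horizontalProj (I₁.prod I₂) (J₁.prod J₂)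
    (warpedMetric g₁ g₂ f hf hf0) (Prod.map φ₁ φ₂) p v := ⟨_, rfl⟩
  have hXm : (X : TangentSpace (I₁.prod I₂) p) ∈ horizontal (I₁.prod I₂) (J₁.prod J₂)
      (warpedMetric g₁ g₂ f hf hf0) (Prod.map φ₁ φ₂) p := by
    rw [hX]
    exact horizontalProj_mem _ _ _ _
  obtain ⟨hX₁, hX₂⟩ := (mem_horizontal_prodMap hφ.fst.contMDiff hφ.snd.contMDiff hf hf0).1 hXm
  have h1 := IsClairautWith.dirDeriv_vertical hΦ hψ hc
    (verticalProj_mem (I' := J₁.prod J₂) (warpedMetric g₁ g₂ f hf hf0) (Prod.map φ₁ φ₂) p v)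
  have h2 : dirDeriv (I := I₁.prod I₂) ψ p ((X.1, 0) : E₁ × E₂) = 0 :=
    (mul_eq_zero.1 ((hφ.dirDeriv_fst hf hf0 hρ hρ0 hψ hc p hu₂ hu₂0 hX₁).trans
      (h0 _ _))).resolve_right (hf0 p.1).ne'
  have h3 := hφ.dirDeriv_snd hf hf0 hρ hρ0 hψ hc p hu₁ hu₁0 hX₂
  have e : ∀ A : E₁ × E₂ →L[ℝ] ℝ, A (X.1, 0) = 0 → A (0, X.2) = 0 → A X = 0 := by
    intro A a b
    have hs : X = (X.1, 0) + (0, X.2) := by simp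
    rw [hs, map_add, a, b, add_zero]
  have h4 := e _ h2 h3
  rw [hX] at h4
  have h5 := congrArg (mfderiv (I₁.prod I₂) 𝓘(ℝ, ℝ) ψ p) (verticalProj_add_horizontalProj
    (I' := J₁.prod J₂) (warpedMetric g₁ g₂ f hf hf0) (Prod.map φ₁ φ₂) p v)
  rw [map_add] at h5
  exact (h5.symm.trans (congrArg₂ (fun a b : ℝ => a + b) h1 h4)).trans (add_zero 0)

end IsRiemannianWarpedProductSubmersion

end Final
end ClairautWarped

end

open scoped Manifold ContDiff in
theorem proposition4p1
    -- the source `M = M₁ ×_f M₂`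
    {E₁ : Type*} [NormedAddCommGroup E₁] [NormedSpace ℝ E₁] [FiniteDimensional ℝ E₁]
    {M₁ : Type*} [TopologicalSpace M₁] [T2Space M₁] [ChartedSpace E₁ M₁] [IsManifold 𝓘(ℝ, E₁) ∞ M₁]
    {E₂ : Type*} [NormedAddCommGroup E₂] [NormedSpace ℝ E₂] [FiniteDimensional ℝ E₂]
    {M₂ : Type*} [TopologicalSpace M₂] [T2Space M₂] [ChartedSpace E₂ M₂] [IsManifold 𝓘(ℝ, E₂) ∞ M₂]
    [Nonempty M₂]
    (g₁ : ClairautWarped.Metric 𝓘(ℝ, E₁) M₁) (g₂ : ClairautWarped.Metric 𝓘(ℝ, E₂) M₂)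
    (f : M₁ → ℝ) (hf : ContMDiff 𝓘(ℝ, E₁) 𝓘(ℝ, ℝ) ∞ f) (hf0 : ∀ x, 0 < f x)
    -- the target `N = N₁ ×_ρ N₂`
    {F₁ : Type*} [NormedAddCommGroup F₁] [NormedSpace ℝ F₁] [FiniteDimensional ℝ F₁]
    {N₁ : Type*} [TopologicalSpace N₁] [T2Space N₁] [ChartedSpace F₁ N₁] [IsManifold 𝓘(ℝ, F₁) ∞ N₁]
    {F₂ : Type*} [NormedAddCommGroup F₂] [NormedSpace ℝ F₂] [FiniteDimensional ℝ F₂]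
    {N₂ : Type*} [TopologicalSpace N₂] [T2Space N₂] [ChartedSpace F₂ N₂] [IsManifold 𝓘(ℝ, F₂) ∞ N₂]
    (g₁' : ClairautWarped.Metric 𝓘(ℝ, F₁) N₁) (g₂' : ClairautWarped.Metric 𝓘(ℝ, F₂) N₂)
    (ρ : N₁ → ℝ) (hρ : ContMDiff 𝓘(ℝ, F₁) 𝓘(ℝ, ℝ) ∞ ρ) (hρ0 : ∀ x, 0 < ρ x)
    -- the submersion `φ = (φ₁, φ₂)`, Clairaut with `r = e^ψ`
    (φ₁ : M₁ → N₁) (φ₂ : M₂ → N₂)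
    (hφ : ClairautWarped.IsRiemannianWarpedProductSubmersion g₁ g₂ f g₁' g₂' ρ φ₁ φ₂)
    (ψ : M₁ × M₂ → ℝ) (hψ : ContMDiff (𝓘(ℝ, E₁).prod 𝓘(ℝ, E₂)) 𝓘(ℝ, ℝ) ∞ ψ)
    (hclairaut : ClairautWarped.IsClairautWith
      (𝓘(ℝ, E₁).prod 𝓘(ℝ, E₂)) (𝓘(ℝ, F₁).prod 𝓘(ℝ, F₂))
      (ClairautWarped.warpedMetric g₁ g₂ f hf hf0) (Prod.map φ₁ φ₂) (fun p => Real.exp (ψ p))) :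
    -- harmonic iff `H₁ = 0 = ∇ψ` or `m₁ - n₁ = m₂ - n₂ = 0`
    (ClairautWarped.IsHarmonic (ClairautWarped.warpedMetric g₁ g₂ f hf hf0)
        (ClairautWarped.warpedMetric g₁' g₂' ρ hρ hρ0) (Prod.map φ₁ φ₂) ↔
      ((∀ x, ClairautWarped.meanCurvature 𝓘(ℝ, E₁) 𝓘(ℝ, F₁) g₁ φ₁ x = 0) ∧
        (∀ p, ClairautWarped.gradient (ClairautWarped.warpedMetric g₁ g₂ f hf hf0) ψ p = 0)) ∨
      ((Module.finrank ℝ E₁ : ℤ) - Module.finrank ℝ F₁ = 0 ∧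
        (Module.finrank ℝ E₂ : ℤ) - Module.finrank ℝ F₂ = 0)) ∧
    -- if `M₁` is connected and the fibers of `φ₁`, `φ₂` are both or neither of dimension zero:
    -- harmonic iff `M` is a Riemannian product or `dim Mᵢ = dim Nᵢ`
    (PreconnectedSpace M₁ →
      (Module.finrank ℝ E₁ = Module.finrank ℝ F₁ ↔ Module.finrank ℝ E₂ = Module.finrank ℝ F₂) →
      (ClairautWarped.IsHarmonic (ClairautWarped.warpedMetric g₁ g₂ f hf hf0)
          (ClairautWarped.warpedMetric g₁' g₂' ρ hρ hρ0) (Prod.map φ₁ φ₂) ↔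
        ClairautWarped.IsRiemannianProduct (ClairautWarped.warpedMetric g₁ g₂ f hf hf0) ∨
        (Module.finrank ℝ E₁ = Module.finrank ℝ F₁ ∧
          Module.finrank ℝ E₂ = Module.finrank ℝ F₂))) ∧
    -- if only the fibers of `φ₂` have positive dimension, one direction remains
    (PreconnectedSpace M₁ → Module.finrank ℝ F₂ < Module.finrank ℝ E₂ →
      ClairautWarped.IsHarmonic (ClairautWarped.warpedMetric g₁ g₂ f hf hf0)
          (ClairautWarped.warpedMetric g₁' g₂' ρ hρ hρ0) (Prod.map φ₁ φ₂) →
      ClairautWarped.IsRiemannianProduct (ClairautWarped.warpedMetric g₁ g₂ f hf hf0)) := by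
  have hΦ := hφ.isRiemannianSubmersion hf hf0 hρ hρ0
  have hharm := ClairautWarped.IsClairautWith.isHarmonic_iff hΦ hψ hclairaut
  have hle₂ : Module.finrank ℝ F₂ ≤ Module.finrank ℝ E₂ := by
    have := hφ.snd.finrank_vertical (Classical.arbitrary M₂)
    omega
  have hprod : Module.finrank ℝ (E₁ × E₂) = Module.finrank ℝ (F₁ × F₂) ↔
      Module.finrank ℝ E₁ + Module.finrank ℝ E₂ = Module.finrank ℝ F₁ + Module.finrank ℝ F₂ := by
    rw [Module.finrank_prod, Module.finrank_prod]
  have hdims : IsEmpty M₁ ∨ Module.finrank ℝ F₁ ≤ Module.finrank ℝ E₁ := by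
    rcases isEmpty_or_nonempty M₁ with hM | ⟨⟨x⟩⟩
    · exact Or.inl hM
    · refine Or.inr ?_
      have := hφ.fst.finrank_vertical x
      omega
  have hempty : IsEmpty M₁ → ClairautWarped.IsHarmonic (ClairautWarped.warpedMetric g₁ g₂ f hf hf0)
      (ClairautWarped.warpedMetric g₁' g₂' ρ hρ hρ0) (Prod.map φ₁ φ₂) := fun hM p =>
    (hM.false p.1).elim
  have hc : PreconnectedSpace M₁ → Module.finrank ℝ F₂ < Module.finrank ℝ E₂ →
      ClairautWarped.IsHarmonic (ClairautWarped.warpedMetric g₁ g₂ f hf hf0)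
          (ClairautWarped.warpedMetric g₁' g₂' ρ hρ hρ0) (Prod.map φ₁ φ₂) →
      ClairautWarped.IsRiemannianProduct (ClairautWarped.warpedMetric g₁ g₂ f hf hf0) := by
    intro hM hk hh
    refine ClairautWarped.isRiemannianProduct_of_eq_const hf hf0 fun x y => ?_
    have h0 := (hharm.1 hh).resolve_left fun h => by
      rcases hdims with hM | hle
      · exact hM.false x
      · have := hprod.1 h
        omega
    exact ClairautWarped.apply_eq_of_dirDeriv_eq_zero hf
      (hφ.dirDeriv_warping_eq_zero hf hf0 hρ hρ0 hψ hclairaut hk h0) x y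
  refine ⟨⟨fun hh => ?_, ?_⟩, fun hM hiff => ⟨fun hh => ?_, ?_⟩, hc⟩
  -- if `M₁` is empty, the dimensions are unrelated, but the first alternative holds vacuously
  · rcases isEmpty_or_nonempty M₁ with hM | ⟨⟨x⟩⟩
    · exact Or.inl ⟨fun x => (hM.false x).elim, fun p => (hM.false p.1).elim⟩
    rcases hharm.1 hh with h | h
    · have h1 := hprod.1 h
      have h2 := hdims.resolve_left fun hM => hM.false x
      exact Or.inr ⟨by omega, by omega⟩
    · refine Or.inl ⟨fun x => ?_, fun p => (ClairautWarped.gradient_eq_zero_iff _ ψ p).2 (h p)⟩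
      exact hφ.meanCurvature_fst_eq_zero hf hf0 hρ hρ0 hψ hclairaut (x, Classical.arbitrary M₂)
        (h _)
  · rintro (⟨-, h⟩ | ⟨h₁, h₂⟩)
    · exact hharm.2 (Or.inr fun p => (ClairautWarped.gradient_eq_zero_iff _ ψ p).1 (h p))
    · exact hharm.2 (Or.inl (hprod.2 (by omega)))
  · rcases hle₂.lt_or_eq with hk | hk
    · exact Or.inl (hc hM hk hh)
    · exact Or.inr ⟨hiff.2 hk.symm, hk.symm⟩
  · rintro (h | ⟨h₁, h₂⟩)
    · rcases hdims with hM₁ | hle₁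
      · exact hempty hM₁
      rcases hle₂.lt_or_eq with hk | hk
      · have hk₁ : Module.finrank ℝ F₁ < Module.finrank ℝ E₁ := by omega
        have hconst := ClairautWarped.eq_of_isRiemannianProduct hf hf0 (by omega) h
        have hdf : ∀ x (v : TangentSpace 𝓘(ℝ, E₁) x), ClairautWarped.dirDeriv f x v = 0 := by
          intro x v
          have e : f = fun _ => f x := funext fun y => hconst y x
          have e' := mfderiv_const (I := 𝓘(ℝ, E₁)) (I' := 𝓘(ℝ, ℝ)) (c := f x) (x := x)
          rw [← e] at e'
          exact DFunLike.congr_fun e' v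
        exact hharm.2 (Or.inr (hφ.dirDeriv_eq_zero hf hf0 hρ hρ0 hψ hclairaut hk₁ hk hdf))
      · exact hharm.2 (Or.inl (hprod.2 (by have := hiff.2 hk.symm; omega)))
    · exact hharm.2 (Or.inl (hprod.2 (by omega)))
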